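/- Let $N\ge 1$, $p>1$, and let $\phi_N(x)=(2\pi)^{-N/2}e^{-|x|^2/2}$, $d\gamma_N=\phi_N\,dx$ on $\mathbb R^N$. For an open set $\Omega\subset\mathbb R^N$ let $W^{1,p}(\Omega,\phi_N)$ be the space of $w\in W^{1,1}_{loc}(\Omega)$ with $w,|Dw|\in L^p(\Omega,\gamma_N)$, normed by $\|w\|_{L^p(\Omega,\gamma_N)}+\|Dw\|_{L^p(\Omega,\gamma_N)}$, and let $W_0^{1,p}(\Omega,\phi_N)$ be the closure of $C_0^\infty(\Omega)$ in it. Set $$Q_p(\alpha,\Omega)=\sup_{w\in W_0^{1,p}(\Omega,\phi_N)}\Big\{-\int_\Omega|Dw|^p\,d\gamma_N+\alpha\int_\Omega|w|^p\,d\gamma_N+p\int_\Omega w\,d\gamma_N\Big\},\qquad \lambda_1(\Omega)=\inf_{w\in W_0^{1,p}(\Omega,\phi_N)\setminus\{0\}}\frac{\int_\Omega|Dw|^p\,d\gamma_N}{\int_\Omega|w|^p\,d\gamma_N}.$$ For $t\in\mathbb R$ let $H_t=\{x\in\mathbb R^N: x_1<t\}$ and $Q_p^\sharp(\alpha,t)=Q_p(\alpha,H_t)$.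 Fix $\alpha\in\mathbb R$ and let $D_\alpha=\{t\in\mathbb R:\alpha<\lambda_1(H_t)\}$. Then $Q_p^\sharp(\alpha,t)$ is finite for every $t\in D_\alpha$, and $t\mapsto Q_p^\sharp(\alpha,t)$ is strictly increasing on $D_\alpha$. Moreover, for every $t\in D_\alpha$ there is a unique (up to equality a.e.) $v\in W_0^{1,p}((-\infty,t),\phi_1)$ with $$\int_{-\infty}^t|v'|^{p-2}v'\psi'\,d\gamma_1=\alpha\int_{-\infty}^t|v|^{p-2}v\,\psi\,d\gamma_1+\int_{-\infty}^t\psi\,d\gamma_1\qquad\text{for all }\psi\in W_0^{1,p}((-\infty,t),\phi_1);$$ it is nonnegative, it has a representative that is continuous on $(-\infty,t]$ and has a left derivative $v'(t)$ at $t$, $Q_p^\sharp(\alpha,\cdot)$ is finite near $t$ and differentiable at $t$, and $$\frac{\partial}{\partial t}Q_p^\sharp(\alpha,t)=(p-1)\,|v'(t)|^p\,\phi_1(t).$$ -/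

import Mathlib

open MeasureTheory Set Filter Topology

noncomputable section

/-- The Gaussian density `φ_N(x) = (2π)^{-N/2} exp(-|x|²/2)`, where `N` is the dimension of `E`. -/
def gaussDensity {E : Type*} [NormedAddCommGroup E] [InnerProductSpace ℝ E] (x : E) : ℝ :=
  1 / (2 * Real.pi) ^ ((Module.finrank ℝ E : ℝ) / 2) * Real.exp (-(‖x‖ ^ 2) / 2)

/-- The Gaussian measure `dγ_N = φ_N(x) dx`. -/
def gaussMeasure (E : Type*) [NormedAddCommGroup E] [InnerProductSpace ℝ E] [MeasureSpace E] :
    Measure E :=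
  (volume : Measure E).withDensity (fun x => ENNReal.ofReal (gaussDensity x))

/-- `C_0^∞(Ω)`: smooth functions with compact support contained in `Ω`. -/
def IsTestFunction {E : Type*} [NormedAddCommGroup E] [InnerProductSpace ℝ E]
    (Ω : Set E) (φ : E → ℝ) : Prop :=
  ContDiff ℝ (⊤ : ℕ∞) φ ∧ HasCompactSupport φ ∧ tsupport φ ⊆ Ω

/-- `u ∈ W^{1,1}_loc(Ω)` with weak gradient `G`. -/
def HasWeakGradientOn {E : Type*} [NormedAddCommGroup E] [InnerProductSpace ℝ E] [MeasureSpace E]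
    (Ω : Set E) (u : E → ℝ) (G : E → E) : Prop :=
  LocallyIntegrableOn u Ω volume ∧ LocallyIntegrableOn G Ω volume ∧
    ∀ φ : E → ℝ, IsTestFunction Ω φ → ∀ e : E,
      ∫ x in Ω, u x * fderiv ℝ φ x e = -∫ x in Ω, φ x * inner ℝ (G x) e

/-- `u ∈ W^{1,p}(Ω, φ_N)` with weak gradient `G`. -/
def MemGaussSobolev {E : Type*} [NormedAddCommGroup E] [InnerProductSpace ℝ E] [MeasureSpace E]
    (p : ℝ) (Ω : Set E) (u : E → ℝ) (G : E → E) : Prop :=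
  HasWeakGradientOn Ω u G ∧
    MemLp u (ENNReal.ofReal p) ((gaussMeasure E).restrict Ω) ∧
    MemLp G (ENNReal.ofReal p) ((gaussMeasure E).restrict Ω)

/-- `u ∈ W_0^{1,p}(Ω, φ_N)` with weak gradient `G`: the closure of `C_0^∞(Ω)` in
`W^{1,p}(Ω, φ_N)` for the norm `‖u‖_{L^p(Ω, φ_N)} + ‖Du‖_{L^p(Ω, φ_N)}`. -/
def MemGaussSobolevZero {E : Type*} [NormedAddCommGroup E] [InnerProductSpace ℝ E]
    [CompleteSpace E] [MeasureSpace E]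
    (p : ℝ) (Ω : Set E) (u : E → ℝ) (G : E → E) : Prop :=
  MemGaussSobolev p Ω u G ∧
    ∀ ε : ENNReal, 0 < ε → ∃ φ : E → ℝ, IsTestFunction Ω φ ∧
      eLpNorm (fun x => u x - φ x) (ENNReal.ofReal p) ((gaussMeasure E).restrict Ω) +
        eLpNorm (fun x => G x - gradient φ x) (ENNReal.ofReal p)
          ((gaussMeasure E).restrict Ω) < ε

/-- The functional `F_α(w) = -∫_Ω |Dw|^p dγ + α ∫_Ω |w|^p dγ + p ∫_Ω w dγ`,
evaluated at `w = u`, `Dw = G`. -/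
def torsionFunctional {E : Type*} [NormedAddCommGroup E] [InnerProductSpace ℝ E] [MeasureSpace E]
    (p α : ℝ) (Ω : Set E) (u : E → ℝ) (G : E → E) : ℝ :=
  -(∫ x in Ω, ‖G x‖ ^ p ∂(gaussMeasure E)) + α * (∫ x in Ω, |u x| ^ p ∂(gaussMeasure E))
    + p * ∫ x in Ω, u x ∂(gaussMeasure E)

/-- The generalized torsional rigidity `Q_p(α, Ω) ∈ [-∞, +∞]`: the supremum of `F_α` over
`W_0^{1,p}(Ω, φ_N)`. -/
def genTorsionalRigidity {E : Type*} [NormedAddCommGroup E] [InnerProductSpace ℝ E]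
    [CompleteSpace E] [MeasureSpace E] (p α : ℝ) (Ω : Set E) : EReal :=
  ⨆ (u : E → ℝ) (G : E → E) (_ : MemGaussSobolevZero p Ω u G),
    ((torsionFunctional p α Ω u G : ℝ) : EReal)

/-- The first eigenvalue `λ_1(Ω)`: the infimum of the Rayleigh quotient
`∫_Ω |Dw|^p dγ / ∫_Ω |w|^p dγ` over `w ∈ W_0^{1,p}(Ω, φ_N) \ {0}`. -/
def firstEigenvalue {E : Type*} [NormedAddCommGroup E] [InnerProductSpace ℝ E]
    [CompleteSpace E] [MeasureSpace E] (p : ℝ) (Ω : Set E) : ℝ :=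
  sInf {r : ℝ | ∃ (u : E → ℝ) (G : E → E), MemGaussSobolevZero p Ω u G ∧
    ¬ (u =ᵐ[(gaussMeasure E).restrict Ω] 0) ∧
    r = (∫ x in Ω, ‖G x‖ ^ p ∂(gaussMeasure E)) / ∫ x in Ω, |u x| ^ p ∂(gaussMeasure E)}

/-- `v` is a weak solution of `-div(φ_N |Dv|^{p-2} Dv) = α φ_N |v|^{p-2} v + φ_N` in `Ω`,
`v ∈ W_0^{1,p}(Ω, φ_N)`. -/
def IsGenTorsionFunction {E : Type*} [NormedAddCommGroup E] [InnerProductSpace ℝ E]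
    [CompleteSpace E] [MeasureSpace E] (p α : ℝ) (Ω : Set E) (v : E → ℝ) : Prop :=
  ∃ G : E → E, MemGaussSobolevZero p Ω v G ∧
    ∀ (ψ : E → ℝ) (Ψ : E → E), MemGaussSobolevZero p Ω ψ Ψ →
      ∫ x in Ω, ‖G x‖ ^ (p - 2) * inner ℝ (G x) (Ψ x) ∂(gaussMeasure E) =
        α * (∫ x in Ω, |v x| ^ (p - 2) * v x * ψ x ∂(gaussMeasure E))
          + ∫ x in Ω, ψ x ∂(gaussMeasure E)

/-- The half-space `H_t = {x ∈ ℝ^N : x_1 < t}`. -/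
def halfSpace (N : ℕ) [NeZero N] (t : ℝ) : Set (EuclideanSpace ℝ (Fin N)) :=
  {x | x 0 < t}

/-- `Q_p^♯(α, t) = Q_p(α, H_t)`. -/
def genTorsionSharp (N : ℕ) [NeZero N] (p α t : ℝ) : EReal :=
  genTorsionalRigidity p α (halfSpace N t)

end

/-! ### The Gaussian density and measure -/

section GaussBasic

variable {E : Type*} [NormedAddCommGroup E] [InnerProductSpace ℝ E]

/-! The problem collapses to one dimension, where the equation can be integrated once. On a
half-line, `W_0^{1,p}` consists exactly of the `L^p` functions that are, up to a null set,
primitives vanishing at `t` of an `L^p` gradient (`ae_eq_neg_integral_of_tendsto`,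
`memGaussSobolevZero_of_ae_eq`). Testing with primitives of indicators then turns the weak equation
into the integrated one: `-φ |v'|^{p-2} v'` at `y` is the flux `∫_{-∞}^y (α |v|^{p-2} v + 1) dγ`
(`IsRegularSolution`, `IsGenTorsionFunction.exists_regular`). The continuous representative, the
one-sided derivative at `t` and the formula for that derivative can all be read off from this form.

The central tool is Picone's inequality. If `u` is a nonnegative solution, it is positive inside,
and for a test function `w` the test function `|w|^p u^{1-p}` gives `F_α(w) ≤ ∫ (p w - |w|^p
u^{1-p}) dγ`. The integrand is at most `(p-1) u`, with equality for nonnegative `w` only at `w = u`.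
Hence `Q = (p-1) ∫ u dγ` (`IsRegularSolution.genTorsionalRigidity_eq`), and nonnegative solutions
are unique (`IsRegularSolution.unique`). No convexity of the functional is needed, so this works for
`α > 0` as well. Below the first eigenvalue every solution is nonnegative, by testing with its
negative part (`IsRegularSolution.nonneg_of_rayleigh`), so uniqueness holds without a sign
assumption.

Existence depends on the sign of `α`. For `α ≥ 0` the source is nondecreasing in the unknown, and a
monotone iteration from zero converges as soon as it is bounded in `L^p`; the Rayleigh bound or any
`L^p` supersolution provides this. A supersolution built from a solution with a slightly larger
parameter also gives solvability a little beyond `t` (`IsRegularSolution.exists_gt`). For `α < 0`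
the functional is strictly concave and coercive, and the direct method applies (`exists_maximizer`).
Solutions increase with the end point: for `α ≥ 0` because the iteration stays below the larger
solution, for `α ≤ 0` by following the difference of fluxes (`IsRegularSolution.le`). With
positivity this yields strict monotonicity of `Q`.

For the derivative, monotonicity and uniqueness give continuity in the end point of the solution and
of its boundary slope. At each end point `r`, extend the solution linearly past `r` and subtract its
value at `s`: this is an admissible competitor on `(-∞, s)` for every `s`, so its energy is a
minorant of `Q` that touches at `r`, with derivative `(p-1) |v'(r)|^p φ_1(r)`
(`hasDerivAt_competitor`). A continuous function with touching minorants of continuous derivative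
`q` at every point is a primitive of `q` (`hasDerivAt_of_minorants`), which gives the formula with
no expansion of the solution in the end point.

Finally, `Q` of the half-space equals `Q` of the half-line: slicing by Fubini gives one inequality,
since the remaining directions carry a probability measure, and cut-off cylinders give the other
(`IsRegularSolution.genTorsionSharp_eq`). The same cylinders show that the eigenvalue of the
half-space is a Rayleigh bound on the half-line. -/

theorem gaussDensity_pos (x : E) : 0 < gaussDensity x := by
  unfold gaussDensity
  have := Real.pi_pos
  positivity

theorem continuous_gaussDensity : Continuous (gaussDensity : E → ℝ) := by
  unfold gaussDensity
  fun_prop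

theorem gaussDensity_real (x : ℝ) :
    gaussDensity x = 1 / (2 * Real.pi) ^ ((1 : ℝ) / 2) * Real.exp (-(x ^ 2) / 2) := by
  simp [gaussDensity]

theorem gaussDensity_real_eq_gaussianPDFReal (x : ℝ) :
    gaussDensity x = ProbabilityTheory.gaussianPDFReal 0 1 x := by
  rw [gaussDensity_real, ProbabilityTheory.gaussianPDFReal, Real.sqrt_eq_rpow]
  simp

theorem gaussMeasure_real_eq : gaussMeasure ℝ = ProbabilityTheory.gaussianReal 0 1 := by
  rw [ProbabilityTheory.gaussianReal_of_var_ne_zero 0 one_ne_zero, gaussMeasure]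
  congr 1
  ext x
  rw [gaussDensity_real_eq_gaussianPDFReal, ProbabilityTheory.gaussianPDF]

instance : IsProbabilityMeasure (gaussMeasure ℝ) := by
  rw [gaussMeasure_real_eq]; infer_instance

instance : NullSingletonClass (gaussMeasure ℝ) := by
  rw [gaussMeasure_real_eq]
  exact ProbabilityTheory.nullSingletonClass_gaussianReal one_ne_zero

variable [MeasureSpace E]

theorem gaussMeasure_absolutelyContinuous : gaussMeasure E ≪ volume :=
  withDensity_absolutelyContinuous _ _

theorem restrict_gaussMeasure {s : Set E} (hs : MeasurableSet s) :
    (gaussMeasure E).restrict s =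
      (volume.restrict s).withDensity (fun x => ENNReal.ofReal (gaussDensity x)) :=
  restrict_withDensity hs _

variable [BorelSpace E]

theorem absolutelyContinuous_gaussMeasure : (volume : Measure E) ≪ gaussMeasure E := by
  apply withDensity_absolutelyContinuous'
  · exact (continuous_gaussDensity.measurable.ennreal_ofReal).aemeasurable
  · exact Eventually.of_forall fun x => by simp [gaussDensity_pos x]

theorem ae_restrict_gaussMeasure_iff {s : Set E} {P : E → Prop} :
    (∀ᵐ x ∂((gaussMeasure E).restrict s), P x) ↔ ∀ᵐ x ∂(volume.restrict s), P x :=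
  ⟨fun h => (absolutelyContinuous_gaussMeasure.restrict s).ae_le h,
   fun h => (gaussMeasure_absolutelyContinuous.restrict s).ae_le h⟩

theorem setIntegral_gaussMeasure {s : Set E} (hs : MeasurableSet s) (f : E → ℝ) :
    ∫ x in s, f x ∂(gaussMeasure E) = ∫ x in s, gaussDensity x * f x := by
  rw [restrict_gaussMeasure hs, integral_withDensity_eq_integral_toReal_smul]
  · exact integral_congr_ae (Eventually.of_forall fun x => by
      simp [ENNReal.toReal_ofReal (gaussDensity_pos x).le])
  · exact continuous_gaussDensity.measurable.ennreal_ofReal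
  · exact Eventually.of_forall fun x => ENNReal.ofReal_lt_top

theorem integrableOn_gaussMeasure_iff {s : Set E} (hs : MeasurableSet s) (f : E → ℝ) :
    IntegrableOn f s (gaussMeasure E) ↔ IntegrableOn (fun x => gaussDensity x * f x) s volume := by
  rw [IntegrableOn, restrict_gaussMeasure hs, integrable_withDensity_iff_integrable_smul']
  · refine integrable_congr (Eventually.of_forall fun x => ?_)
    simp [ENNReal.toReal_ofReal (gaussDensity_pos x).le]
  · exact continuous_gaussDensity.measurable.ennreal_ofReal
  · exact Eventually.of_forall fun x => ENNReal.ofReal_lt_top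

theorem setLIntegral_gaussMeasure {s : Set E} (hs : MeasurableSet s) {f : E → ENNReal}
    (hf : Measurable f) :
    ∫⁻ x in s, f x ∂(gaussMeasure E) = ∫⁻ x in s, ENNReal.ofReal (gaussDensity x) * f x := by
  rw [restrict_gaussMeasure hs, lintegral_withDensity_eq_lintegral_mul _ _ hf]
  · rfl
  · exact continuous_gaussDensity.measurable.ennreal_ofReal

end GaussBasic

/-! ### The odd power `|x|^{p-2} x` -/

/-- The odd power `|x|^{p-2} x`. -/
noncomputable def oddPow (p x : ℝ) : ℝ := |x| ^ (p - 2) * x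

section OddPow

variable {p q : ℝ}

@[simp] theorem oddPow_zero : oddPow p 0 = 0 := by simp [oddPow]

theorem oddPow_neg (x : ℝ) : oddPow p (-x) = -oddPow p x := by simp [oddPow]

theorem oddPow_of_pos {x : ℝ} (hx : 0 < x) : oddPow p x = x ^ (p - 1) := by
  rw [oddPow, abs_of_pos hx, ← Real.rpow_add_one hx.ne']
  ring_nf

theorem oddPow_of_nonneg (hp : 1 < p) {x : ℝ} (hx : 0 ≤ x) : oddPow p x = x ^ (p - 1) := by
  rcases hx.eq_or_lt with rfl | h
  · rw [oddPow_zero, Real.zero_rpow (by linarith)]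
  · exact oddPow_of_pos h

theorem abs_oddPow (hp : 1 < p) (x : ℝ) : |oddPow p x| = |x| ^ (p - 1) := by
  rw [← oddPow_of_nonneg hp (abs_nonneg x), oddPow, oddPow, abs_mul, abs_abs,
    abs_of_nonneg (by positivity)]

theorem oddPow_nonneg {x : ℝ} (hx : 0 ≤ x) : 0 ≤ oddPow p x := by
  unfold oddPow; positivity

theorem oddPow_mul_self (hp : 1 < p) (x : ℝ) : oddPow p x * x = |x| ^ p := by
  rcases eq_or_ne x 0 with rfl | h
  · simp [Real.zero_rpow (by linarith : p ≠ 0)]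
  · have h' : 0 < |x| := abs_pos.2 h
    rw [oddPow, mul_assoc, ← abs_mul_abs_self x, ← mul_assoc, ← Real.rpow_add_one h'.ne',
      ← Real.rpow_add_one h'.ne']
    ring_nf

theorem continuous_oddPow (hp : 1 < p) : Continuous (oddPow p) := by
  rw [continuous_iff_continuousAt]
  intro x
  rcases eq_or_ne x 0 with rfl | h
  · rw [ContinuousAt, oddPow_zero, tendsto_zero_iff_abs_tendsto_zero]
    have : Tendsto (fun x : ℝ => |x| ^ (p - 1)) (𝓝 0) (𝓝 (|0| ^ (p - 1))) :=
      (Continuous.rpow_const (by fun_prop) fun x => Or.inr (by linarith)).tendsto 0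
    rw [abs_zero, Real.zero_rpow (by linarith)] at this
    exact this.congr fun x => (abs_oddPow hp x).symm
  · unfold oddPow
    exact (continuous_abs.continuousAt.rpow_const (Or.inl (abs_ne_zero.2 h))).mul continuousAt_id

/-- Odd powers with conjugate exponents are mutually inverse; this is what lets the flux be solved
for the derivative. -/
theorem oddPow_oddPow (hpq : (p - 1) * (q - 1) = 1) (x : ℝ) :
    oddPow q (oddPow p x) = x := by
  have key : ∀ y : ℝ, 0 < y → oddPow q (oddPow p y) = y := fun y hy => by
    rw [oddPow_of_pos hy, oddPow_of_pos (by positivity), ← Real.rpow_mul hy.le, hpq, Real.rpow_one]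
  rcases lt_trichotomy x 0 with h | rfl | h
  · have := key (-x) (by linarith)
    rw [oddPow_neg, oddPow_neg] at this
    linarith
  · simp
  · exact key x h

theorem strictMono_oddPow (hp : 1 < p) : StrictMono (oddPow p) := by
  apply strictMono_of_odd_strictMonoOn_nonneg (fun x => oddPow_neg x)
  intro x hx y hy hxy
  rw [oddPow_of_nonneg hp hx, oddPow_of_nonneg hp hy]
  exact Real.rpow_lt_rpow hx hxy (by linarith)

theorem hasDerivAt_abs_rpow_oddPow (hp : 1 < p) (x : ℝ) :
    HasDerivAt (fun x : ℝ => |x| ^ p) (p * oddPow p x) x := by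
  have := hasDerivAt_abs_rpow x hp
  rwa [mul_assoc] at this

theorem oddPow_pos {x : ℝ} (hx : 0 < x) : 0 < oddPow p x := by
  rw [oddPow_of_pos hx]; positivity

end OddPow

/-! ### Elementary inequalities -/

section Inequalities

variable {p : ℝ}

/-- Young's inequality in the form `p a b^{p-1} ≤ a^p + (p-1) b^p`. -/
theorem young_rpow (hp : 1 < p) {a b : ℝ} (ha : 0 ≤ a) (hb : 0 ≤ b) :
    p * (a * b ^ (p - 1)) ≤ a ^ p + (p - 1) * b ^ p := by
  have hpq := Real.HolderConjugate.conjExponent hp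
  have h := Real.young_inequality_of_nonneg ha (Real.rpow_nonneg hb (p - 1)) hpq
  have h1 : (b ^ (p - 1)) ^ (p.conjExponent) = b ^ p := by
    rw [← Real.rpow_mul hb]
    congr 1
    rw [Real.conjExponent]
    have : p - 1 ≠ 0 := by linarith
    field_simp
  rw [h1, Real.conjExponent] at h
  have h2 : p * (a * b ^ (p - 1)) ≤ p * (a ^ p / p + b ^ p / (p / (p - 1))) :=
    mul_le_mul_of_nonneg_left h (by linarith)
  have h3 : p - 1 ≠ 0 := by linarith
  have h4 : p ≠ 0 := by linarith
  calc _ ≤ _ := h2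
    _ = _ := by field_simp

/-- Picone's inequality on the line. -/
theorem picone_pointwise (hp : 1 < p) {u : ℝ} (hu : 0 < u) (d w w' : ℝ) :
    oddPow p d * (p * oddPow p w * w' * u ^ (1 - p) - (p - 1) * |w| ^ p * u ^ (-p) * d)
      ≤ |w'| ^ p := by
  -- The choice `b = |d| |w| / u` makes both Young terms match the expanded derivative of `|w|^p
  -- u^{1-p}`.
  have h1 := young_rpow hp (abs_nonneg w') (b := |d| * |w| / u) (by positivity)
  have e1 : (|d| * |w| / u) ^ (p - 1) = |oddPow p d| * |oddPow p w| * u ^ (1 - p) := by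
    rw [abs_oddPow hp, abs_oddPow hp, Real.div_rpow (by positivity) hu.le,
      Real.mul_rpow (by positivity) (by positivity), div_eq_mul_inv, ← Real.rpow_neg hu.le]
    ring_nf
  have e2 : (|d| * |w| / u) ^ p = oddPow p d * d * |w| ^ p * u ^ (-p) := by
    rw [oddPow_mul_self hp, Real.div_rpow (by positivity) hu.le,
      Real.mul_rpow (by positivity) (by positivity), div_eq_mul_inv, ← Real.rpow_neg hu.le]
  rw [e1, e2] at h1
  have h3 : oddPow p d * oddPow p w * w' ≤ |w'| * (|oddPow p d| * |oddPow p w|) := by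
    calc _ ≤ |oddPow p d * oddPow p w * w'| := le_abs_self _
      _ = _ := by rw [abs_mul, abs_mul]; ring
  have h4 : 0 < u ^ (1 - p) := by positivity
  have h5 := mul_le_mul_of_nonneg_right h3 h4.le
  have h6 : p * (oddPow p d * oddPow p w * w' * u ^ (1 - p)) ≤
      p * (|w'| * (|oddPow p d| * |oddPow p w|) * u ^ (1 - p)) :=
    mul_le_mul_of_nonneg_left h5 (by linarith)
  nlinarith [h1, h6]

/-- The deficit `(p-1)u - p w + w^p u^{1-p}` is nonnegative and vanishes only at `w = u`. -/
theorem deficit_nonneg (hp : 1 < p) {u w : ℝ} (hu : 0 < u) (hw : 0 ≤ w) :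
    p * w - w ^ p * u ^ (1 - p) ≤ (p - 1) * u := by
  have h := young_rpow hp hw hu.le
  have h1 : 0 < u ^ (1 - p) := by positivity
  have h2 := mul_le_mul_of_nonneg_right h h1.le
  have e1 : u ^ (p - 1) * u ^ (1 - p) = 1 := by
    rw [← Real.rpow_add hu]; simp
  have e2 : u ^ p * u ^ (1 - p) = u := by
    rw [← Real.rpow_add hu]; simp
  have : p * (w * u ^ (p - 1)) * u ^ (1 - p) = p * w := by
    rw [mul_assoc, mul_assoc, e1, mul_one]
  rw [this, add_mul, mul_assoc, e2] at h2
  linarith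

theorem strictConvexOn_abs_rpow (hp : 1 < p) : StrictConvexOn ℝ univ (fun x : ℝ => |x| ^ p) := by
  apply StrictMono.strictConvexOn_univ_of_deriv
  · exact Continuous.rpow_const (by fun_prop) fun x => Or.inr (by linarith)
  · have : deriv (fun x : ℝ => |x| ^ p) = fun x => p * oddPow p x :=
      funext fun x => (hasDerivAt_abs_rpow_oddPow hp x).deriv
    rw [this]
    intro x y hxy
    exact mul_lt_mul_of_pos_left (strictMono_oddPow hp hxy) (by linarith)

/-- The deficit is strictly convex in `w` and vanishes at `u`. A second zero would make it negative
at the midpoint, contradicting `deficit_nonneg`. -/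
theorem eq_of_deficit_eq (hp : 1 < p) {u w : ℝ} (hu : 0 < u) (hw : 0 ≤ w)
    (h : (p - 1) * u ≤ p * w - w ^ p * u ^ (1 - p)) : w = u := by
  have hcv : StrictConvexOn ℝ (Ici 0) (fun x : ℝ => x ^ p) := strictConvexOn_rpow hp
  by_contra hne
  have hmid : (0 : ℝ) ≤ (w + u) / 2 := by linarith
  have h1 := hcv.2 (mem_Ici.2 hw) (mem_Ici.2 hu.le) hne (by norm_num : (0 : ℝ) < 1 / 2)
    (by norm_num : (0 : ℝ) < 1 / 2) (by norm_num)
  have h2 := deficit_nonneg hp hu hmid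
  have e2 : u ^ p * u ^ (1 - p) = u := by
    rw [← Real.rpow_add hu]; simp
  have h4 : 0 < u ^ (1 - p) := by positivity
  simp only [smul_eq_mul] at h1
  have e : (1 / 2 * w + 1 / 2 * u : ℝ) = (w + u) / 2 := by ring
  rw [e] at h1
  have h5 := mul_lt_mul_of_pos_right h1 h4
  rw [add_mul, mul_assoc, mul_assoc, e2] at h5
  linarith

/-- Quantitative strict convexity of `|x|^p`. -/
theorem uniform_convexity_abs_rpow (hp : 1 < p) {ε : ℝ} (hε : 0 < ε) :
    ∃ C : ℝ, 0 ≤ C ∧ ∀ a b : ℝ, |a - b| ^ p ≤ ε * (|a| ^ p + |b| ^ p) +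
      C * ((|a| ^ p + |b| ^ p) / 2 - |(a + b) / 2| ^ p) := by
  have hc : Continuous (fun x : ℝ => |x| ^ p) :=
    Continuous.rpow_const (by fun_prop) fun x => Or.inr (by linarith)
  have hdef : ∀ a b : ℝ, 0 ≤ (|a| ^ p + |b| ^ p) / 2 - |(a + b) / 2| ^ p := fun a b => by
    have := (strictConvexOn_abs_rpow hp).convexOn.2 (mem_univ a) (mem_univ b)
      (by norm_num : (0 : ℝ) ≤ 1 / 2) (by norm_num : (0 : ℝ) ≤ 1 / 2) (by norm_num)
    simp only [smul_eq_mul] at this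
    rw [show (1 / 2 * a + 1 / 2 * b : ℝ) = (a + b) / 2 by ring] at this
    linarith
  have hdef' : ∀ a b : ℝ, a ≠ b → 0 < (|a| ^ p + |b| ^ p) / 2 - |(a + b) / 2| ^ p := fun a b h => by
    have := (strictConvexOn_abs_rpow hp).2 (mem_univ a) (mem_univ b) h
      (by norm_num : (0 : ℝ) < 1 / 2) (by norm_num : (0 : ℝ) < 1 / 2) (by norm_num)
    simp only [smul_eq_mul] at this
    rw [show (1 / 2 * a + 1 / 2 * b : ℝ) = (a + b) / 2 by ring] at this
    linarith
  -- By homogeneity only the unit sphere matters. Off `K` the `ε`-term alone suffices. On the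
  -- compact set `K` the two coordinates differ, so the convexity deficit has a positive minimum
  -- `d0`, and `|a - b| ≤ 2` on the sphere makes `2 ^ p / d0` large enough.
  let K : Set (ℝ × ℝ) := Metric.sphere 0 1 ∩ {z | ε * (|z.1| ^ p + |z.2| ^ p) ≤ |z.1 - z.2| ^ p}
  have hK : IsCompact K := (isCompact_sphere _ _).inter_right
    (isClosed_le (((hc.comp continuous_fst).add (hc.comp continuous_snd)).const_smul ε) (hc.comp (by fun_prop : Continuous fun z : ℝ × ℝ => z.1 - z.2)))
  have hdc : Continuous fun z : ℝ × ℝ => (|z.1| ^ p + |z.2| ^ p) / 2 - |(z.1 + z.2) / 2| ^ p := by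
    have h1 := hc.comp (by fun_prop : Continuous fun z : ℝ × ℝ => z.1)
    have h2 := hc.comp (by fun_prop : Continuous fun z : ℝ × ℝ => z.2)
    have h3 := hc.comp (by fun_prop : Continuous fun z : ℝ × ℝ => (z.1 + z.2) / 2)
    exact ((h1.add h2).div_const 2).sub h3
  obtain ⟨C, hC0, hC⟩ : ∃ C : ℝ, 0 ≤ C ∧ ∀ z ∈ Metric.sphere (0 : ℝ × ℝ) 1,
      |z.1 - z.2| ^ p ≤ ε * (|z.1| ^ p + |z.2| ^ p) +
        C * ((|z.1| ^ p + |z.2| ^ p) / 2 - |(z.1 + z.2) / 2| ^ p) := by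
    rcases K.eq_empty_or_nonempty with hKe | hKn
    · refine ⟨0, le_rfl, fun z hz => ?_⟩
      have : z ∉ K := by rw [hKe]; exact notMem_empty z
      have h : ¬ ε * (|z.1| ^ p + |z.2| ^ p) ≤ |z.1 - z.2| ^ p := fun h => this ⟨hz, h⟩
      linarith [not_le.1 h]
    · obtain ⟨z0, hz0, hmin⟩ := hK.exists_isMinOn hKn hdc.continuousOn
      have hpos : 0 < (|z0.1| ^ p + |z0.2| ^ p) / 2 - |(z0.1 + z0.2) / 2| ^ p := by
        apply hdef'
        intro heq
        have h1 := hz0.2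
        simp only [mem_ofPred_eq, heq, sub_self, abs_zero,
          Real.zero_rpow (by linarith : p ≠ 0)] at h1
        have h2 : |z0.2| ^ p ≤ 0 := by
          have : 0 ≤ |z0.2| ^ p := by positivity
          nlinarith
        have h3 : z0.2 = 0 := by
          by_contra hne
          have : 0 < |z0.2| ^ p := Real.rpow_pos_of_pos (abs_pos.2 hne) p
          linarith
        have h4 : z0 = 0 := Prod.ext (heq.trans h3) h3
        have h5 := hz0.1
        rw [h4] at h5
        simp at h5
      set d0 := (|z0.1| ^ p + |z0.2| ^ p) / 2 - |(z0.1 + z0.2) / 2| ^ p with hd0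
      refine ⟨2 ^ p / d0, by positivity, fun z hz => ?_⟩
      by_cases hzK : ε * (|z.1| ^ p + |z.2| ^ p) ≤ |z.1 - z.2| ^ p
      · have h1 : d0 ≤ (|z.1| ^ p + |z.2| ^ p) / 2 - |(z.1 + z.2) / 2| ^ p :=
          hmin (show z ∈ K from ⟨hz, hzK⟩)
        have h2 : |z.1 - z.2| ≤ 2 := by
          have hn : ‖z‖ = 1 := by simpa using hz
          have a1 : |z.1| ≤ 1 := by rw [← hn]; exact norm_fst_le z
          have a2 : |z.2| ≤ 1 := by rw [← hn]; exact norm_snd_le z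
          calc |z.1 - z.2| ≤ |z.1| + |z.2| := abs_sub _ _
            _ ≤ 2 := by linarith
        have h3 : |z.1 - z.2| ^ p ≤ 2 ^ p := Real.rpow_le_rpow (abs_nonneg _) h2 (by linarith)
        have h4 : 2 ^ p / d0 * d0 ≤
            2 ^ p / d0 * ((|z.1| ^ p + |z.2| ^ p) / 2 - |(z.1 + z.2) / 2| ^ p) :=
          mul_le_mul_of_nonneg_left h1 (by positivity)
        rw [div_mul_cancel₀ _ hpos.ne'] at h4
        have : 0 ≤ ε * (|z.1| ^ p + |z.2| ^ p) := by positivity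
        linarith
      · have := mul_nonneg (show (0 : ℝ) ≤ 2 ^ p / d0 by positivity) (hdef z.1 z.2)
        linarith
  refine ⟨C, hC0, fun a b => ?_⟩
  by_cases h0 : (a, b) = (0 : ℝ × ℝ)
  · obtain ⟨rfl, rfl⟩ := Prod.mk_eq_zero.1 h0
    simp [Real.zero_rpow (by linarith : p ≠ 0)]
  · set r := ‖((a, b) : ℝ × ℝ)‖ with hr
    have hr0 : 0 < r := norm_pos_iff.2 h0
    have h := hC (r⁻¹ • (a, b)) (by
      rw [mem_sphere_zero_iff_norm, norm_smul, ← hr, Real.norm_eq_abs, abs_of_pos (inv_pos.2 hr0),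
        inv_mul_cancel₀ hr0.ne'])
    simp only [Prod.smul_mk, smul_eq_mul, ← mul_sub, ← mul_add, mul_div_assoc, abs_mul,
      abs_of_pos (inv_pos.2 hr0)] at h
    simp only [Real.mul_rpow (inv_pos.2 hr0).le (abs_nonneg _)] at h
    have hrp : 0 < (r⁻¹) ^ p := by positivity
    have e : ∀ x y z : ℝ, ε * (r⁻¹ ^ p * x + r⁻¹ ^ p * y) +
        C * ((r⁻¹ ^ p * x + r⁻¹ ^ p * y) / 2 - r⁻¹ ^ p * z) =
        r⁻¹ ^ p * (ε * (x + y) + C * ((x + y) / 2 - z)) := fun x y z => by ring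
    have e' := e (|a| ^ p) (|b| ^ p) (|(a + b) / 2| ^ p)
    refine le_of_mul_le_mul_left ?_ hrp
    rw [← e']
    convert h using 3

end Inequalities

/-! ### Convergence of `L^p` functionals -/

section LpConvergence

variable {α F : Type*} [MeasurableSpace α] [NormedAddCommGroup F] {μ : Measure α} {p : ℝ}

theorem lintegral_enorm_rpow_eq_eLpNorm (hp : 1 < p) (f : α → F) :
    ∫⁻ x, ‖f x‖ₑ ^ p ∂μ = eLpNorm f (ENNReal.ofReal p) μ ^ p := by
  rw [eLpNorm_eq_lintegral_rpow_enorm_toReal (by simp; linarith) ENNReal.ofReal_ne_top,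
    ENNReal.toReal_ofReal (by linarith), ← ENNReal.rpow_mul, one_div,
    inv_mul_cancel₀ (by linarith), ENNReal.rpow_one]

theorem integral_norm_rpow_eq_eLpNorm (hp : 1 < p) {f : α → F}
    (hf : AEStronglyMeasurable f μ) :
    ∫ x, ‖f x‖ ^ p ∂μ = (eLpNorm f (ENNReal.ofReal p) μ).toReal ^ p := by
  rw [integral_eq_lintegral_of_nonneg_ae (Eventually.of_forall fun x => by positivity)
    (hf.norm.aemeasurable.pow_const p).aestronglyMeasurable, ENNReal.toReal_rpow,
    ← lintegral_enorm_rpow_eq_eLpNorm hp]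
  congr 1
  refine lintegral_congr fun x => ?_
  rw [← ofReal_norm, ENNReal.ofReal_rpow_of_nonneg (norm_nonneg _) (by linarith)]

theorem MeasureTheory.MemLp.integrable_norm_rpow_ofReal (hp : 1 < p) {f : α → F}
    (hf : MemLp f (ENNReal.ofReal p) μ) : Integrable (fun x => ‖f x‖ ^ p) μ := by
  have := hf.integrable_norm_rpow (by simp; linarith) ENNReal.ofReal_ne_top
  rwa [ENNReal.toReal_ofReal (by linarith)] at this

theorem memLp_ofReal_iff_integrable (hp : 1 < p) {f : α → F} (hf : AEStronglyMeasurable f μ) :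
    MemLp f (ENNReal.ofReal p) μ ↔ Integrable (fun x => ‖f x‖ ^ p) μ := by
  have := integrable_norm_rpow_iff hf (p := ENNReal.ofReal p) (by simp; linarith)
    ENNReal.ofReal_ne_top
  rw [ENNReal.toReal_ofReal (by linarith)] at this
  exact this.symm

theorem tendsto_integral_norm_rpow_of_eLpNorm (hp : 1 < p) {f : α → F} {g : ℕ → α → F}
    (hf : MemLp f (ENNReal.ofReal p) μ) (hg : ∀ n, MemLp (g n) (ENNReal.ofReal p) μ)
    (h : Tendsto (fun n => eLpNorm (fun x => f x - g n x) (ENNReal.ofReal p) μ) atTop (𝓝 0)) :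
    Tendsto (fun n => ∫ x, ‖g n x‖ ^ p ∂μ) atTop (𝓝 (∫ x, ‖f x‖ ^ p ∂μ)) := by
  have hp1 : 1 ≤ ENNReal.ofReal p := by simpa using hp.le
  simp_rw [fun n => integral_norm_rpow_eq_eLpNorm hp (hg n).1, integral_norm_rpow_eq_eLpNorm hp hf.1]
  refine Tendsto.rpow_const ?_ (Or.inr (by linarith))
  have h' : Tendsto (fun n => (eLpNorm (fun x => f x - g n x) (ENNReal.ofReal p) μ).toReal)
      atTop (𝓝 0) := by
    exact (ENNReal.tendsto_toReal ENNReal.zero_ne_top).comp h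
  rw [tendsto_iff_norm_sub_tendsto_zero]
  refine squeeze_zero (fun n => norm_nonneg _) (fun n => ?_) h'
  have hfg : MemLp (f - g n) (ENNReal.ofReal p) μ := hf.sub (hg n)
  have e : (fun x => f x - g n x) = f - g n := rfl
  have a1 : (eLpNorm (g n) (ENNReal.ofReal p) μ).toReal ≤
      (eLpNorm f (ENNReal.ofReal p) μ).toReal + (eLpNorm (f - g n) (ENNReal.ofReal p) μ).toReal := by
    rw [← ENNReal.toReal_add hf.2.ne hfg.2.ne]
    refine ENNReal.toReal_mono (ENNReal.add_ne_top.2 ⟨hf.2.ne, hfg.2.ne⟩) ?_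
    have := eLpNorm_sub_le hf.1 hfg.1 hp1
    rwa [sub_sub_cancel] at this
  have a2 : (eLpNorm f (ENNReal.ofReal p) μ).toReal ≤
      (eLpNorm (g n) (ENNReal.ofReal p) μ).toReal +
        (eLpNorm (f - g n) (ENNReal.ofReal p) μ).toReal := by
    rw [← ENNReal.toReal_add (hg n).2.ne hfg.2.ne]
    refine ENNReal.toReal_mono (ENNReal.add_ne_top.2 ⟨(hg n).2.ne, hfg.2.ne⟩) ?_
    have := eLpNorm_add_le (hg n).1 hfg.1 hp1
    rwa [add_sub_cancel] at this
  rw [e, Real.norm_eq_abs, abs_le]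
  constructor <;> linarith

theorem tendsto_integral_of_eLpNorm [IsFiniteMeasure μ] (hp : 1 < p) {f : α → ℝ} {g : ℕ → α → ℝ}
    (hf : MemLp f (ENNReal.ofReal p) μ) (hg : ∀ n, MemLp (g n) (ENNReal.ofReal p) μ)
    (h : Tendsto (fun n => eLpNorm (fun x => f x - g n x) (ENNReal.ofReal p) μ) atTop (𝓝 0)) :
    Tendsto (fun n => ∫ x, g n x ∂μ) atTop (𝓝 (∫ x, f x ∂μ)) := by
  have hp1 : 1 ≤ ENNReal.ofReal p := by simpa using hp.le
  refine tendsto_integral_of_L1' f hf.1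
    (Eventually.of_forall fun n => (hg n).integrable hp1) ?_
  set c := μ univ ^ (1 / (1 : ENNReal).toReal - 1 / (ENNReal.ofReal p).toReal) with hc
  have hcfin : c ≠ ⊤ := by
    rw [hc]
    apply ENNReal.rpow_ne_top_of_nonneg _ (measure_ne_top _ _)
    rw [ENNReal.toReal_ofReal (by linarith)]
    simp only [ENNReal.toReal_one, sub_nonneg]
    rw [div_le_div_iff₀ (by linarith) one_pos]
    linarith
  have h2 : Tendsto (fun n => eLpNorm (fun x => f x - g n x) (ENNReal.ofReal p) μ * c)
      atTop (𝓝 0) := by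
    simpa using ENNReal.Tendsto.mul_const h (Or.inr hcfin)
  refine tendsto_of_tendsto_of_tendsto_of_le_of_le tendsto_const_nhds h2 (fun n => zero_le)
    fun n => ?_
  change eLpNorm (g n - f) 1 μ ≤ eLpNorm (f - g n) (ENNReal.ofReal p) μ * c
  rw [eLpNorm_sub_comm]
  exact eLpNorm_le_eLpNorm_mul_rpow_measure_univ hp1 (hf.1.sub (hg n).1)

end LpConvergence

/-! ### Test functions -/

section TestFunction

variable {E : Type*} [NormedAddCommGroup E] [InnerProductSpace ℝ E] {Ω : Set E} {w : E → ℝ}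

theorem IsTestFunction.continuous (h : IsTestFunction Ω w) : Continuous w := h.1.continuous

theorem IsTestFunction.differentiable (h : IsTestFunction Ω w) : Differentiable ℝ w :=
  h.1.differentiable (by simp)

theorem IsTestFunction.continuous_fderiv (h : IsTestFunction Ω w) : Continuous (fderiv ℝ w) :=
  h.1.continuous_fderiv (by simp)

theorem IsTestFunction.mono {Ω' : Set E} (h : IsTestFunction Ω w) (hΩ : Ω ⊆ Ω') :
    IsTestFunction Ω' w := ⟨h.1, h.2.1, h.2.2.trans hΩ⟩

theorem isTestFunction_zero : IsTestFunction Ω (fun _ => (0 : ℝ)) :=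
  ⟨contDiff_const, HasCompactSupport.zero, by
    have : tsupport (fun _ : E => (0 : ℝ)) = ∅ := tsupport_eq_empty_iff.2 rfl
    rw [this]; exact empty_subset _⟩

variable [CompleteSpace E]

theorem gradient_eq_toDual_symm (w : E → ℝ) :
    gradient w = fun x => (InnerProductSpace.toDual ℝ E).symm (fderiv ℝ w x) := rfl

theorem inner_gradient (w : E → ℝ) (x e : E) : inner ℝ (gradient w x) e = fderiv ℝ w x e := by
  rw [gradient, InnerProductSpace.toDual_symm_apply]

theorem IsTestFunction.continuous_gradient (h : IsTestFunction Ω w) : Continuous (gradient w) := by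
  rw [gradient_eq_toDual_symm]
  exact (LinearIsometryEquiv.continuous _).comp h.continuous_fderiv

theorem IsTestFunction.hasCompactSupport_gradient (h : IsTestFunction Ω w) :
    HasCompactSupport (gradient w) := by
  rw [gradient_eq_toDual_symm]
  exact (h.2.1.fderiv (𝕜 := ℝ)).comp_left (map_zero _)

variable [MeasureSpace E] [BorelSpace E]

instance [IsLocallyFiniteMeasure (volume : Measure E)] :
    IsLocallyFiniteMeasure (gaussMeasure E) :=
  IsLocallyFiniteMeasure.withDensity_ofReal continuous_gaussDensity

variable [FiniteDimensional ℝ E] [(volume : Measure E).IsAddHaarMeasure]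

theorem IsTestFunction.memGaussSobolev (p : ℝ) (h : IsTestFunction Ω w) :
    MemGaussSobolev p Ω w (gradient w) := by
  refine ⟨⟨?_, ?_, fun η hη e => ?_⟩, ?_, ?_⟩
  · exact h.continuous.locallyIntegrable.locallyIntegrableOn _
  · exact h.continuous_gradient.locallyIntegrable.locallyIntegrableOn _
  · have hi : ∀ f : E → ℝ, (∀ x ∉ Ω, f x = 0) → ∫ x in Ω, f x = ∫ x, f x := fun f hf =>
      setIntegral_eq_integral_of_forall_compl_eq_zero hf
    have hη0 : ∀ x ∉ Ω, η x = 0 := fun x hx => image_eq_zero_of_notMem_tsupport fun h' => hx (hη.2.2 h')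
    have hw0 : ∀ x ∉ Ω, w x = 0 := fun x hx => image_eq_zero_of_notMem_tsupport fun h' => hx (h.2.2 h')
    rw [hi _ fun x hx => by rw [hw0 x hx, zero_mul], hi _ fun x hx => by rw [hη0 x hx, zero_mul]]
    simp_rw [inner_gradient]
    rw [integral_mul_fderiv_eq_neg_fderiv_mul_of_integrable]
    · simp_rw [mul_comm]
    · refine Continuous.integrable_of_hasCompactSupport ?_ ?_
      · exact (h.continuous_fderiv.clm_apply continuous_const).mul hη.continuous
      · exact hη.2.1.mul_left
    · refine Continuous.integrable_of_hasCompactSupport ?_ ?_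
      · exact h.continuous.mul (hη.continuous_fderiv.clm_apply continuous_const)
      · exact h.2.1.mul_right
    · refine Continuous.integrable_of_hasCompactSupport ?_ ?_
      · exact h.continuous.mul hη.continuous
      · exact h.2.1.mul_right
    · exact fun x _ => h.differentiable x
    · exact fun x _ => hη.differentiable x
  · exact h.continuous.memLp_of_hasCompactSupport h.2.1
  · exact h.continuous_gradient.memLp_of_hasCompactSupport h.hasCompactSupport_gradient

theorem IsTestFunction.memGaussSobolevZero (p : ℝ) (h : IsTestFunction Ω w) :
    MemGaussSobolevZero p Ω w (gradient w) :=
  ⟨h.memGaussSobolev p, fun ε hε => ⟨w, h, by simpa using hε⟩⟩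

omit [FiniteDimensional ℝ E] [(volume : Measure E).IsAddHaarMeasure] [BorelSpace E] in
theorem MemGaussSobolevZero.exists_seq {p : ℝ} {u : E → ℝ} {G : E → E}
    (h : MemGaussSobolevZero p Ω u G) :
    ∃ w : ℕ → E → ℝ, (∀ n, IsTestFunction Ω (w n)) ∧
      Tendsto (fun n => eLpNorm (fun x => u x - w n x) (ENNReal.ofReal p)
        ((gaussMeasure E).restrict Ω)) atTop (𝓝 0) ∧
      Tendsto (fun n => eLpNorm (fun x => G x - gradient (w n) x) (ENNReal.ofReal p)
        ((gaussMeasure E).restrict Ω)) atTop (𝓝 0) := by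
  choose w hw hlt using fun n : ℕ => h.2 ((n + 1 : ENNReal)⁻¹) (by simp)
  have h0 : Tendsto (fun n : ℕ => ((n + 1 : ENNReal)⁻¹)) atTop (𝓝 0) := by
    have := (tendsto_add_atTop_iff_nat 1).2 ENNReal.tendsto_inv_nat_nhds_zero
    simpa using this
  exact ⟨w, hw,
    tendsto_of_tendsto_of_tendsto_of_le_of_le tendsto_const_nhds h0 (fun n => zero_le)
      fun n => le_self_add.trans (hlt n).le,
    tendsto_of_tendsto_of_tendsto_of_le_of_le tendsto_const_nhds h0 (fun n => zero_le)
      fun n => le_add_self.trans (hlt n).le⟩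

/-- The functional is continuous along approximations by test functions. -/
theorem MemGaussSobolevZero.exists_seq_tendsto [IsFiniteMeasure (gaussMeasure E)] {p : ℝ}
    (hp : 1 < p) {u : E → ℝ} {G : E → E} (h : MemGaussSobolevZero p Ω u G) :
    ∃ w : ℕ → E → ℝ, (∀ n, IsTestFunction Ω (w n)) ∧
      Tendsto (fun n => eLpNorm (fun x => u x - w n x) (ENNReal.ofReal p)
        ((gaussMeasure E).restrict Ω)) atTop (𝓝 0) ∧
      Tendsto (fun n => ∫ x in Ω, ‖gradient (w n) x‖ ^ p ∂(gaussMeasure E)) atTop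
        (𝓝 (∫ x in Ω, ‖G x‖ ^ p ∂(gaussMeasure E))) ∧
      Tendsto (fun n => ∫ x in Ω, |w n x| ^ p ∂(gaussMeasure E)) atTop
        (𝓝 (∫ x in Ω, |u x| ^ p ∂(gaussMeasure E))) ∧
      ∀ α, Tendsto (fun n => torsionFunctional p α Ω (w n) (gradient (w n))) atTop
        (𝓝 (torsionFunctional p α Ω u G)) := by
  obtain ⟨w, hw, h1, h2⟩ := h.exists_seq
  have a1 := tendsto_integral_norm_rpow_of_eLpNorm hp h.1.2.2
    (fun n => ((hw n).memGaussSobolev p).2.2) h2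
  have a2 := tendsto_integral_norm_rpow_of_eLpNorm hp h.1.2.1
    (fun n => ((hw n).memGaussSobolev p).2.1) h1
  have a3 := tendsto_integral_of_eLpNorm hp h.1.2.1
    (fun n => ((hw n).memGaussSobolev p).2.1) h1
  exact ⟨w, hw, h1, a1, a2, fun α => (a1.neg.add (a2.const_mul α)).add (a3.const_mul p)⟩

/-- By density, upper bounds for the supremum need only be checked on test functions. Picone's
inequality is therefore required only where `w` has compact support inside the domain. -/
theorem genTorsionalRigidity_le [IsFiniteMeasure (gaussMeasure E)] {p α M : ℝ} (hp : 1 < p)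
    (h : ∀ w : E → ℝ, IsTestFunction Ω w → torsionFunctional p α Ω w (gradient w) ≤ M) :
    genTorsionalRigidity p α Ω ≤ (M : EReal) := by
  refine iSup_le fun u => iSup_le fun G => iSup_le fun hu => ?_
  obtain ⟨w, hw, -, -, -, ht⟩ := hu.exists_seq_tendsto hp
  exact EReal.coe_le_coe_iff.2 (le_of_tendsto' (ht α) fun n => h _ (hw n))

omit [FiniteDimensional ℝ E] [(volume : Measure E).IsAddHaarMeasure] [BorelSpace E] in
theorem le_genTorsionalRigidity {p α : ℝ} {u : E → ℝ} {G : E → E}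
    (h : MemGaussSobolevZero p Ω u G) :
    (torsionFunctional p α Ω u G : EReal) ≤ genTorsionalRigidity p α Ω :=
  le_iSup_of_le u (le_iSup_of_le G (le_iSup_of_le h le_rfl))

/-- A Rayleigh bound on test functions extends to the closure. -/
theorem MemGaussSobolevZero.rayleigh [IsFiniteMeasure (gaussMeasure E)] {p lam : ℝ} (hp : 1 < p)
    (h : ∀ w : E → ℝ, IsTestFunction Ω w → lam * ∫ x in Ω, |w x| ^ p ∂(gaussMeasure E) ≤
      ∫ x in Ω, ‖gradient w x‖ ^ p ∂(gaussMeasure E)) {u : E → ℝ} {G : E → E}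
    (hu : MemGaussSobolevZero p Ω u G) :
    lam * ∫ x in Ω, |u x| ^ p ∂(gaussMeasure E) ≤ ∫ x in Ω, ‖G x‖ ^ p ∂(gaussMeasure E) := by
  obtain ⟨w, hw, -, h1, h2, -⟩ := hu.exists_seq_tendsto hp
  exact le_of_tendsto_of_tendsto' (h2.const_mul lam) h1 fun n => h _ (hw n)

end TestFunction

/-! ### Integration on half-lines -/

section HalfLine

variable {p t : ℝ}

theorem gaussDensity_anti {x y : ℝ} (h : |x| ≤ |y|) : gaussDensity y ≤ gaussDensity x := by
  rw [gaussDensity_real, gaussDensity_real]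
  have := Real.pi_pos
  gcongr 1 / _ * Real.exp ?_
  have := sq_le_sq.2 h
  linarith

theorem gaussDensity_le_of_mem_Icc {a x : ℝ} (hx : x ∈ Icc a t) :
    gaussDensity (max |a| |t|) ≤ gaussDensity x := by
  apply gaussDensity_anti
  rw [abs_of_nonneg (le_max_of_le_left (abs_nonneg a))]
  exact abs_le_max_abs_abs hx.1 hx.2

/-- On bounded pieces Lebesgue measure is controlled by the Gaussian measure. -/
theorem exists_restrict_Ioo_le_smul (a t : ℝ) : ∃ K : ENNReal, K ≠ ⊤ ∧
    (volume : Measure ℝ).restrict (Ioo a t) ≤ K • (gaussMeasure ℝ).restrict (Iio t) := by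
  have hc : 0 < gaussDensity (max |a| |t|) := gaussDensity_pos _
  refine ⟨(ENNReal.ofReal (gaussDensity (max |a| |t|)))⁻¹, by simp [hc], ?_⟩
  set K := (ENNReal.ofReal (gaussDensity (max |a| |t|)))⁻¹
  refine Measure.le_iff.2 fun s hs => ?_
  rw [Measure.smul_apply, smul_eq_mul, Measure.restrict_apply hs, Measure.restrict_apply hs]
  calc volume (s ∩ Ioo a t) = ∫⁻ x in s ∩ Ioo a t, 1 := by simp
    _ ≤ ∫⁻ x in s ∩ Ioo a t, K * ENNReal.ofReal (gaussDensity x) := by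
        refine setLIntegral_mono (by
          exact (continuous_gaussDensity.measurable.ennreal_ofReal).const_mul _) fun x hx => ?_
        rw [mul_comm, ← div_eq_mul_inv, ENNReal.le_div_iff_mul_le (Or.inl (by simpa using hc))
          (Or.inl ENNReal.ofReal_ne_top), one_mul]
        exact ENNReal.ofReal_le_ofReal (gaussDensity_le_of_mem_Icc (Ioo_subset_Icc_self hx.2))
    _ = K * ∫⁻ x in s ∩ Ioo a t, ENNReal.ofReal (gaussDensity x) :=
        lintegral_const_mul _ (continuous_gaussDensity.measurable.ennreal_ofReal)
    _ = K * gaussMeasure ℝ (s ∩ Ioo a t) := by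
        rw [gaussMeasure, withDensity_apply _ (hs.inter measurableSet_Ioo)]
    _ ≤ K * gaussMeasure ℝ (s ∩ Iio t) := by
        gcongr
        exact fun x hx => hx.2

/-- The weight is bounded below on bounded intervals, and Hölder's inequality on a finite measure
passes from `L^p` to `L^1`. Primitives from `t` are thus continuous functionals of the gradient,
although the weight degenerates at `-∞`. -/
theorem exists_lintegral_Ioo_le (hp : 1 < p) (a t : ℝ) : ∃ C : ENNReal, C ≠ ⊤ ∧ ∀ G : ℝ → ℝ,
    AEStronglyMeasurable G ((gaussMeasure ℝ).restrict (Iio t)) →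
    ∫⁻ x in Ioo a t, ‖G x‖ₑ ≤ C * eLpNorm G (ENNReal.ofReal p) ((gaussMeasure ℝ).restrict (Iio t)) := by
  obtain ⟨K, hK, hle⟩ := exists_restrict_Ioo_le_smul a t
  have hp1 : 1 ≤ ENNReal.ofReal p := by simpa using hp.le
  set μ := (gaussMeasure ℝ).restrict (Iio t)
  set c := μ univ ^ (1 / (1 : ENNReal).toReal - 1 / (ENNReal.ofReal p).toReal) with hc
  have hcfin : c ≠ ⊤ := by
    rw [hc]
    apply ENNReal.rpow_ne_top_of_nonneg _ (measure_ne_top _ _)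
    rw [ENNReal.toReal_ofReal (by linarith)]
    simp only [ENNReal.toReal_one, sub_nonneg]
    rw [div_le_div_iff₀ (by linarith) one_pos]
    linarith
  refine ⟨K * c, ENNReal.mul_ne_top hK hcfin, fun G hG => ?_⟩
  calc ∫⁻ x in Ioo a t, ‖G x‖ₑ ≤ ∫⁻ x, ‖G x‖ₑ ∂(K • μ) := lintegral_mono' hle le_rfl
    _ = K * eLpNorm G 1 μ := by rw [lintegral_smul_measure, eLpNorm_one_eq_lintegral_enorm]; rfl
    _ ≤ K * (eLpNorm G (ENNReal.ofReal p) μ * c) := by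
        gcongr
        exact eLpNorm_le_eLpNorm_mul_rpow_measure_univ hp1 hG
    _ = _ := by ring

theorem MeasureTheory.MemLp.intervalIntegrable_of_gauss (hp : 1 < p) {G : ℝ → ℝ}
    (hG : MemLp G (ENNReal.ofReal p) ((gaussMeasure ℝ).restrict (Iio t))) {a b : ℝ} (ha : a ≤ t)
    (hb : b ≤ t) : IntervalIntegrable G volume a b := by
  have key : ∀ a ≤ t, IntervalIntegrable G volume a t := fun a ha => by
    obtain ⟨C, hC, h⟩ := exists_lintegral_Ioo_le hp a t
    rw [intervalIntegrable_iff_integrableOn_Ioo_of_le ha]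
    refine ⟨?_, ?_⟩
    · exact (hG.1.mono_ac (absolutelyContinuous_gaussMeasure.restrict _)).mono_set fun x hx => hx.2
    · exact (h G hG.1).trans_lt (ENNReal.mul_lt_top hC.lt_top hG.2)
  exact (key a ha).trans (key b hb).symm

/-- Tonelli on the triangle `x < y < t`. -/
theorem lintegral_triangle_swap (t : ℝ) {h G : ℝ → ENNReal}
    (hh : AEMeasurable h (volume.restrict (Iio t)))
    (hG : AEMeasurable G (volume.restrict (Iio t))) :
    ∫⁻ x in Iio t, h x * ∫⁻ y in Ioo x t, G y = ∫⁻ y in Iio t, G y * ∫⁻ x in Iio y, h x := by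
  set μ := (volume : Measure ℝ).restrict (Iio t) with hμ
  have hm : AEMeasurable (fun z : ℝ × ℝ => {z : ℝ × ℝ | z.1 < z.2}.indicator
      (fun z => h z.1 * G z.2) z) (μ.prod μ) :=
    (hh.comp_fst.mul hG.comp_snd).indicator (measurableSet_lt measurable_fst measurable_snd)
  have hsw := lintegral_lintegral_swap (μ := μ) (ν := μ)
    (f := fun x y => {z : ℝ × ℝ | z.1 < z.2}.indicator (fun z => h z.1 * G z.2) (x, y)) hm
  have e1 : ∀ x, ∫⁻ y, {z : ℝ × ℝ | z.1 < z.2}.indicator (fun z => h z.1 * G z.2) (x, y) ∂μ =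
      h x * ∫⁻ y in Ioo x t, G y := fun x => by
    have : ∀ y, {z : ℝ × ℝ | z.1 < z.2}.indicator (fun z => h z.1 * G z.2) (x, y) =
        (Ioi x).indicator (fun y => h x * G y) y := fun y => by
      by_cases hxy : x < y <;> simp [indicator, hxy]
    simp_rw [this]
    rw [lintegral_indicator measurableSet_Ioi, hμ, Measure.restrict_restrict measurableSet_Ioi,
      Ioi_inter_Iio, lintegral_const_mul'' _ (hG.mono_set Ioo_subset_Iio_self)]
  have e2 : ∀ᵐ y ∂μ, ∫⁻ x, {z : ℝ × ℝ | z.1 < z.2}.indicator (fun z => h z.1 * G z.2) (x, y) ∂μ =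
      G y * ∫⁻ x in Iio y, h x := by
    filter_upwards [ae_restrict_mem measurableSet_Iio] with y hy
    have : ∀ x, {z : ℝ × ℝ | z.1 < z.2}.indicator (fun z => h z.1 * G z.2) (x, y) =
        (Iio y).indicator (fun x => G y * h x) x := fun x => by
      by_cases hxy : x < y <;> simp [indicator, hxy, mul_comm]
    simp_rw [this]
    rw [lintegral_indicator measurableSet_Iio, hμ, Measure.restrict_restrict measurableSet_Iio,
      Iio_inter_Iio, min_eq_left (le_of_lt hy),
      lintegral_const_mul'' _ (hh.mono_set (Iio_subset_Iio (le_of_lt hy)))]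
  simp_rw [e1] at hsw
  rw [hsw]
  exact lintegral_congr_ae e2

/-- Fubini on the triangle `x < y < t`. -/
theorem integral_triangle_swap (t : ℝ) {h G : ℝ → ℝ}
    (hh : AEStronglyMeasurable h (volume.restrict (Iio t)))
    (hG : AEStronglyMeasurable G (volume.restrict (Iio t)))
    (hfin : ∫⁻ y in Iio t, ‖G y‖ₑ * ∫⁻ x in Iio y, ‖h x‖ₑ ≠ ⊤) :
    IntegrableOn (fun x => h x * ∫ y in x..t, G y) (Iio t) ∧
    ∫ x in Iio t, h x * ∫ y in x..t, G y = ∫ y in Iio t, G y * ∫ x in Iio y, h x := by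
  set μ := (volume : Measure ℝ).restrict (Iio t) with hμ
  set F : ℝ → ℝ → ℝ := fun x y => {z : ℝ × ℝ | z.1 < z.2}.indicator (fun z => h z.1 * G z.2) (x, y)
    with hF
  have hm : AEStronglyMeasurable (Function.uncurry F) (μ.prod μ) :=
    (hh.comp_fst.mul hG.comp_snd).indicator (measurableSet_lt measurable_fst measurable_snd)
  have hi : Integrable (Function.uncurry F) (μ.prod μ) := by
    refine ⟨hm, ?_⟩
    rw [HasFiniteIntegral, lintegral_prod _ hm.enorm]
    have := lintegral_triangle_swap t hh.enorm hG.enorm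
    rw [← this] at hfin
    refine lt_of_le_of_lt (lintegral_mono fun x => ?_) hfin.lt_top
    have e : ∀ y, ‖Function.uncurry F (x, y)‖ₑ = (Ioi x).indicator (fun y => ‖h x‖ₑ * ‖G y‖ₑ) y :=
      fun y => by
        by_cases hxy : x < y <;> simp [hF, indicator, hxy, enorm_mul]
    simp_rw [e]
    rw [lintegral_indicator measurableSet_Ioi, hμ, Measure.restrict_restrict measurableSet_Ioi,
      Ioi_inter_Iio, lintegral_const_mul'' _ (hG.enorm.mono_set Ioo_subset_Iio_self)]
  have e1 : ∀ᵐ x ∂μ, ∫ y, F x y ∂μ = h x * ∫ y in x..t, G y := by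
    filter_upwards [ae_restrict_mem measurableSet_Iio] with x hx
    have : ∀ y, F x y = (Ioi x).indicator (fun y => h x * G y) y := fun y => by
      by_cases hxy : x < y <;> simp [hF, indicator, hxy]
    simp_rw [this]
    rw [integral_indicator measurableSet_Ioi, hμ, Measure.restrict_restrict measurableSet_Ioi,
      Ioi_inter_Iio, integral_const_mul, intervalIntegral.integral_of_le (le_of_lt hx),
      integral_Ioc_eq_integral_Ioo]
  have e2 : ∀ᵐ y ∂μ, ∫ x, F x y ∂μ = G y * ∫ x in Iio y, h x := by
    filter_upwards [ae_restrict_mem measurableSet_Iio] with y hy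
    have : ∀ x, F x y = (Iio y).indicator (fun x => G y * h x) x := fun x => by
      by_cases hxy : x < y <;> simp [hF, indicator, hxy, mul_comm]
    simp_rw [this]
    rw [integral_indicator measurableSet_Iio, hμ, Measure.restrict_restrict measurableSet_Iio,
      Iio_inter_Iio, min_eq_left (le_of_lt hy), integral_const_mul]
  refine ⟨hi.integral_prod_left.congr e1, ?_⟩
  have := integral_integral_swap hi
  rw [integral_congr_ae e1, integral_congr_ae e2] at this
  exact this

end HalfLine

/-! ### The space `W_0^{1,p}` on a half-line -/

section SobolevHalfLine

variable {p t : ℝ}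

theorem gradient_real (w : ℝ → ℝ) : gradient w = deriv w := by
  ext x; exact gradient_eq_deriv'

theorem IsTestFunction.eq_neg_integral_gradient {w : ℝ → ℝ} (h : IsTestFunction (Iio t) w)
    (x : ℝ) : w x = -∫ y in x..t, gradient w y := by
  rw [gradient_real, intervalIntegral.integral_deriv_eq_sub (fun y _ => h.differentiable y)
    ((h.1.continuous_deriv (by simp)).intervalIntegrable _ _)]
  have : w t = 0 := image_eq_zero_of_notMem_tsupport fun h' => lt_irrefl t (h.2.2 h')
  rw [this]; ring

/-- A limit of test functions in `W^{1,p}` is the primitive of its gradient vanishing at `t`. -/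
theorem ae_eq_neg_integral_of_tendsto (hp : 1 < p) {u G : ℝ → ℝ}
    (hu : AEStronglyMeasurable u ((gaussMeasure ℝ).restrict (Iio t)))
    (hG : MemLp G (ENNReal.ofReal p) ((gaussMeasure ℝ).restrict (Iio t)))
    {w : ℕ → ℝ → ℝ} (hw : ∀ n, IsTestFunction (Iio t) (w n))
    (h1 : Tendsto (fun n => eLpNorm (fun x => u x - w n x) (ENNReal.ofReal p)
        ((gaussMeasure ℝ).restrict (Iio t))) atTop (𝓝 0))
    (h2 : Tendsto (fun n => eLpNorm (fun x => G x - gradient (w n) x) (ENNReal.ofReal p)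
        ((gaussMeasure ℝ).restrict (Iio t))) atTop (𝓝 0)) :
    ∀ᵐ x ∂(volume.restrict (Iio t)), u x = -∫ y in x..t, G y := by
  set μ := (gaussMeasure ℝ).restrict (Iio t) with hμ
  have h1' : Tendsto (fun n => eLpNorm (w n - u) (ENNReal.ofReal p) μ) atTop (𝓝 0) := by
    refine h1.congr fun n => ?_
    rw [eLpNorm_sub_comm]; rfl
  -- A subsequence converges almost everywhere. At each such `x` the primitives over `(x, t)` also
  -- converge, by the local `L^1` bound, and the two limits must agree.
  have hmeas := tendstoInMeasure_of_tendsto_eLpNorm (by simp; linarith)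
    (fun n => (hw n).continuous.aestronglyMeasurable) hu h1'
  obtain ⟨ns, hns, hae⟩ := hmeas.exists_seq_tendsto_ae
  rw [← ae_restrict_gaussMeasure_iff]
  filter_upwards [hae, ae_restrict_mem measurableSet_Iio] with x hx hxt
  refine tendsto_nhds_unique hx ?_
  obtain ⟨C, hC, hle⟩ := exists_lintegral_Ioo_le hp x t
  have h3 : Tendsto (fun n => (C * eLpNorm (fun x => G x - gradient (w (ns n)) x)
      (ENNReal.ofReal p) μ).toReal) atTop (𝓝 0) := by
    have := ENNReal.Tendsto.const_mul (h2.comp hns.tendsto_atTop) (Or.inr hC)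
    rw [mul_zero] at this
    exact (ENNReal.tendsto_toReal ENNReal.zero_ne_top).comp this
  rw [tendsto_iff_norm_sub_tendsto_zero]
  refine squeeze_zero (fun n => norm_nonneg _) (fun n => ?_) h3
  have hmG : MemLp (fun x => G x - gradient (w (ns n)) x) (ENNReal.ofReal p) μ :=
    hG.sub ((hw (ns n)).memGaussSobolev p).2.2
  rw [(hw (ns n)).eq_neg_integral_gradient x, sub_neg_eq_add, neg_add_eq_sub,
    ← intervalIntegral.integral_sub (hG.intervalIntegrable_of_gauss hp (le_of_lt hxt) le_rfl)
      (((hw (ns n)).memGaussSobolev p).2.2.intervalIntegrable_of_gauss hp (le_of_lt hxt) le_rfl),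
    intervalIntegral.integral_of_le (le_of_lt hxt), integral_Ioc_eq_integral_Ioo]
  refine (norm_integral_le_lintegral_norm _).trans ?_
  refine ENNReal.toReal_mono (ENNReal.mul_ne_top hC hmG.2.ne) ?_
  simp_rw [ofReal_norm]
  exact hle _ hmG.1

theorem MemGaussSobolevZero.ae_eq_neg_integral (hp : 1 < p) {u G : ℝ → ℝ}
    (h : MemGaussSobolevZero p (Iio t) u G) :
    ∀ᵐ x ∂(volume.restrict (Iio t)), u x = -∫ y in x..t, G y := by
  obtain ⟨w, hw, h1, h2⟩ := h.exists_seq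
  exact ae_eq_neg_integral_of_tendsto hp h.1.2.1.1 h.1.2.2 hw h1 h2

theorem locallyIntegrableOn_of_memLp_gauss (hp : 1 < p) {G : ℝ → ℝ}
    (hG : MemLp G (ENNReal.ofReal p) ((gaussMeasure ℝ).restrict (Iio t))) :
    LocallyIntegrableOn G (Iio t) volume := by
  rw [locallyIntegrableOn_iff isOpen_Iio.isLocallyClosed]
  intro K hK hKc
  obtain ⟨a, ha⟩ := hKc.bddBelow
  rcases le_or_gt a t with h | h
  · have := (hG.intervalIntegrable_of_gauss hp h le_rfl)
    rw [intervalIntegrable_iff_integrableOn_Icc_of_le h] at this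
    exact this.mono_set fun x hx => ⟨ha hx, le_of_lt (hK hx)⟩
  · have : K = ∅ := eq_empty_of_forall_notMem fun x hx => by
      have := ha hx; have h2 : x < t := hK hx; linarith
    simp [this]

/-- Fubini on the triangle `x < y < t` moves the inner integral from `G` to `η'`, and `∫_{-∞}^y η' =
η(y)`. No regularity of `G` is used; the double integral converges because `η'` vanishes near `-∞`.
-/
theorem hasWeakGradientOn_of_ae_eq (hp : 1 < p) {u G : ℝ → ℝ}
    (hu : MemLp u (ENNReal.ofReal p) ((gaussMeasure ℝ).restrict (Iio t)))
    (hG : MemLp G (ENNReal.ofReal p) ((gaussMeasure ℝ).restrict (Iio t)))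
    (h : ∀ᵐ x ∂(volume.restrict (Iio t)), u x = -∫ y in x..t, G y) :
    HasWeakGradientOn (Iio t) u G := by
  refine ⟨locallyIntegrableOn_of_memLp_gauss hp hu, locallyIntegrableOn_of_memLp_gauss hp hG,
    fun η hη e => ?_⟩
  have hd : Continuous (deriv η) := hη.1.continuous_deriv (by simp)
  have hdc : HasCompactSupport (deriv η) := hη.2.1.deriv
  have hGm : AEStronglyMeasurable G (volume.restrict (Iio t)) :=
    hG.1.mono_ac (absolutelyContinuous_gaussMeasure.restrict _)
  obtain ⟨a, ha⟩ := (show IsCompact (tsupport (deriv η)) from hdc).bddBelow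
  have hfin : ∫⁻ y in Iio t, ‖G y‖ₑ * ∫⁻ x in Iio y, ‖deriv η x‖ₑ ≠ ⊤ := by
    have hI : ∫⁻ x, ‖deriv η x‖ₑ ≠ ⊤ := (hd.integrable_of_hasCompactSupport hdc).2.ne
    obtain ⟨C, hC, hle⟩ := exists_lintegral_Ioo_le hp (a - 1) t
    have : ∫⁻ y in Iio t, ‖G y‖ₑ * ∫⁻ x in Iio y, ‖deriv η x‖ₑ ≤
        (∫⁻ y in Ioo (a - 1) t, ‖G y‖ₑ) * ∫⁻ x, ‖deriv η x‖ₑ := by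
      rw [← lintegral_mul_const' _ _ hI, ← lintegral_indicator measurableSet_Iio,
        ← lintegral_indicator measurableSet_Ioo]
      refine lintegral_mono fun y => ?_
      by_cases hy : y < t
      · by_cases hya : a - 1 < y
        · simp only [indicator, mem_Iio, hy, mem_Ioo, hya, and_self, ite_true]
          gcongr
          exact Measure.restrict_le_self
        · simp only [indicator, mem_Iio, hy, mem_Ioo, hya, false_and, ite_true, ite_false]
          have : ∫⁻ x in Iio y, ‖deriv η x‖ₑ = 0 := by
            rw [setLIntegral_congr_fun (g := fun _ => 0) measurableSet_Iio, lintegral_zero]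
            intro x hx
            have : deriv η x = 0 := image_eq_zero_of_notMem_tsupport fun h' => by
              have := ha h'; simp only [mem_Iio] at hx; linarith
            simp [this]
          rw [this, mul_zero]
      · simp [indicator, hy]
    refine ne_top_of_le_ne_top (ENNReal.mul_ne_top ?_ hI) this
    exact ne_top_of_le_ne_top (ENNReal.mul_ne_top hC hG.2.ne) (hle G hG.1)
  obtain ⟨-, hF⟩ := integral_triangle_swap t hd.aestronglyMeasurable hGm hfin
  have e1 : ∫ x in Iio t, u x * fderiv ℝ η x e =
      -e * ∫ x in Iio t, deriv η x * ∫ y in x..t, G y := by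
    rw [← integral_const_mul]
    refine integral_congr_ae (h.mono fun x hx => ?_)
    have : fderiv ℝ η x e = e * deriv η x := by
      rw [← fderiv_apply_one_eq_deriv]
      conv_lhs => rw [show e = e • (1 : ℝ) by simp]
      rw [map_smul, smul_eq_mul]
    simp only [this, hx]
    ring
  have e2 : ∫ y in Iio t, G y * ∫ x in Iio y, deriv η x = ∫ y in Iio t, G y * η y := by
    congr 1
    ext y
    rw [← integral_Iic_eq_integral_Iio, hη.2.1.integral_Iic_deriv_eq (hη.1.of_le (by simp))]
  rw [e1, hF, e2, neg_mul, ← integral_const_mul]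
  congr 2
  ext x
  simp only [inner, RCLike.re_to_real, star_trivial]
  ring

end SobolevHalfLine

/-! ### Density of test functions -/

section Density

variable {p t : ℝ}

/-- Dominated convergence for multipliers. It handles truncation near `t` as well as the cutoffs at
`-∞` and their derivatives. -/
theorem tendsto_eLpNorm_mul_zero {α : Type*} [MeasurableSpace α] {μ : Measure α} (hp : 1 < p)
    {f : α → ℝ} (hf : MemLp f (ENNReal.ofReal p) μ) {θ : ℕ → α → ℝ} {C : ℝ}
    (hθm : ∀ n, AEStronglyMeasurable (θ n) μ) (hθC : ∀ n x, |θ n x| ≤ C)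
    (hθ : ∀ᵐ x ∂μ, Tendsto (fun n => θ n x) atTop (𝓝 0)) :
    Tendsto (fun n => eLpNorm (fun x => θ n x * f x) (ENNReal.ofReal p) μ) atTop (𝓝 0) := by
  have hp0 : 0 < p := by linarith
  have key : Tendsto (fun n => ∫⁻ x, ‖θ n x * f x‖ₑ ^ p ∂μ) atTop (𝓝 (∫⁻ x, 0 ∂μ)) := by
    refine tendsto_lintegral_of_dominated_convergence' (fun x => ‖C * f x‖ₑ ^ p) (fun n => ?_)
      (fun n => ?_) ?_ ?_
    · exact ((hθm n).mul hf.1).enorm.pow_const p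
    · refine Eventually.of_forall fun x => ?_
      have : ‖θ n x * f x‖ₑ ≤ ‖C * f x‖ₑ := by
        rw [enorm_mul, enorm_mul]
        gcongr
        rw [enorm_le_iff_norm_le, Real.norm_eq_abs, Real.norm_eq_abs]
        exact (hθC n x).trans (le_abs_self C)
      exact ENNReal.rpow_le_rpow this hp0.le
    · rw [lintegral_enorm_rpow_eq_eLpNorm hp]
      exact ENNReal.rpow_ne_top_of_nonneg hp0.le (hf.const_mul C).2.ne
    · filter_upwards [hθ] with x hx
      have h1 : Tendsto (fun n => ‖θ n x * f x‖ₑ) atTop (𝓝 0) := by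
        have := (hx.mul_const (f x)).enorm
        simpa using this
      have := h1.ennrpow_const p
      rwa [ENNReal.zero_rpow_of_pos hp0] at this
  simp_rw [lintegral_enorm_rpow_eq_eLpNorm hp, lintegral_zero] at key
  have := key.ennrpow_const (1 / p)
  rw [ENNReal.zero_rpow_of_pos (by positivity)] at this
  refine this.congr fun n => ?_
  rw [← ENNReal.rpow_mul, mul_one_div_cancel hp0.ne', ENNReal.rpow_one]

/-- Smooth functions supported strictly inside `(-∞, t)` are dense in `L^p`. -/
theorem exists_smooth_approx_Iio (hp : 1 < p) {G : ℝ → ℝ}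
    (hG : MemLp G (ENNReal.ofReal p) ((gaussMeasure ℝ).restrict (Iio t))) {ε : ENNReal}
    (hε : 0 < ε) : ∃ (h : ℝ → ℝ) (b : ℝ), b < t ∧ ContDiff ℝ (⊤ : ℕ∞) h ∧
      HasCompactSupport h ∧ (∀ x, b ≤ x → h x = 0) ∧
      eLpNorm (fun x => G x - h x) (ENNReal.ofReal p) ((gaussMeasure ℝ).restrict (Iio t)) < ε := by
  set μ := (gaussMeasure ℝ).restrict (Iio t) with hμ
  have hp1 : 1 ≤ ENNReal.ofReal p := by simpa using hp.le
  have hθ := tendsto_eLpNorm_mul_zero hp hG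
    (θ := fun n : ℕ => (Ici (t - 2 * (1 / ((n : ℝ) + 1)))).indicator fun _ => (1 : ℝ)) (C := 1)
    (fun n => (measurable_const.indicator measurableSet_Ici).aestronglyMeasurable)
    (fun n x => by
      by_cases h : x ∈ Ici (t - 2 * (1 / ((n : ℝ) + 1)))
      · rw [indicator_of_mem h, abs_one]
      · rw [indicator_of_notMem h, abs_zero]; exact zero_le_one)
    (by
      filter_upwards [ae_restrict_mem measurableSet_Iio] with x hx
      have hx' : 0 < t - x := sub_pos.2 hx
      have h0 : Tendsto (fun n : ℕ => 2 * (1 / ((n : ℝ) + 1))) atTop (𝓝 0) := by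
        simpa using (tendsto_one_div_add_atTop_nhds_zero_nat (𝕜 := ℝ)).const_mul 2
      refine tendsto_const_nhds.congr' ?_
      filter_upwards [h0.eventually_lt_const hx'] with n hn
      rw [indicator_of_notMem]
      simp only [mem_Ici, not_le]
      linarith)
  have hε2 : 0 < ε / 2 := ENNReal.half_pos hε.ne'
  obtain ⟨n, hn⟩ := (hθ.eventually_lt_const hε2).exists
  set a : ℝ := 1 / ((n : ℝ) + 1) with ha
  have ha0 : 0 < a := by positivity
  set G' : ℝ → ℝ := (Iio (t - 2 * a)).indicator G with hG'
  have hG'm : MemLp G' (ENNReal.ofReal p) μ := hG.indicator measurableSet_Iio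
  obtain ⟨δ, hδ0, hδ⟩ : ∃ δ : ℝ, 0 < δ ∧ ENNReal.ofReal δ < ε / 2 := by
    obtain ⟨δ, h1, h2⟩ := ENNReal.lt_iff_exists_nnreal_btwn.1 hε2
    exact ⟨δ, by simpa using h1, by simpa using h2⟩
  obtain ⟨g, hgc, hgs, hg⟩ := hG'm.exist_eLpNorm_sub_le ENNReal.ofReal_ne_top hp1 hδ0
  -- `s` equals `1` for `x ≤ t - 2a`, where the truncated `G'` lives, and `0` for `x ≥ t - a`. Since
  -- `s G' = G'`, multiplying the approximant by `s` costs nothing beyond the truncation error and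
  -- `δ`.
  set s : ℝ → ℝ := fun x => Real.smoothTransition ((t - a - x) / a) with hs
  have hsC : ContDiff ℝ (⊤ : ℕ∞) s := Real.smoothTransition.contDiff.comp (by fun_prop)
  refine ⟨fun x => s x * g x, t - a, by linarith, hsC.mul (hgs.of_le le_rfl), hgc.mul_left,
    fun x hx => ?_, ?_⟩
  · simp only [hs]
    rw [Real.smoothTransition.zero_of_nonpos, zero_mul]
    exact div_nonpos_of_nonpos_of_nonneg (by linarith) ha0.le
  · have hdec : (fun x => G x - s x * g x) =
        (fun x => (Ici (t - 2 * a)).indicator (fun _ => (1 : ℝ)) x * G x) +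
          fun x => s x * (G' - g) x := by
      ext x
      by_cases hx : x < t - 2 * a
      · have : s x = 1 := by
          simp only [hs]
          apply Real.smoothTransition.one_of_one_le
          rw [le_div_iff₀ ha0]; linarith
        rw [Pi.add_apply, Pi.sub_apply, hG', indicator_of_mem (mem_Iio.2 hx), this,
          indicator_of_notMem (notMem_Ici.2 hx)]
        ring
      · rw [Pi.add_apply, Pi.sub_apply, hG', indicator_of_notMem (notMem_Iio.2 (not_lt.1 hx)),
          indicator_of_mem (mem_Ici.2 (not_lt.1 hx))]
        ring
    have hm2 : AEStronglyMeasurable (fun x => s x * (G' - g) x) μ :=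
      hsC.continuous.aestronglyMeasurable.mul (hG'm.1.sub hgs.continuous.aestronglyMeasurable)
    rw [hdec]
    refine (eLpNorm_add_le ?_ hm2 hp1).trans_lt ?_
    · exact ((measurable_const.indicator measurableSet_Ici).aestronglyMeasurable).mul hG.1
    · have : eLpNorm (fun x => s x * (G' - g) x) (ENNReal.ofReal p) μ ≤ ENNReal.ofReal δ := by
        refine (eLpNorm_mono_real (g := fun x => ‖(G' - g) x‖) fun x => ?_).trans
          ((eLpNorm_norm _).trans_le hg)
        rw [norm_mul]
        refine mul_le_of_le_one_left (norm_nonneg _) ?_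
        rw [Real.norm_eq_abs, abs_of_nonneg (Real.smoothTransition.nonneg _)]
        exact Real.smoothTransition.le_one _
      calc _ < ε / 2 + ε / 2 := ENNReal.add_lt_add hn (this.trans_lt hδ)
        _ = ε := ENNReal.add_halves ε

/-- A smooth bump equal to `1` on the unit ball and supported in the ball of radius `2`. -/
noncomputable def unitBump (E : Type*) [NormedAddCommGroup E] [InnerProductSpace ℝ E] :
    ContDiffBump (0 : E) := ⟨1, 2, one_pos, one_lt_two⟩

/-- The rescaled cutoff `x ↦ χ(x / (n+1))`. -/
noncomputable def cutoff (E : Type*) [NormedAddCommGroup E] [InnerProductSpace ℝ E] (n : ℕ)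
    (x : E) : ℝ := unitBump E (((n : ℝ) + 1)⁻¹ • x)

section Cutoff

variable {E : Type*} [NormedAddCommGroup E] [InnerProductSpace ℝ E]

theorem contDiff_cutoff (n : ℕ) : ContDiff ℝ (⊤ : ℕ∞) (cutoff E n) :=
  (unitBump E).contDiff.comp (contDiff_const_smul _)

theorem abs_cutoff_le_one (n : ℕ) (x : E) : |cutoff E n x| ≤ 1 := by
  rw [cutoff, abs_of_nonneg (unitBump E).nonneg]
  exact (unitBump E).le_one

theorem cutoff_eq_one {n : ℕ} {x : E} (h : ‖x‖ ≤ (n : ℝ) + 1) : cutoff E n x = 1 := by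
  apply (unitBump E).one_of_mem_closedBall
  have : (0 : ℝ) < (n : ℝ) + 1 := by positivity
  simp only [unitBump, mem_closedBall_zero_iff, norm_smul, norm_inv, Real.norm_eq_abs,
    abs_of_pos this]
  rw [inv_mul_le_iff₀ this]; linarith

theorem tendsto_cutoff (x : E) : Tendsto (fun n => cutoff E n x) atTop (𝓝 1) := by
  refine tendsto_const_nhds.congr' ?_
  obtain ⟨m, hm⟩ := exists_nat_ge ‖x‖
  filter_upwards [eventually_ge_atTop m] with n hn
  rw [cutoff_eq_one]
  have : (m : ℝ) ≤ n := by exact_mod_cast hn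
  linarith

theorem hasCompactSupport_cutoff [FiniteDimensional ℝ E] (n : ℕ) :
    HasCompactSupport (cutoff E n) := by
  have hne : ((n : ℝ) + 1)⁻¹ ≠ 0 := by positivity
  exact (unitBump E).hasCompactSupport.comp_homeomorph (Homeomorph.smulOfNeZero _ hne)

theorem exists_norm_fderiv_cutoff_le [FiniteDimensional ℝ E] :
    ∃ C : ℝ, 0 ≤ C ∧ ∀ (n : ℕ) (x : E), ‖fderiv ℝ (cutoff E n) x‖ ≤ C * (1 / ((n : ℝ) + 1)) := by
  have hcs : HasCompactSupport (fderiv ℝ (unitBump E)) := (unitBump E).hasCompactSupport.fderiv ℝ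
  have hcont : Continuous (fderiv ℝ (unitBump E)) :=
    ((unitBump E).contDiff (n := 1)).continuous_fderiv one_ne_zero
  obtain ⟨C, hC⟩ := hcs.exists_bound_of_continuous hcont
  refine ⟨C, (norm_nonneg _).trans (hC 0), fun n x => ?_⟩
  have : fderiv ℝ (cutoff E n) x = ((n : ℝ) + 1)⁻¹ •
      fderiv ℝ (unitBump E) (((n : ℝ) + 1)⁻¹ • x) := by
    have := fderiv_comp_smul (f := unitBump E) (((n : ℝ) + 1)⁻¹) (x := x) (𝕜 := ℝ)
    exact this
  rw [this, norm_smul, norm_inv, Real.norm_eq_abs, abs_of_pos (by positivity : (0 : ℝ) < (n : ℝ) + 1),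
    mul_comm, one_div]
  gcongr
  exact hC _

end Cutoff

theorem tendsto_eLpNorm_cutoff (hp : 1 < p) {μ : Measure ℝ} {f : ℝ → ℝ}
    (hf : MemLp f (ENNReal.ofReal p) μ) :
    Tendsto (fun n => eLpNorm (fun x => (1 - cutoff ℝ n x) * f x) (ENNReal.ofReal p) μ)
      atTop (𝓝 0) := by
  refine tendsto_eLpNorm_mul_zero hp hf (C := 2)
    (fun n => (continuous_const.sub (contDiff_cutoff n).continuous).aestronglyMeasurable)
    (fun n x => ?_) (Eventually.of_forall fun x => ?_)
  · have := abs_le.1 (abs_cutoff_le_one n x)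
    rw [abs_le]; constructor <;> linarith
  · simpa using (tendsto_cutoff x).const_sub 1

theorem tendsto_eLpNorm_deriv_cutoff (hp : 1 < p) {μ : Measure ℝ} {f : ℝ → ℝ}
    (hf : MemLp f (ENNReal.ofReal p) μ) :
    Tendsto (fun n => eLpNorm (fun x => deriv (cutoff ℝ n) x * f x) (ENNReal.ofReal p) μ)
      atTop (𝓝 0) := by
  obtain ⟨C, hC0, hC⟩ := exists_norm_fderiv_cutoff_le (E := ℝ)
  have hb : ∀ n x, |deriv (cutoff ℝ n) x| ≤ C * (1 / ((n : ℝ) + 1)) := fun n x => by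
    rw [← Real.norm_eq_abs, norm_deriv_eq_norm_fderiv]; exact hC n x
  refine tendsto_eLpNorm_mul_zero hp hf (C := C)
    (fun n => ((contDiff_cutoff n).continuous_deriv (by simp)).aestronglyMeasurable)
    (fun n x => ?_) (Eventually.of_forall fun x => ?_)
  · refine (hb n x).trans (mul_le_of_le_one_right hC0 ?_)
    rw [div_le_one (by positivity)]
    have : (0 : ℝ) ≤ n := by positivity
    linarith
  · rw [tendsto_zero_iff_abs_tendsto_zero]
    refine squeeze_zero (fun n => abs_nonneg _) (fun n => hb n x) ?_
    simpa using (tendsto_one_div_add_atTop_nhds_zero_nat (𝕜 := ℝ)).const_mul C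

/-- A function which is the primitive of its gradient vanishing at `t` lies in `W_0^{1,p}`. -/
theorem memGaussSobolevZero_of_ae_eq (hp : 1 < p) {u G : ℝ → ℝ}
    (hu : MemLp u (ENNReal.ofReal p) ((gaussMeasure ℝ).restrict (Iio t)))
    (hG : MemLp G (ENNReal.ofReal p) ((gaussMeasure ℝ).restrict (Iio t)))
    (h : ∀ᵐ x ∂(volume.restrict (Iio t)), u x = -∫ y in x..t, G y) :
    MemGaussSobolevZero p (Iio t) u G := by
  refine ⟨⟨hasWeakGradientOn_of_ae_eq hp hu hG h, hu, hG⟩, fun ε hε => ?_⟩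
  set μ := (gaussMeasure ℝ).restrict (Iio t) with hμ
  set P := ENNReal.ofReal p
  have hp1 : 1 ≤ P := by simpa [P] using hp.le
  have hε2 : 0 < ε / 2 := ENNReal.half_pos hε.ne'
  have hA : Tendsto (fun n => eLpNorm (fun x => (1 - cutoff ℝ n x) * u x) P μ +
      (eLpNorm (fun x => (1 - cutoff ℝ n x) * G x) P μ +
        eLpNorm (fun x => deriv (cutoff ℝ n) x * u x) P μ)) atTop (𝓝 0) := by
    simpa using (tendsto_eLpNorm_cutoff hp hu).add
      ((tendsto_eLpNorm_cutoff hp hG).add (tendsto_eLpNorm_deriv_cutoff hp hu))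
  -- The cutoff is fixed before the gradient is approximated, because `M` and `C` below depend on
  -- its slope and on its support.
  obtain ⟨n, hn⟩ := (hA.eventually_lt_const hε2).exists
  set χ := cutoff ℝ n with hχ
  have hχs : ContDiff ℝ (⊤ : ℕ∞) χ := contDiff_cutoff n
  have hχd : Continuous (deriv χ) := hχs.continuous_deriv (by simp)
  have hχc : HasCompactSupport χ := hasCompactSupport_cutoff n
  obtain ⟨M, hM⟩ := hχc.deriv.exists_bound_of_continuous hχd
  obtain ⟨a, ha⟩ := (show IsCompact (tsupport χ) from hχc).bddBelow
  have hχ0 : ∀ x < a, χ x = 0 := fun x hx => image_eq_zero_of_notMem_tsupport fun h' =>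
    absurd (ha h') (not_le.2 hx)
  have hχ0' : ∀ x < a, deriv χ x = 0 := fun x hx => image_eq_zero_of_notMem_tsupport fun h' =>
    absurd (ha (tsupport_deriv_subset h')) (not_le.2 hx)
  obtain ⟨C, hC, hle⟩ := exists_lintegral_Ioo_le hp (a - 1) t
  -- the total error is `A + B * δ`
  set B : ENNReal := μ univ ^ P.toReal⁻¹ * C + (1 + μ univ ^ P.toReal⁻¹ * (ENNReal.ofReal M * C))
    with hB
  have hmu : μ univ ^ P.toReal⁻¹ ≠ ⊤ :=
    ENNReal.rpow_ne_top_of_nonneg (by positivity) (measure_ne_top _ _)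
  have hBt : B ≠ ⊤ := by
    simp only [hB, ne_eq, ENNReal.add_eq_top, not_or]
    exact ⟨ENNReal.mul_ne_top hmu hC, ENNReal.one_ne_top,
      ENNReal.mul_ne_top hmu (ENNReal.mul_ne_top ENNReal.ofReal_ne_top hC)⟩
  obtain ⟨δ, hδ0, hδ⟩ : ∃ δ : ENNReal, 0 < δ ∧ B * δ < ε / 2 := by
    have : Tendsto (fun δ : ENNReal => B * δ) (𝓝[>] 0) (𝓝 (B * 0)) :=
      (ENNReal.Tendsto.const_mul tendsto_id (Or.inr hBt)).mono_left nhdsWithin_le_nhds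
    rw [mul_zero] at this
    obtain ⟨δ, h1, h2⟩ := ((this.eventually_lt_const hε2).and self_mem_nhdsWithin).exists
    exact ⟨δ, h2, h1⟩
  -- The approximating gradient vanishes on `[b, ∞)`, so its primitive from `t` vanishes there too,
  -- and the product with the cutoff is compactly supported strictly inside the half-line.
  obtain ⟨g, b, hbt, hgs, hgc, hg0, hg⟩ := exists_smooth_approx_Iio hp hG hδ0
  set H : ℝ → ℝ := fun x => -∫ y in x..t, g y with hH
  have hHd : ∀ x, HasDerivAt H (g x) x := fun x => by
    have := (intervalIntegral.integral_hasDerivAt_left (hgs.continuous.intervalIntegrable x t)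
      hgs.continuous.aestronglyMeasurable.stronglyMeasurableAtFilter hgs.continuous.continuousAt).neg
    rw [neg_neg] at this
    exact this
  have hHs : ContDiff ℝ (⊤ : ℕ∞) H := by
    have : ContDiff ℝ ((⊤ : ℕ∞) + 1) H := by
      rw [contDiff_succ_iff_deriv]
      refine ⟨fun x => (hHd x).differentiableAt, by simp, ?_⟩
      rw [show deriv H = g from funext fun x => (hHd x).deriv]
      exact hgs
    exact this.of_le (by simp)
  have hH0 : ∀ x, b ≤ x → H x = 0 := fun x hx => by
    simp only [hH, neg_eq_zero]
    rw [intervalIntegral.integral_congr (g := fun _ => (0 : ℝ)), intervalIntegral.integral_zero]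
    intro y hy
    apply hg0
    rcases le_total x t with h1 | h1
    · rw [uIcc_of_le h1] at hy; exact hx.trans hy.1
    · rw [uIcc_of_ge h1] at hy; exact hbt.le.trans hy.1
  have hGm : MemLp (fun x => G x - g x) P μ := hG.sub (hgs.continuous.memLp_of_hasCompactSupport hgc)
  have huH : ∀ᵐ x ∂μ, a - 1 < x → ‖u x - H x‖ ≤ (C * δ).toReal := by
    have h' := ae_restrict_gaussMeasure_iff.2 h
    filter_upwards [h', ae_restrict_mem measurableSet_Iio] with x hx hxt hxa
    have hxt' : x ≤ t := le_of_lt hxt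
    rw [hx, hH]
    simp only
    rw [neg_sub_neg, ← intervalIntegral.integral_sub (hgs.continuous.intervalIntegrable _ _)
      (hG.intervalIntegrable_of_gauss hp hxt' le_rfl), intervalIntegral.integral_of_le hxt',
      integral_Ioc_eq_integral_Ioo]
    refine (norm_integral_le_lintegral_norm _).trans ?_
    -- The constant `B` contains the summand `1`, hence `B ≠ 0`, and `B * δ < ε / 2` rules out `δ =
    -- ⊤`.
    have hδt : δ ≠ ⊤ := fun h => by
      rw [h] at hδ
      have hB0 : B ≠ 0 := by
        simp only [hB, ne_eq, add_eq_zero, not_and]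
        intro _ h; simp at h
      rw [ENNReal.mul_top hB0] at hδ
      exact not_top_lt hδ
    refine ENNReal.toReal_mono (ENNReal.mul_ne_top hC hδt) ?_
    simp_rw [ofReal_norm]
    calc ∫⁻ y in Ioo x t, ‖g y - G y‖ₑ ≤ ∫⁻ y in Ioo (a - 1) t, ‖G y - g y‖ₑ := by
          simp_rw [fun y => enorm_sub_rev (g y) (G y)]
          exact lintegral_mono_set (Ioo_subset_Ioo_left hxa.le)
      _ ≤ C * eLpNorm (fun x => G x - g x) P μ := hle _ hGm.1
      _ ≤ C * δ := by gcongr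
  have hδt : C * δ ≠ ⊤ := ENNReal.mul_ne_top hC fun h => by
      rw [h] at hδ
      have hB0 : B ≠ 0 := by
        simp only [hB, ne_eq, add_eq_zero, not_and]
        intro _ h; simp at h
      rw [ENNReal.mul_top hB0] at hδ
      exact not_top_lt hδ
  -- the approximating test function
  set w : ℝ → ℝ := fun x => χ x * H x with hw
  have hwd : ∀ x, deriv w x = deriv χ x * H x + χ x * g x := fun x =>
    (((hχs.differentiable (by simp)) x).hasDerivAt.mul (hHd x)).deriv
  refine ⟨w, ⟨hχs.mul hHs, hχc.mul_right, ?_⟩, ?_⟩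
  · have : tsupport w ⊆ Iic b := by
      refine closure_minimal (fun x hx => ?_) isClosed_Iic
      by_contra hxb
      exact hx (by simp only [hw]; rw [hH0 x (le_of_lt (not_le.1 hxb)), mul_zero])
    exact fun x hx => lt_of_le_of_lt (this hx) hbt
  · have hum := hu.1
    have hHm : AEStronglyMeasurable H μ := hHs.continuous.aestronglyMeasurable
    have hχm : AEStronglyMeasurable χ μ := hχs.continuous.aestronglyMeasurable
    have hχm' : AEStronglyMeasurable (deriv χ) μ := hχd.aestronglyMeasurable
    have d1 : (fun x => u x - w x) = (fun x => (1 - χ x) * u x) + fun x => χ x * (u x - H x) := by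
      ext x; simp only [hw, Pi.add_apply]; ring
    have d2 : (fun x => G x - gradient w x) = ((fun x => (1 - χ x) * G x) -
        fun x => deriv χ x * u x) + ((fun x => χ x * (G x - g x)) +
          fun x => deriv χ x * (u x - H x)) := by
      ext x; simp only [gradient_real, hwd, Pi.add_apply, Pi.sub_apply]; ring
    have b1 : eLpNorm (fun x => χ x * (u x - H x)) P μ ≤ μ univ ^ P.toReal⁻¹ * (C * δ) := by
      rw [← ENNReal.ofReal_toReal hδt]
      refine eLpNorm_le_of_ae_bound (huH.mono fun x hx => ?_)
      rcases lt_or_ge x a with hxa | hxa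
      · rw [hχ0 x hxa, zero_mul, norm_zero]; positivity
      · rw [norm_mul]
        exact (mul_le_of_le_one_left (norm_nonneg _) (abs_cutoff_le_one n x)).trans
          (hx (by linarith))
    have b2 : eLpNorm (fun x => χ x * (G x - g x)) P μ ≤ δ := by
      refine le_trans (eLpNorm_mono fun x => ?_) hg.le
      rw [norm_mul]
      exact mul_le_of_le_one_left (norm_nonneg _) (abs_cutoff_le_one n x)
    have b3 : eLpNorm (fun x => deriv χ x * (u x - H x)) P μ ≤
        μ univ ^ P.toReal⁻¹ * (ENNReal.ofReal M * (C * δ)) := by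
      have hM0 : 0 ≤ M := (norm_nonneg _).trans (hM 0)
      rw [← ENNReal.ofReal_toReal hδt, ← ENNReal.ofReal_mul hM0]
      refine eLpNorm_le_of_ae_bound (huH.mono fun x hx => ?_)
      rcases lt_or_ge x a with hxa | hxa
      · rw [hχ0' x hxa, zero_mul, norm_zero]; positivity
      · rw [norm_mul]
        exact mul_le_mul (hM x) (hx (by linarith)) (norm_nonneg _) hM0
    have m1 : AEStronglyMeasurable (fun x => (1 - χ x) * u x) μ :=
      (aestronglyMeasurable_const.sub hχm).mul hum
    have m2 : AEStronglyMeasurable (fun x => χ x * (u x - H x)) μ := hχm.mul (hum.sub hHm)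
    have m3 : AEStronglyMeasurable (fun x => (1 - χ x) * G x) μ :=
      (aestronglyMeasurable_const.sub hχm).mul hG.1
    have m4 : AEStronglyMeasurable (fun x => deriv χ x * u x) μ := hχm'.mul hum
    have m5 : AEStronglyMeasurable (fun x => χ x * (G x - g x)) μ := hχm.mul hGm.1
    have m6 : AEStronglyMeasurable (fun x => deriv χ x * (u x - H x)) μ := hχm'.mul (hum.sub hHm)
    rw [d1, d2]
    calc _ ≤ (eLpNorm (fun x => (1 - χ x) * u x) P μ + μ univ ^ P.toReal⁻¹ * (C * δ)) +
          ((eLpNorm (fun x => (1 - χ x) * G x) P μ + eLpNorm (fun x => deriv χ x * u x) P μ) +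
            (δ + μ univ ^ P.toReal⁻¹ * (ENNReal.ofReal M * (C * δ)))) := by
          refine add_le_add ((eLpNorm_add_le m1 m2 hp1).trans ?_)
            ((eLpNorm_add_le (m3.sub m4) (m5.add m6) hp1).trans ?_)
          · gcongr
          · refine add_le_add (eLpNorm_sub_le m3 m4 hp1) ((eLpNorm_add_le m5 m6 hp1).trans ?_)
            gcongr
      _ = (eLpNorm (fun x => (1 - χ x) * u x) P μ + (eLpNorm (fun x => (1 - χ x) * G x) P μ +
            eLpNorm (fun x => deriv χ x * u x) P μ)) + B * δ := by
          rw [hB]; ring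
      _ < ε / 2 + ε / 2 := ENNReal.add_lt_add hn hδ
      _ = ε := ENNReal.add_halves ε

end Density

/-! ### Hölder duality -/

section Duality

variable {α : Type*} [MeasurableSpace α] {μ : Measure α} {p : ℝ}

theorem conj_sub_one (hp : 1 < p) : (p - 1) * (p / (p - 1) - 1) = 1 := by
  have : p - 1 ≠ 0 := by linarith
  field_simp
  ring

theorem conj_sub_one' (hp : 1 < p) : (p / (p - 1) - 1) * (p - 1) = 1 := by
  rw [mul_comm]; exact conj_sub_one hp

theorem one_lt_conj (hp : 1 < p) : 1 < p / (p - 1) := by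
  rw [one_lt_div (by linarith)]; linarith

theorem MeasureTheory.MemLp.oddPow (hp : 1 < p) {f : α → ℝ} (hf : MemLp f (ENNReal.ofReal p) μ) :
    MemLp (fun x => oddPow p (f x)) (ENNReal.ofReal (p / (p - 1))) μ := by
  rw [memLp_ofReal_iff_integrable (one_lt_conj hp)
    ((continuous_oddPow hp).comp_aestronglyMeasurable hf.1)]
  refine (hf.integrable_norm_rpow_ofReal hp).congr (Eventually.of_forall fun x => ?_)
  simp only [Real.norm_eq_abs]
  rw [abs_oddPow hp, ← Real.rpow_mul (abs_nonneg _)]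
  congr 1
  have : p - 1 ≠ 0 := by linarith
  field_simp

theorem holderConjugate_ofReal (hp : 1 < p) :
    (ENNReal.ofReal (p / (p - 1))).HolderConjugate (ENNReal.ofReal p) := by
  have h := (Real.HolderConjugate.conjExponent hp).symm
  rw [Real.conjExponent] at h
  exact h.ennrealOfReal

theorem MeasureTheory.MemLp.integrable_mul_conj (hp : 1 < p) {f g : α → ℝ}
    (hf : MemLp f (ENNReal.ofReal (p / (p - 1))) μ) (hg : MemLp g (ENNReal.ofReal p) μ) :
    Integrable (fun x => f x * g x) μ := by
  have := holderConjugate_ofReal hp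
  exact MemLp.integrable_mul hf hg

theorem tendsto_integral_mul_conj (hp : 1 < p) {f g : α → ℝ} {gs : ℕ → α → ℝ}
    (hf : MemLp f (ENNReal.ofReal (p / (p - 1))) μ) (hg : MemLp g (ENNReal.ofReal p) μ)
    (hgs : ∀ n, MemLp (gs n) (ENNReal.ofReal p) μ)
    (h : Tendsto (fun n => eLpNorm (fun x => g x - gs n x) (ENNReal.ofReal p) μ) atTop (𝓝 0)) :
    Tendsto (fun n => ∫ x, f x * gs n x ∂μ) atTop (𝓝 (∫ x, f x * g x ∂μ)) := by
  have := holderConjugate_ofReal hp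
  have hm : AEStronglyMeasurable (fun x => f x * g x) μ := hf.1.mul hg.1
  refine tendsto_integral_of_L1' (fun x => f x * g x) hm
    (Eventually.of_forall fun n => hf.integrable_mul_conj hp (hgs n)) ?_
  have h2 := ENNReal.Tendsto.const_mul (a := eLpNorm f (ENNReal.ofReal (p / (p - 1))) μ) h
    (Or.inr hf.2.ne)
  rw [mul_zero] at h2
  refine tendsto_of_tendsto_of_tendsto_of_le_of_le tendsto_const_nhds h2 (fun n => zero_le)
    fun n => ?_
  have hle : eLpNorm (f • fun x => g x - gs n x) 1 μ ≤
      eLpNorm f (ENNReal.ofReal (p / (p - 1))) μ *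
        eLpNorm (fun x => g x - gs n x) (ENNReal.ofReal p) μ :=
    eLpNorm_smul_le_mul_eLpNorm (hg.sub (hgs n)).1 hf.1
  refine le_trans (le_of_eq ?_) hle
  refine eLpNorm_congr_norm_ae (Eventually.of_forall fun x => ?_)
  simp only [Pi.sub_apply, Pi.smul_apply', smul_eq_mul, ← mul_sub, norm_mul]
  rw [norm_sub_rev]

end Duality

/-! ### Regular solutions of the one-dimensional equation -/

/-- The flux `∫_{-∞}^y (α |u|^{p-2}u + 1) dγ`. -/
noncomputable def torsionFlux (p α : ℝ) (u : ℝ → ℝ) (y : ℝ) : ℝ :=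
  ∫ x in Iio y, (α * oddPow p (u x) + 1) ∂(gaussMeasure ℝ)

/-- The opposite of the derivative of a solution, expressed through the flux. -/
noncomputable def torsionSlope (p α : ℝ) (u : ℝ → ℝ) (y : ℝ) : ℝ :=
  oddPow (p / (p - 1)) (torsionFlux p α u y / gaussDensity y)

/-- Solutions of the one-dimensional equation in integrated form, extended by zero. -/
structure IsRegularSolution (p α t : ℝ) (u : ℝ → ℝ) : Prop where
  eq_zero : ∀ x, t ≤ x → u x = 0
  memLp : MemLp u (ENNReal.ofReal p) (gaussMeasure ℝ)
  eq_integral : ∀ x ≤ t, u x = ∫ y in x..t, torsionSlope p α u y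
  memLp_slope : MemLp (torsionSlope p α u) (ENNReal.ofReal p) ((gaussMeasure ℝ).restrict (Iio t))

section RegularSolution

variable {p α t : ℝ} {u : ℝ → ℝ}

theorem integrable_oddPow (hp : 1 < p) {μ : Measure ℝ} [IsFiniteMeasure μ]
    (hu : MemLp u (ENNReal.ofReal p) μ) : Integrable (fun x => oddPow p (u x)) μ :=
  (hu.oddPow hp).integrable (by simpa using (one_lt_conj hp).le)

theorem integrable_source (hp : 1 < p) (α : ℝ) {μ : Measure ℝ} [IsFiniteMeasure μ]
    (hu : MemLp u (ENNReal.ofReal p) μ) : Integrable (fun x => α * oddPow p (u x) + 1) μ :=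
  ((integrable_oddPow hp hu).const_mul α).add (integrable_const 1)

theorem integrable_gaussDensity_mul {f : ℝ → ℝ} (hf : Integrable f (gaussMeasure ℝ)) :
    Integrable (fun x => gaussDensity x * f x) := by
  have := (integrableOn_gaussMeasure_iff MeasurableSet.univ f).1 hf.integrableOn
  rwa [integrableOn_univ] at this

theorem hasDerivAt_setIntegral_Iio {f : ℝ → ℝ} (hf : Integrable f (gaussMeasure ℝ)) {y : ℝ}
    (hc : ContinuousAt f y) :
    HasDerivAt (fun y => ∫ x in Iio y, f x ∂(gaussMeasure ℝ)) (gaussDensity y * f y) y := by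
  have hi := integrable_gaussDensity_mul hf
  have e : (fun y => ∫ x in Iio y, f x ∂(gaussMeasure ℝ)) =
      fun y => (∫ x in Iic (0 : ℝ), gaussDensity x * f x) +
        ∫ x in (0 : ℝ)..y, gaussDensity x * f x := by
    ext y
    rw [setIntegral_gaussMeasure measurableSet_Iio, ← integral_Iic_eq_integral_Iio,
      ← intervalIntegral.integral_Iic_sub_Iic hi.integrableOn hi.integrableOn]
    ring
  rw [e]
  refine HasDerivAt.const_add _ ?_
  exact intervalIntegral.integral_hasDerivAt_right hi.intervalIntegrable
    (hi.1.stronglyMeasurableAtFilter) (continuous_gaussDensity.continuousAt.mul hc)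

theorem continuous_setIntegral_Iio {f : ℝ → ℝ} (hf : Integrable f (gaussMeasure ℝ)) :
    Continuous (fun y => ∫ x in Iio y, f x ∂(gaussMeasure ℝ)) := by
  have hi := integrable_gaussDensity_mul hf
  have e : (fun y => ∫ x in Iio y, f x ∂(gaussMeasure ℝ)) =
      fun y => (∫ x in Iic (0 : ℝ), gaussDensity x * f x) +
        ∫ x in (0 : ℝ)..y, gaussDensity x * f x := by
    ext y
    rw [setIntegral_gaussMeasure measurableSet_Iio, ← integral_Iic_eq_integral_Iio,
      ← intervalIntegral.integral_Iic_sub_Iic hi.integrableOn hi.integrableOn]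
    ring
  rw [e]
  exact continuous_const.add
    (intervalIntegral.continuous_primitive (fun a b => hi.intervalIntegrable) 0)

theorem continuous_torsionFlux (hp : 1 < p) (hu : MemLp u (ENNReal.ofReal p) (gaussMeasure ℝ)) :
    Continuous (torsionFlux p α u) :=
  continuous_setIntegral_Iio (integrable_source hp α hu)

theorem continuous_torsionSlope (hp : 1 < p) (hu : MemLp u (ENNReal.ofReal p) (gaussMeasure ℝ)) :
    Continuous (torsionSlope p α u) :=
  (continuous_oddPow (one_lt_conj hp)).comp
    ((continuous_torsionFlux hp hu).div continuous_gaussDensity fun x => (gaussDensity_pos x).ne')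

theorem oddPow_torsionSlope (hp : 1 < p) (y : ℝ) :
    oddPow p (torsionSlope p α u y) = torsionFlux p α u y / gaussDensity y :=
  oddPow_oddPow (conj_sub_one' hp) _

/-- The integration by parts behind the weak formulation. -/
theorem integral_source_mul_primitive (hp : 1 < p)
    (hu : MemLp u (ENNReal.ofReal p) (gaussMeasure ℝ)) {Ψ : ℝ → ℝ} (hΨ : IntegrableOn Ψ (Iio t)) :
    IntegrableOn (fun x => (α * oddPow p (u x) + 1) * ∫ y in x..t, Ψ y) (Iio t) (gaussMeasure ℝ) ∧
    ∫ x in Iio t, (α * oddPow p (u x) + 1) * (∫ y in x..t, Ψ y) ∂(gaussMeasure ℝ) =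
      ∫ y in Iio t, oddPow p (torsionSlope p α u y) * Ψ y ∂(gaussMeasure ℝ) := by
  have hi := integrable_gaussDensity_mul (integrable_source hp α hu)
  -- Integrability of `Ψ` with respect to Lebesgue measure makes the double integral a product of
  -- two finite ones. For general weighted gradients this may fail, and the weak form is then
  -- reached by density.
  have hfin : ∫⁻ y in Iio t, ‖Ψ y‖ₑ * ∫⁻ x in Iio y, ‖gaussDensity x * (α * oddPow p (u x) + 1)‖ₑ
      ≠ ⊤ := by
    have h1 : ∫⁻ x, ‖gaussDensity x * (α * oddPow p (u x) + 1)‖ₑ ≠ ⊤ := hi.2.ne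
    refine ne_top_of_le_ne_top (ENNReal.mul_ne_top hΨ.2.ne h1) ?_
    rw [← lintegral_mul_const' _ _ h1]
    gcongr
    exact Measure.restrict_le_self
  obtain ⟨h1, h2⟩ := integral_triangle_swap t hi.1.restrict hΨ.1 hfin
  constructor
  · rw [integrableOn_gaussMeasure_iff measurableSet_Iio]
    exact h1.congr_fun (fun x _ => by simp only; ring) measurableSet_Iio
  · rw [setIntegral_gaussMeasure measurableSet_Iio, setIntegral_gaussMeasure measurableSet_Iio]
    simp_rw [← mul_assoc]
    rw [h2]
    refine setIntegral_congr_fun measurableSet_Iio fun y _ => ?_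
    rw [oddPow_torsionSlope hp, mul_div_cancel₀ _ (gaussDensity_pos y).ne', torsionFlux,
      setIntegral_gaussMeasure measurableSet_Iio, mul_comm]

namespace IsRegularSolution

variable (h : IsRegularSolution p α t u)
include h

theorem continuous (hp : 1 < p) : Continuous u := by
  have hs : Continuous (torsionSlope p α u) := continuous_torsionSlope hp h.memLp
  have e : u = fun x => ∫ y in (min x t)..t, torsionSlope p α u y := by
    ext x
    rcases le_total x t with hx | hx
    · rw [min_eq_left hx]; exact h.eq_integral x hx
    · rw [min_eq_right hx, intervalIntegral.integral_same]; exact h.eq_zero x hx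
  have e2 : Continuous fun x => -∫ y in t..x, torsionSlope p α u y :=
    (intervalIntegral.continuous_primitive (fun a b => hs.intervalIntegrable a b) t).neg
  rw [e]
  convert e2.comp (continuous_id.min continuous_const : Continuous fun x => min x t) using 2 with x
  rw [intervalIntegral.integral_symm]; rfl

theorem hasDerivAt (hp : 1 < p) {x : ℝ} (hx : x < t) :
    HasDerivAt u (-torsionSlope p α u x) x := by
  have hs : Continuous (torsionSlope p α u) := continuous_torsionSlope hp h.memLp
  refine (intervalIntegral.integral_hasDerivAt_left (hs.intervalIntegrable x t)
    hs.aestronglyMeasurable.stronglyMeasurableAtFilter hs.continuousAt).congr_of_eventuallyEq ?_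
  filter_upwards [Iio_mem_nhds hx] with y hy
  exact h.eq_integral y (le_of_lt hy)

theorem hasDerivWithinAt (hp : 1 < p) :
    HasDerivWithinAt u (-torsionSlope p α u t) (Iic t) t := by
  have hs : Continuous (torsionSlope p α u) := continuous_torsionSlope hp h.memLp
  refine ((intervalIntegral.integral_hasDerivAt_left (hs.intervalIntegrable t t)
    hs.aestronglyMeasurable.stronglyMeasurableAtFilter hs.continuousAt).hasDerivWithinAt).congr
    (fun y hy => h.eq_integral y hy) (h.eq_integral t le_rfl)

theorem hasDerivAt_flux (hp : 1 < p) (y : ℝ) :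
    HasDerivAt (torsionFlux p α u) (gaussDensity y * (α * oddPow p (u y) + 1)) y :=
  hasDerivAt_setIntegral_Iio (integrable_source hp α h.memLp)
    ((((continuous_oddPow hp).comp (h.continuous hp)).const_smul α).add
      continuous_const).continuousAt

theorem memGaussSobolevZero (hp : 1 < p) :
    MemGaussSobolevZero p (Iio t) u (fun x => -torsionSlope p α u x) := by
  refine memGaussSobolevZero_of_ae_eq hp (h.memLp.restrict _) h.memLp_slope.neg ?_
  filter_upwards [ae_restrict_mem measurableSet_Iio] with x hx
  rw [intervalIntegral.integral_neg, neg_neg]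
  exact h.eq_integral x (le_of_lt hx)

/-- The weak formulation. -/
theorem weak_form (hp : 1 < p) {ψ Ψ : ℝ → ℝ} (hψ : MemGaussSobolevZero p (Iio t) ψ Ψ) :
    -∫ x in Iio t, oddPow p (torsionSlope p α u x) * Ψ x ∂(gaussMeasure ℝ) =
      α * (∫ x in Iio t, oddPow p (u x) * ψ x ∂(gaussMeasure ℝ)) +
        ∫ x in Iio t, ψ x ∂(gaussMeasure ℝ) := by
  set μ := (gaussMeasure ℝ).restrict (Iio t) with hμ
  have huμ : MemLp u (ENNReal.ofReal p) μ := h.memLp.restrict _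
  have hJ := huμ.oddPow hp
  have hS := h.memLp_slope.oddPow hp
  -- Test functions have Lebesgue-integrable gradients, so the Fubini identity applies to them. Both
  -- sides pass to the limit by Hölder, since odd powers of `L^p` functions lie in the dual space.
  obtain ⟨w, hw, h1, h2⟩ := hψ.exists_seq
  have hw1 := fun n => ((hw n).memGaussSobolev p).2.1
  have hw2 := fun n => ((hw n).memGaussSobolev p).2.2
  have key : ∀ n, -∫ x, oddPow p (torsionSlope p α u x) * gradient (w n) x ∂μ =
      α * (∫ x, oddPow p (u x) * w n x ∂μ) + ∫ x, w n x ∂μ := fun n => by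
    have hgi : IntegrableOn (gradient (w n)) (Iio t) :=
      ((hw n).continuous_gradient.integrable_of_hasCompactSupport
        (hw n).hasCompactSupport_gradient).integrableOn
    have := (integral_source_mul_primitive (α := α) hp h.memLp hgi).2
    rw [← this, ← integral_neg, ← integral_const_mul, ← integral_add]
    · refine integral_congr_ae (Eventually.of_forall fun x => ?_)
      simp only
      rw [(hw n).eq_neg_integral_gradient x]
      ring
    · exact (hJ.integrable_mul_conj hp (hw1 n)).const_mul α
    · exact (hw1 n).integrable (by simpa using hp.le)
  have l1 := (tendsto_integral_mul_conj hp hS hψ.1.2.2 hw2 h2).neg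
  have l2 := ((tendsto_integral_mul_conj hp hJ hψ.1.2.1 hw1 h1).const_mul α).add
    (tendsto_integral_of_eLpNorm hp hψ.1.2.1 hw1 h1)
  exact tendsto_nhds_unique l1 (l2.congr fun n => (key n).symm)

theorem isGenTorsionFunction (hp : 1 < p) : IsGenTorsionFunction p α (Iio t) u := by
  refine ⟨_, h.memGaussSobolevZero hp, fun ψ Ψ hψ => ?_⟩
  rw [show (∫ x in Iio t, |u x| ^ (p - 2) * u x * ψ x ∂(gaussMeasure ℝ)) =
    ∫ x in Iio t, oddPow p (u x) * ψ x ∂(gaussMeasure ℝ) from rfl, ← h.weak_form hp hψ,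
    ← integral_neg]
  refine integral_congr_ae (Eventually.of_forall fun x => ?_)
  simp only [inner, RCLike.re_to_real, star_trivial, norm_neg, Real.norm_eq_abs, oddPow]
  ring

/-- The solution is an admissible test function for its own equation. -/
theorem energy (hp : 1 < p) : ∫ x in Iio t, |torsionSlope p α u x| ^ p ∂(gaussMeasure ℝ) =
    α * (∫ x in Iio t, |u x| ^ p ∂(gaussMeasure ℝ)) + ∫ x in Iio t, u x ∂(gaussMeasure ℝ) := by
  have := h.weak_form hp (h.memGaussSobolevZero hp)
  simp_rw [oddPow_mul_self hp] at this
  rw [← this, ← integral_neg]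
  refine integral_congr_ae (Eventually.of_forall fun x => ?_)
  simp only
  rw [← oddPow_mul_self hp]; ring

theorem torsionFunctional_eq (hp : 1 < p) :
    torsionFunctional p α (Iio t) u (fun x => -torsionSlope p α u x) =
      (p - 1) * ∫ x in Iio t, u x ∂(gaussMeasure ℝ) := by
  simp only [torsionFunctional, norm_neg, Real.norm_eq_abs]
  rw [h.energy hp]
  ring

end IsRegularSolution

end RegularSolution

/-! ### Positivity, Picone's identity and uniqueness -/

section Picone

variable {p α t : ℝ} {u : ℝ → ℝ}

theorem torsionFunctional_eq_of_subset {E : Type*} [NormedAddCommGroup E] [InnerProductSpace ℝ E]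
    [CompleteSpace E] [MeasureSpace E] {p α : ℝ} (hp : 1 < p) {Ω Ω' : Set E}
    (hΩ' : MeasurableSet Ω') (hs : Ω ⊆ Ω') {w : E → ℝ} (hw : IsTestFunction Ω w) :
    torsionFunctional p α Ω' w (gradient w) = torsionFunctional p α Ω w (gradient w) := by
  have hp0 : p ≠ 0 := by linarith
  have h0 : ∀ x ∉ Ω, w x = 0 := fun x hx => image_eq_zero_of_notMem_tsupport fun h' => hx (hw.2.2 h')
  have h1 : ∀ x ∉ Ω, gradient w x = 0 := fun x hx => by
    have : fderiv ℝ w x = 0 := image_eq_zero_of_notMem_tsupport fun h' =>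
      hx (hw.2.2 (tsupport_fderiv_subset ℝ h'))
    rw [gradient, this, map_zero]
  unfold torsionFunctional
  rw [setIntegral_eq_of_subset_of_forall_sdiff_eq_zero hΩ' hs fun x hx => by
      rw [h1 x hx.2, norm_zero, Real.zero_rpow hp0],
    setIntegral_eq_of_subset_of_forall_sdiff_eq_zero hΩ' hs fun x hx => by
      rw [h0 x hx.2, abs_zero, Real.zero_rpow hp0],
    setIntegral_eq_of_subset_of_forall_sdiff_eq_zero hΩ' hs fun x hx => h0 x hx.2]

namespace IsRegularSolution

/-- At an interior zero, which is a minimum, the slope and hence the flux vanish. The derivative of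
the flux there equals the density, whatever the sign of `α`, so the flux is positive just to the
right. Then `u` decreases strictly from zero and becomes negative. -/
theorem pos (hp : 1 < p) (h : IsRegularSolution p α t u) (h0 : ∀ x, 0 ≤ u x) {x : ℝ}
    (hx : x < t) : 0 < u x := by
  refine (h0 x).lt_of_ne fun hx0 => ?_
  have hmin : IsLocalMin u x := Eventually.of_forall fun y => hx0 ▸ h0 y
  have hs0 : torsionSlope p α u x = 0 :=
    neg_eq_zero.1 (hmin.hasDerivAt_eq_zero (h.hasDerivAt hp hx))
  have hf0 : torsionFlux p α u x = 0 := by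
    have := oddPow_torsionSlope (α := α) (u := u) hp x
    rw [hs0, oddPow_zero, eq_comm, div_eq_zero_iff] at this
    exact this.resolve_right (gaussDensity_pos x).ne'
  have hc : Continuous fun y => gaussDensity y * (α * oddPow p (u y) + 1) :=
    continuous_gaussDensity.mul
      (((continuous_oddPow hp).comp (h.continuous hp)).const_smul α |>.add continuous_const)
  have hpos : ∀ᶠ y in 𝓝 x, 0 < gaussDensity y * (α * oddPow p (u y) + 1) := by
    refine hc.continuousAt.eventually_const_lt ?_
    simp only [← hx0]
    rw [oddPow_zero, mul_zero, zero_add, mul_one]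
    exact gaussDensity_pos x
  obtain ⟨ε, hε, hball⟩ := Metric.eventually_nhds_iff.1 (hpos.and (Iio_mem_nhds hx))
  set b := x + ε / 2 with hb
  have hxb : x < b := by linarith
  have hI : ∀ y ∈ Icc x b, dist y x < ε := fun y hy => by
    rw [Real.dist_eq, abs_of_nonneg (by linarith [hy.1])]
    have := hy.2; linarith
  have hmono : StrictMonoOn (torsionFlux p α u) (Icc x b) := by
    refine strictMonoOn_of_deriv_pos (convex_Icc x b)
      (continuous_torsionFlux hp h.memLp).continuousOn fun y hy => ?_
    rw [(h.hasDerivAt_flux hp y).deriv]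
    exact (hball (hI y (interior_subset hy))).1
  have hanti : StrictAntiOn u (Icc x b) := by
    refine strictAntiOn_of_deriv_neg (convex_Icc x b) (h.continuous hp).continuousOn fun y hy => ?_
    rw [(h.hasDerivAt hp (hball (hI y (interior_subset hy))).2).deriv, neg_lt_zero]
    rw [interior_Icc] at hy
    apply oddPow_pos
    have := hmono (left_mem_Icc.2 hxb.le) (Ioo_subset_Icc_self hy) hy.1
    rw [hf0] at this
    exact div_pos this (gaussDensity_pos y)
  have := hanti (left_mem_Icc.2 hxb.le) (right_mem_Icc.2 hxb.le) hxb
  linarith [h0 b]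

/-- Picone's inequality against a positive solution. -/
theorem picone (hp : 1 < p) (h : IsRegularSolution p α t u) (h0 : ∀ x, 0 ≤ u x) {w : ℝ → ℝ}
    (hw : IsTestFunction (Iio t) w) :
    IntegrableOn (fun x => |w x| ^ p * u x ^ (1 - p)) (Iio t) (gaussMeasure ℝ) ∧
    torsionFunctional p α (Iio t) w (gradient w) ≤
      ∫ x in Iio t, (p * w x - |w x| ^ p * u x ^ (1 - p)) ∂(gaussMeasure ℝ) := by
  have hp0 : p ≠ 0 := by linarith
  -- Picone's test function: multiplied by `u^{p-1}` it gives back `|w|^p`, and paired with the flux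
  -- of `u` it costs at most `|w'|^p`. It is differentiable because `u` is positive on the compact
  -- support of `w`; `Ψ` is its derivative.
  set ψ : ℝ → ℝ := fun x => |w x| ^ p * u x ^ (1 - p) with hψ
  set Ψ : ℝ → ℝ := fun x => p * oddPow p (w x) * deriv w x * u x ^ (1 - p) -
    (p - 1) * |w x| ^ p * u x ^ (-p) * (-torsionSlope p α u x) with hΨ
  have hpos : ∀ x < t, 0 < u x := fun x hx => h.pos hp h0 hx
  set K := tsupport w
  have hK : IsCompact K := hw.2.1
  have hw0 : ∀ x ∉ K, w x = 0 := fun x hx => image_eq_zero_of_notMem_tsupport hx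
  have hψ0 : ∀ x ∉ K, ψ x = 0 := fun x hx => by simp [hψ, hw0 x hx, hp0]
  have hΨ0 : ∀ x ∉ K, Ψ x = 0 := fun x hx => by simp [hΨ, hw0 x hx, hp0]
  have hwd : Continuous (deriv w) := hw.1.continuous_deriv (by simp)
  have hsc : Continuous (torsionSlope p α u) := continuous_torsionSlope hp h.memLp
  have hcu : Continuous u := h.continuous hp
  have hrp : ∀ r : ℝ, ContinuousOn (fun x => u x ^ r) K := fun r x hx =>
    (hcu.continuousAt.rpow_const (Or.inl (hpos x (hw.2.2 hx)).ne')).continuousWithinAt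
  have hcabs : Continuous fun x => |w x| ^ p :=
    hw.continuous.abs.rpow_const fun x => Or.inr (by linarith)
  have hψc : ContinuousOn ψ K := hcabs.continuousOn.mul (hrp _)
  have hJw : Continuous fun x => oddPow p (w x) := (continuous_oddPow hp).comp hw.continuous
  have hΨc : ContinuousOn Ψ K := by
    refine ContinuousOn.sub (((continuous_const.mul hJw).mul hwd).continuousOn.mul (hrp _)) ?_
    exact (((continuous_const.mul hcabs).continuousOn).mul (hrp _)).mul hsc.neg.continuousOn
  have hint : ∀ {μ : Measure ℝ} [IsLocallyFiniteMeasure μ] {f : ℝ → ℝ}, ContinuousOn f K →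
      (∀ x ∉ K, f x = 0) → Integrable f μ := fun hf hf0 =>
    (hf.integrableOn_compact hK).integrable_of_forall_notMem_eq_zero hf0
  have hd : ∀ x, HasDerivAt ψ (Ψ x) x := fun x => by
    by_cases hx : x ∈ K
    · have hxt : x < t := hw.2.2 hx
      have d1 := (hasDerivAt_abs_rpow_oddPow hp (w x)).comp x (hw.differentiable x).hasDerivAt
      have d2 := (h.hasDerivAt hp hxt).rpow_const (p := 1 - p) (Or.inl (hpos x hxt).ne')
      refine (d1.mul d2).congr_deriv ?_
      simp only [hΨ, Function.comp]
      rw [show 1 - p - 1 = -p by ring]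
      ring
    · rw [hΨ0 x hx]
      refine (hasDerivAt_const x (0 : ℝ)).congr_of_eventuallyEq ?_
      filter_upwards [(isClosed_tsupport w).isOpen_compl.mem_nhds hx] with y hy
      exact hψ0 y hy
  have hΨi : Integrable Ψ := hint hΨc hΨ0
  have hψt : ψ t = 0 := hψ0 t fun h' => lt_irrefl t (hw.2.2 h')
  have hprim : ∀ x, ∫ y in x..t, Ψ y = -ψ x := fun x => by
    rw [intervalIntegral.integral_eq_sub_of_hasDerivAt (fun y _ => hd y) hΨi.intervalIntegrable,
      hψt, zero_sub]
  have hψi : Integrable ψ (gaussMeasure ℝ) := hint hψc hψ0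
  have hJc : Continuous fun x => oddPow p (torsionSlope p α u x) := (continuous_oddPow hp).comp hsc
  have hJΨi : Integrable (fun x => oddPow p (torsionSlope p α u x) * Ψ x) (gaussMeasure ℝ) :=
    hint (hJc.continuousOn.mul hΨc) fun x hx => by rw [hΨ0 x hx, mul_zero]
  have hwi : Integrable w (gaussMeasure ℝ) := hw.continuous.integrable_of_hasCompactSupport hw.2.1
  have hwpi : Integrable (fun x => |w x| ^ p) (gaussMeasure ℝ) :=
    hint hcabs.continuousOn fun x hx => by rw [hw0 x hx, abs_zero, Real.zero_rpow hp0]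
  have hgi : Integrable (fun x => ‖gradient w x‖ ^ p) (gaussMeasure ℝ) := by
    refine hint (hw.continuous_gradient.norm.rpow_const fun x => Or.inr (by linarith)).continuousOn
      fun x hx => ?_
    rw [gradient_real, image_eq_zero_of_notMem_tsupport (fun h' => hx (tsupport_deriv_subset h')),
      norm_zero, Real.zero_rpow hp0]
  -- The Fubini identity needs only integrability of `Ψ`, so membership of `ψ` in the Sobolev space
  -- never has to be checked.
  have key := (integral_source_mul_primitive (α := α) hp h.memLp hΨi.integrableOn (t := t)).2
  simp_rw [hprim] at key
  have e1 : ∫ x in Iio t, (α * oddPow p (u x) + 1) * -ψ x ∂(gaussMeasure ℝ) =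
      -(α * (∫ x in Iio t, |w x| ^ p ∂(gaussMeasure ℝ)) + ∫ x in Iio t, ψ x ∂(gaussMeasure ℝ)) := by
    rw [← integral_const_mul, ← integral_add (hwpi.integrableOn.const_mul α) hψi.integrableOn,
      ← integral_neg]
    refine setIntegral_congr_fun measurableSet_Iio fun x hx => ?_
    have hux := hpos x hx
    have : oddPow p (u x) * ψ x = |w x| ^ p := by
      rw [oddPow_of_pos hux, hψ, mul_left_comm, ← Real.rpow_add hux]
      simp
    linear_combination (-α) * this
  have e2 : -∫ x in Iio t, oddPow p (torsionSlope p α u x) * Ψ x ∂(gaussMeasure ℝ) ≤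
      ∫ x in Iio t, ‖gradient w x‖ ^ p ∂(gaussMeasure ℝ) := by
    rw [← integral_neg]
    refine setIntegral_mono_on hJΨi.integrableOn.neg hgi.integrableOn measurableSet_Iio
      fun x hx => ?_
    have := picone_pointwise hp (hpos x hx) (-torsionSlope p α u x) (w x) (deriv w x)
    rw [oddPow_neg] at this
    rw [gradient_real, Real.norm_eq_abs]
    simp only [hΨ]
    linarith
  refine ⟨hψi.integrableOn, ?_⟩
  rw [← key, e1, neg_neg] at e2
  rw [integral_sub (hwi.integrableOn.const_mul p) hψi.integrableOn, integral_const_mul,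
    torsionFunctional]
  linarith

theorem deficit_le (hp : 1 < p) (h : IsRegularSolution p α t u) (h0 : ∀ x, 0 ≤ u x) {x : ℝ}
    (hx : x < t) (a : ℝ) : p * a - |a| ^ p * u x ^ (1 - p) ≤ (p - 1) * u x := by
  have h1 := deficit_nonneg hp (h.pos hp h0 hx) (abs_nonneg a)
  have h2 : p * a ≤ p * |a| := mul_le_mul_of_nonneg_left (le_abs_self a) (by linarith)
  linarith

theorem integrable (hp : 1 < p) (h : IsRegularSolution p α t u) : Integrable u (gaussMeasure ℝ) :=
  h.memLp.integrable (by simpa using hp.le)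

/-- After Picone the gradient is gone, and the remaining integrand can be maximised pointwise in the
value of `w`. -/
theorem torsionFunctional_le (hp : 1 < p) (h : IsRegularSolution p α t u) (h0 : ∀ x, 0 ≤ u x)
    {s : ℝ} (hst : s ≤ t) {w : ℝ → ℝ} (hw : IsTestFunction (Iio s) w) :
    torsionFunctional p α (Iio s) w (gradient w) ≤
      (p - 1) * ∫ x in Iio s, u x ∂(gaussMeasure ℝ) := by
  have hsub : Iio s ⊆ Iio t := Iio_subset_Iio hst
  obtain ⟨h1, h2⟩ := h.picone hp h0 (hw.mono hsub)
  rw [torsionFunctional_eq_of_subset hp measurableSet_Iio hsub hw] at h2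
  refine h2.trans ?_
  have hp0 : p ≠ 0 := by linarith
  have hw0 : ∀ x ∉ Iio s, w x = 0 :=
    fun x hx => image_eq_zero_of_notMem_tsupport fun h' => hx (hw.2.2 h')
  rw [setIntegral_eq_of_subset_of_forall_sdiff_eq_zero measurableSet_Iio hsub fun x hx => by
    rw [hw0 x hx.2, abs_zero, Real.zero_rpow hp0]; ring, ← integral_const_mul]
  have hwi : Integrable w (gaussMeasure ℝ) := hw.continuous.integrable_of_hasCompactSupport hw.2.1
  exact setIntegral_mono_on ((hwi.integrableOn.const_mul p).sub (h1.mono_set hsub))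
    ((h.integrable hp).integrableOn.const_mul _) measurableSet_Iio
    fun x hx => h.deficit_le hp h0 (hsub hx) (w x)

theorem genTorsionalRigidity_eq (hp : 1 < p) (h : IsRegularSolution p α t u) (h0 : ∀ x, 0 ≤ u x) :
    genTorsionalRigidity p α (Iio t) =
      (((p - 1) * ∫ x in Iio t, u x ∂(gaussMeasure ℝ) : ℝ) : EReal) := by
  refine le_antisymm (genTorsionalRigidity_le hp fun w hw => h.torsionFunctional_le hp h0 le_rfl hw) ?_
  rw [← h.torsionFunctional_eq hp]
  exact le_genTorsionalRigidity (h.memGaussSobolevZero hp)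

/-- Both solutions attain the same supremum. Along test functions converging to `v`, the Picone
deficits relative to `u` are nonnegative with integrals tending to zero. Fatou's lemma makes the
deficit of `v` vanish almost everywhere, and the equality case forces `v = u`. -/
theorem unique (hp : 1 < p) (h : IsRegularSolution p α t u) (h0 : ∀ x, 0 ≤ u x) {v : ℝ → ℝ}
    (hv : IsRegularSolution p α t v) (hv0 : ∀ x, 0 ≤ v x) : v = u := by
  have hQ : (p - 1) * ∫ x in Iio t, u x ∂(gaussMeasure ℝ) =
      (p - 1) * ∫ x in Iio t, v x ∂(gaussMeasure ℝ) := by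
    have := (h.genTorsionalRigidity_eq hp h0).symm.trans (hv.genTorsionalRigidity_eq hp hv0)
    exact_mod_cast this
  obtain ⟨w, hw, hLp, -, -, hF⟩ := (hv.memGaussSobolevZero hp).exists_seq_tendsto hp
  set μ := (gaussMeasure ℝ).restrict (Iio t) with hμ
  have hF' := hF α
  rw [hv.torsionFunctional_eq hp, ← hQ] at hF'
  have hcu := h.continuous hp
  have hcv := hv.continuous hp
  obtain ⟨ns, hns, hae⟩ := (tendstoInMeasure_of_tendsto_eLpNorm (f := w) (g := v) (μ := μ)
    (p := ENNReal.ofReal p) (by simp; linarith)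
    (fun n => (hw n).continuous.aestronglyMeasurable) hcv.aestronglyMeasurable
    (hLp.congr fun n => by rw [eLpNorm_sub_comm]; rfl)).exists_seq_tendsto_ae
  set d : ℕ → ℝ → ℝ := fun n x =>
    (p - 1) * u x - (p * w (ns n) x - |w (ns n) x| ^ p * u x ^ (1 - p)) with hd
  have hui : Integrable (fun x => (p - 1) * u x) μ := (h.integrable hp).integrableOn.const_mul _
  have hdi2 : ∀ n, Integrable (fun x => p * w (ns n) x - |w (ns n) x| ^ p * u x ^ (1 - p)) μ :=
    fun n => (((hw (ns n)).continuous.integrable_of_hasCompactSupport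
      (hw (ns n)).2.1).integrableOn.const_mul p).sub (h.picone hp h0 (hw (ns n))).1
  have hdi : ∀ n, Integrable (d n) μ := fun n => hui.sub (hdi2 n)
  have hdnn : ∀ n, 0 ≤ᵐ[μ] d n := fun n => by
    filter_upwards [ae_restrict_mem measurableSet_Iio] with x hx
    have := h.deficit_le hp h0 hx (w (ns n) x)
    simp only [hd, Pi.zero_apply]
    linarith
  have hd0 : Tendsto (fun n => ∫⁻ x, ENNReal.ofReal (d n x) ∂μ) atTop (𝓝 0) := by
    -- Picone bounds the integral of each deficit by the gap between the supremum and the functional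
    -- at `w (ns n)`.
    have h1 : Tendsto (fun n => ENNReal.ofReal ((p - 1) * (∫ x in Iio t, u x ∂(gaussMeasure ℝ)) -
        torsionFunctional p α (Iio t) (w (ns n)) (gradient (w (ns n))))) atTop (𝓝 0) := by
      have := (ENNReal.continuous_ofReal.tendsto _).comp
        ((hF'.comp hns.tendsto_atTop).const_sub ((p - 1) * ∫ x in Iio t, u x ∂(gaussMeasure ℝ)))
      rw [sub_self, ENNReal.ofReal_zero] at this
      exact this
    refine tendsto_of_tendsto_of_tendsto_of_le_of_le tendsto_const_nhds h1 (fun n => zero_le)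
      fun n => ?_
    simp only
    rw [← ofReal_integral_eq_lintegral_ofReal (hdi n) (hdnn n)]
    refine ENNReal.ofReal_le_ofReal ?_
    have e : ∫ x, d n x ∂μ = (∫ x, (p - 1) * u x ∂μ) -
      ∫ x, (p * w (ns n) x - |w (ns n) x| ^ p * u x ^ (1 - p)) ∂μ := integral_sub hui (hdi2 n)
    rw [e, integral_const_mul]
    linarith [(h.picone hp h0 (hw (ns n))).2]
  have hdm : ∀ n, Measurable fun x => ENNReal.ofReal (d n x) := fun n =>
    ((hcu.measurable.const_mul _).sub ((((hw (ns n)).continuous.measurable).const_mul p).sub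
      (((hw (ns n)).continuous.abs.measurable.pow_const p).mul
        (hcu.measurable.pow_const (1 - p))))).ennreal_ofReal
  have hfatou := lintegral_liminf_le (μ := μ) (u := atTop) hdm
  rw [hd0.liminf_eq, nonpos_iff_eq_zero, lintegral_eq_zero_iff (Measurable.liminf hdm)] at hfatou
  have hvu : v =ᵐ[volume.restrict (Iio t)] u := by
    refine ae_restrict_gaussMeasure_iff.1 ?_
    filter_upwards [hfatou, hae, ae_restrict_mem measurableSet_Iio] with x h1 h2 hx
    have h3 : Tendsto (fun n => d n x) atTop
        (𝓝 ((p - 1) * u x - (p * v x - |v x| ^ p * u x ^ (1 - p)))) :=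
      tendsto_const_nhds.sub ((h2.const_mul p).sub
        ((h2.abs.rpow_const (Or.inr (by linarith))).mul_const _))
    have h4 := ((ENNReal.continuous_ofReal.tendsto _).comp h3).liminf_eq
    simp only [Function.comp_def] at h4
    rw [h4] at h1
    have h5 := ENNReal.ofReal_eq_zero.1 h1
    rw [abs_of_nonneg (hv0 x)] at h5
    exact eq_of_deficit_eq hp (h.pos hp h0 hx) (hv0 x) (by linarith)
  have := Measure.eqOn_open_of_ae_eq hvu isOpen_Iio hcv.continuousOn hcu.continuousOn
  ext x
  rcases lt_or_ge x t with hx | hx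
  · exact this hx
  · rw [h.eq_zero x hx, hv.eq_zero x hx]

theorem lt_integral (hp : 1 < p) (h : IsRegularSolution p α t u) (h0 : ∀ x, 0 ≤ u x) {s : ℝ}
    (hst : s < t) : ∫ x in Iio s, u x ∂(gaussMeasure ℝ) < ∫ x in Iio t, u x ∂(gaussMeasure ℝ) := by
  have hi := h.integrable hp
  rw [← Iio_union_Ico_eq_Iio hst.le, setIntegral_union
    (by rw [Set.disjoint_left]; exact fun x hx h' => absurd h'.1 (not_le.2 hx))
    measurableSet_Ico hi.integrableOn hi.integrableOn, lt_add_iff_pos_right,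
    setIntegral_pos_iff_support_of_nonneg_ae (Eventually.of_forall h0) hi.integrableOn]
  have : Ioo s t ⊆ Function.support u ∩ Ico s t := fun x hx =>
    ⟨(h.pos hp h0 hx.2).ne', hx.1.le, hx.2⟩
  refine lt_of_lt_of_le ?_ (measure_mono this)
  rw [pos_iff_ne_zero]
  intro h'
  have := absolutelyContinuous_gaussMeasure h'
  rw [Real.volume_Ioo, ENNReal.ofReal_eq_zero] at this
  linarith

end IsRegularSolution

end Picone

/-! ### Regularity and sign of weak solutions -/

section Regularity

variable {p α t : ℝ}

theorem memLp_of_abs_le_const {μ : Measure ℝ} [IsFiniteMeasure μ] {q : ENNReal} {f : ℝ → ℝ}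
    (hf : AEStronglyMeasurable f μ) {C : ℝ} (h : ∀ᵐ x ∂μ, |f x| ≤ C) : MemLp f q μ :=
  MemLp.of_bound hf C (by simpa using h)

theorem integral_congr_of_ae_Iio {f g : ℝ → ℝ} (h : ∀ᵐ x ∂(volume.restrict (Iio t)), f x = g x)
    {x : ℝ} (hx : x ≤ t) : ∫ y in x..t, f y = ∫ y in x..t, g y := by
  rw [intervalIntegral.integral_of_le hx, intervalIntegral.integral_of_le hx,
    integral_Ioc_eq_integral_Ioo, integral_Ioc_eq_integral_Ioo]
  exact integral_congr_ae (ae_restrict_of_ae_restrict_of_subset Ioo_subset_Iio_self h)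

/-- A du Bois-Reymond argument. The test functions are primitives of indicators of sets `s` in
bounded intervals, so the weak equation says that `|G|^{p-2} G` and minus the normalised flux have
equal integrals over every such `s`, hence agree almost everywhere. -/
theorem IsGenTorsionFunction.exists_regular (hp : 1 < p) {v : ℝ → ℝ}
    (h : IsGenTorsionFunction p α (Iio t) v) :
    ∃ u, IsRegularSolution p α t u ∧ v =ᵐ[volume.restrict (Iio t)] u := by
  obtain ⟨G, hG, hweak⟩ := h
  set v0 : ℝ → ℝ := (Iio t).indicator v with hv0
  have hv0v : ∀ x < t, v0 x = v x := fun x hx => indicator_of_mem (mem_Iio.2 hx) v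
  have hv0m : MemLp v0 (ENNReal.ofReal p) (gaussMeasure ℝ) :=
    (memLp_indicator_iff_restrict measurableSet_Iio).2 hG.1.2.1
  have hsc : Continuous (torsionSlope p α v0) := continuous_torsionSlope hp hv0m
  set μ := (gaussMeasure ℝ).restrict (Iio t) with hμ
  have hJG : MemLp (fun x => oddPow p (G x)) (ENNReal.ofReal (p / (p - 1))) μ := hG.1.2.2.oddPow hp
  have hJGi : Integrable (fun x => oddPow p (G x)) μ :=
    hJG.integrable (by simpa using (one_lt_conj hp).le)
  have hJsc : Continuous fun x => oddPow p (torsionSlope p α v0 x) :=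
    (continuous_oddPow hp).comp hsc
  -- testing with primitives of indicators
  have htest : ∀ (n : ℕ) (s : Set ℝ), MeasurableSet s → s ⊆ Ioo (-(n : ℝ)) t →
      ∫ x in s, (oddPow p (G x) + oddPow p (torsionSlope p α v0 x)) ∂(gaussMeasure ℝ) = 0 := by
    intro n s hs hsn
    have hst : s ⊆ Iio t := fun x hx => (hsn hx).2
    set Ψ : ℝ → ℝ := s.indicator fun _ => (1 : ℝ) with hΨ
    have hvol : volume s ≠ ⊤ := ((measure_mono hsn).trans_lt (by simp)).ne
    have hΨi : Integrable Ψ := (integrable_indicator_iff hs).2 (integrableOn_const hvol)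
    set ψ : ℝ → ℝ := fun x => -∫ y in x..t, Ψ y with hψ
    have hψc : Continuous ψ := by
      have := intervalIntegral.continuous_primitive (fun a b => hΨi.intervalIntegrable (a := a) (b := b)) t
      refine this.congr fun x => ?_
      rw [hψ, intervalIntegral.integral_symm]
    have hψb : ∀ x, |ψ x| ≤ ∫ y, ‖Ψ y‖ := fun x => by
      rw [hψ, abs_neg, ← Real.norm_eq_abs]
      refine intervalIntegral.norm_integral_le_integral_norm_uIoc.trans ?_
      exact setIntegral_le_integral hΨi.norm (Eventually.of_forall fun y => norm_nonneg _)
    have hmem : MemGaussSobolevZero p (Iio t) ψ Ψ := by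
      refine memGaussSobolevZero_of_ae_eq hp
        (memLp_of_abs_le_const hψc.aestronglyMeasurable (Eventually.of_forall hψb))
        (memLp_of_abs_le_const (measurable_const.indicator hs).aestronglyMeasurable (C := 1)
          (Eventually.of_forall fun x => ?_)) (Eventually.of_forall fun x => rfl)
      by_cases hx : x ∈ s
      · rw [hΨ, indicator_of_mem hx, abs_one]
      · rw [hΨ, indicator_of_notMem hx, abs_zero]; exact zero_le_one
    have h1 := hweak ψ Ψ hmem
    have h2 := (integral_source_mul_primitive (α := α) hp hv0m hΨi.integrableOn (t := t)).2
    have e1 : ∫ x in Iio t, ‖G x‖ ^ (p - 2) * inner ℝ (G x) (Ψ x) ∂(gaussMeasure ℝ) =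
        ∫ x in Iio t, oddPow p (G x) * Ψ x ∂(gaussMeasure ℝ) := by
      refine integral_congr_ae (Eventually.of_forall fun x => ?_)
      simp only [inner, RCLike.re_to_real, star_trivial, Real.norm_eq_abs, oddPow]
      ring
    have e2 : ∫ x in Iio t, (α * oddPow p (v0 x) + 1) * (∫ y in x..t, Ψ y) ∂(gaussMeasure ℝ) =
        -(α * (∫ x in Iio t, |v x| ^ (p - 2) * v x * ψ x ∂(gaussMeasure ℝ))
          + ∫ x in Iio t, ψ x ∂(gaussMeasure ℝ)) := by
      rw [← integral_const_mul, ← integral_add, ← integral_neg]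
      · refine setIntegral_congr_fun measurableSet_Iio fun x hx => ?_
        simp only [hv0v x hx, hψ, oddPow]
        ring
      · exact ((hG.1.2.1.oddPow hp).integrable_mul_conj hp hmem.1.2.1).const_mul α
      · exact hmem.1.2.1.integrable (by simpa using hp.le)
    have key : ∀ f : ℝ → ℝ, ∫ x in Iio t, f x * Ψ x ∂(gaussMeasure ℝ) =
        ∫ x in s, f x ∂(gaussMeasure ℝ) := fun f => by
      have : (fun x => f x * Ψ x) = s.indicator f := by
        ext x
        by_cases hx : x ∈ s <;> simp [hΨ, hx]
      rw [this, setIntegral_indicator hs, inter_eq_right.2 hst]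
    rw [integral_add, ← key, ← key, ← e1, h1, ← h2, e2]
    · ring
    · exact IntegrableOn.mono_set hJGi hst
    · exact ((hJsc.locallyIntegrable (μ := gaussMeasure ℝ)).integrableOn_isCompact
        (isCompact_Icc (a := -(n : ℝ)) (b := t))).mono_set (hsn.trans Ioo_subset_Icc_self)
  have hae : ∀ᵐ x ∂(volume.restrict (Iio t)), G x = -torsionSlope p α v0 x := by
    have hU : Iio t = ⋃ n : ℕ, Ioo (-(n : ℝ)) t := by
      ext x
      simp only [mem_Iio, mem_iUnion, mem_Ioo, exists_and_right, iff_and_self]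
      intro _
      obtain ⟨n, hn⟩ := exists_nat_gt (-x)
      exact ⟨n, by linarith⟩
    rw [← ae_restrict_gaussMeasure_iff]
    have : ∀ n : ℕ, ∀ᵐ x ∂((gaussMeasure ℝ).restrict (Ioo (-(n : ℝ)) t)),
        G x = -torsionSlope p α v0 x := fun n => by
      have hi : Integrable (fun x => oddPow p (G x) + oddPow p (torsionSlope p α v0 x))
          ((gaussMeasure ℝ).restrict (Ioo (-(n : ℝ)) t)) := by
        refine Integrable.add
          (IntegrableOn.mono_set hJGi Ioo_subset_Iio_self) ?_
        exact ((hJsc.locallyIntegrable (μ := gaussMeasure ℝ)).integrableOn_isCompact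
          (isCompact_Icc (a := -(n : ℝ)) (b := t))).mono_set Ioo_subset_Icc_self
      have := hi.ae_eq_zero_of_forall_setIntegral_eq_zero fun s hs _ => by
        rw [Measure.restrict_restrict hs]
        exact htest n _ (hs.inter measurableSet_Ioo) inter_subset_right
      filter_upwards [this] with x hx
      apply (strictMono_oddPow hp).injective
      rw [oddPow_neg]
      simp only [Pi.zero_apply] at hx
      linarith
    rw [hU]
    exact (ae_restrict_iUnion_iff _ _).2 this
  -- The primitive of the slope of `v0` differs from `v0` on a null set only. The flux does not see
  -- this, so `u` solves the integrated equation with its own slope.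
  set u : ℝ → ℝ := fun x => if x < t then ∫ y in x..t, torsionSlope p α v0 y else 0 with hu
  have hvu : v =ᵐ[volume.restrict (Iio t)] u := by
    filter_upwards [hG.ae_eq_neg_integral hp, ae_restrict_mem measurableSet_Iio] with x hx hxt
    have hxt' : x < t := hxt
    rw [hx, integral_congr_of_ae_Iio hae hxt'.le, intervalIntegral.integral_neg, neg_neg]
    simp only [hu, if_pos hxt']
  have hv0u : v0 =ᵐ[gaussMeasure ℝ] u := by
    refine gaussMeasure_absolutelyContinuous.ae_le ?_
    filter_upwards [(ae_restrict_iff' measurableSet_Iio).1 hvu] with x hx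
    rcases lt_or_ge x t with hxt | hxt
    · rw [hv0v x hxt]; exact hx hxt
    · simp [hv0, hu, not_lt.2 hxt]
  have hflux : torsionFlux p α u = torsionFlux p α v0 := by
    ext y
    refine integral_congr_ae (ae_restrict_of_ae (hv0u.mono fun x hx => ?_))
    simp only [hx]
  have hslope : torsionSlope p α u = torsionSlope p α v0 := by
    ext y; rw [torsionSlope, torsionSlope, hflux]
  refine ⟨u, ⟨fun x hx => by simp [hu, not_lt.2 hx], hv0m.ae_eq hv0u, fun x hx => ?_, ?_⟩, hvu⟩
  · rw [hslope]
    rcases hx.lt_or_eq with h' | rfl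
    · simp only [hu, if_pos h']
    · simp [hu]
  · rw [hslope]
    refine (memLp_congr_ae ?_).1 hG.1.2.2.neg
    refine (ae_restrict_gaussMeasure_iff.2 hae).mono fun x hx => ?_
    simp [hx]

/-- The negative part has a right derivative everywhere, even at zeros of `f`. The fundamental
theorem of calculus for right derivatives then applies with no discussion of the zero set. -/
theorem hasDerivWithinAt_min_zero {f : ℝ → ℝ} {f' x : ℝ} (hf : HasDerivAt f f' x) :
    HasDerivWithinAt (fun y => min (f y) 0)
      (if f x < 0 then f' else if f x = 0 then min f' 0 else 0) (Ioi x) x := by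
  rcases lt_trichotomy (f x) 0 with h | h | h
  · rw [if_pos h]
    refine (hf.congr_of_eventuallyEq ?_).hasDerivWithinAt
    filter_upwards [hf.continuousAt.eventually_lt_const h] with y hy
    exact min_eq_left hy.le
  · rw [if_neg h.not_lt, if_pos h, hasDerivWithinAt_iff_tendsto_slope' (by simp)]
    have h1 := (hasDerivWithinAt_iff_tendsto_slope' (by simp)).1 (hf.hasDerivWithinAt (s := Ioi x))
    refine (h1.min (tendsto_const_nhds (x := (0 : ℝ)))).congr' ?_
    filter_upwards [self_mem_nhdsWithin] with y hy
    have hy' : 0 < y - x := sub_pos.2 hy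
    rw [slope_def_field, slope_def_field, h, min_self, sub_zero, sub_zero, ← min_div_div_right hy'.le,
      zero_div]
  · rw [if_neg h.not_gt, if_neg h.ne']
    refine ((hasDerivAt_const x (0 : ℝ)).congr_of_eventuallyEq ?_).hasDerivWithinAt
    filter_upwards [hf.continuousAt.eventually_const_lt h] with y hy
    exact min_eq_right hy.le

/-- Testing the equation with `w = min u 0` gives `∫ |w'|^p = α ∫ |w|^p + ∫ w ≤ α ∫ |w|^p`. As `α <
lam`, the Rayleigh bound leaves only `w = 0`. -/
theorem IsRegularSolution.nonneg_of_rayleigh (hp : 1 < p) {u : ℝ → ℝ}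
    (h : IsRegularSolution p α t u) {lam : ℝ} (hlam : α < lam)
    (hray : ∀ w : ℝ → ℝ, IsTestFunction (Iio t) w →
      lam * ∫ x in Iio t, |w x| ^ p ∂(gaussMeasure ℝ) ≤
      ∫ x in Iio t, ‖gradient w x‖ ^ p ∂(gaussMeasure ℝ)) (x : ℝ) : 0 ≤ u x := by
  have hp0 : p ≠ 0 := by linarith
  set w : ℝ → ℝ := fun x => min (u x) 0 with hw
  set Ψ : ℝ → ℝ := fun x => if u x < 0 then -torsionSlope p α u x else
    if u x = 0 then min (-torsionSlope p α u x) 0 else 0 with hΨ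
  have hcu := h.continuous hp
  have hsc : Continuous (torsionSlope p α u) := continuous_torsionSlope hp h.memLp
  have hwc : Continuous w := hcu.min continuous_const
  have hΨm : Measurable Ψ := by
    refine Measurable.ite (measurableSet_lt hcu.measurable measurable_const) hsc.neg.measurable ?_
    exact Measurable.ite (measurableSet_eq_fun hcu.measurable measurable_const)
      (hsc.neg.min continuous_const).measurable measurable_const
  have hwle : ∀ x, ‖w x‖ ≤ ‖u x‖ := fun x => by
    simp only [hw]
    rcases le_total (u x) 0 with h' | h'
    · rw [min_eq_left h']
    · rw [min_eq_right h', norm_zero]; exact norm_nonneg _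
  have hΨle : ∀ x, ‖Ψ x‖ ≤ ‖torsionSlope p α u x‖ := fun x => by
    simp only [hΨ]
    split_ifs
    · rw [norm_neg]
    · rcases le_total (-torsionSlope p α u x) 0 with h' | h'
      · rw [min_eq_left h', norm_neg]
      · rw [min_eq_right h', norm_zero]; exact norm_nonneg _
    · rw [norm_zero]; exact norm_nonneg _
  have hwL : MemLp w (ENNReal.ofReal p) ((gaussMeasure ℝ).restrict (Iio t)) :=
    (h.memLp.restrict _).mono hwc.aestronglyMeasurable (Eventually.of_forall hwle)
  have hΨL : MemLp Ψ (ENNReal.ofReal p) ((gaussMeasure ℝ).restrict (Iio t)) :=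
    h.memLp_slope.mono hΨm.aestronglyMeasurable (Eventually.of_forall hΨle)
  have hmem : MemGaussSobolevZero p (Iio t) w Ψ := by
    refine memGaussSobolevZero_of_ae_eq hp hwL hΨL ?_
    filter_upwards [ae_restrict_mem measurableSet_Iio] with x hx
    rw [intervalIntegral.integral_eq_sub_of_hasDeriv_right_of_le (le_of_lt hx) hwc.continuousOn
      (fun y hy => hasDerivWithinAt_min_zero (h.hasDerivAt hp hy.2))
      (hΨL.intervalIntegrable_of_gauss hp (le_of_lt hx) le_rfl)]
    simp [hw, h.eq_zero t le_rfl]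
  have h1 := h.weak_form hp hmem
  have h2 := hmem.rayleigh hp hray
  have e1 : -∫ x in Iio t, oddPow p (torsionSlope p α u x) * Ψ x ∂(gaussMeasure ℝ) =
      ∫ x in Iio t, ‖Ψ x‖ ^ p ∂(gaussMeasure ℝ) := by
    rw [← integral_neg]
    refine integral_congr_ae (Eventually.of_forall fun x => ?_)
    simp only [← neg_mul, ← oddPow_neg, hΨ, Real.norm_eq_abs]
    split_ifs with c1 c2
    · exact oddPow_mul_self hp _
    · rcases le_total (-torsionSlope p α u x) 0 with h' | h'
      · rw [min_eq_left h']; exact oddPow_mul_self hp _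
      · rw [min_eq_right h', mul_zero, abs_zero, Real.zero_rpow hp0]
    · rw [mul_zero, abs_zero, Real.zero_rpow hp0]
  have e2 : ∫ x in Iio t, oddPow p (u x) * w x ∂(gaussMeasure ℝ) =
      ∫ x in Iio t, |w x| ^ p ∂(gaussMeasure ℝ) := by
    refine integral_congr_ae (Eventually.of_forall fun x => ?_)
    simp only [hw]
    rcases le_total (u x) 0 with h' | h'
    · rw [min_eq_left h']; exact oddPow_mul_self hp _
    · rw [min_eq_right h', mul_zero, abs_zero, Real.zero_rpow hp0]
  rw [e1, e2] at h1
  have h3 : ∫ x in Iio t, w x ∂(gaussMeasure ℝ) ≤ 0 := integral_nonpos fun x => min_le_right _ _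
  have h4 : 0 ≤ ∫ x in Iio t, |w x| ^ p ∂(gaussMeasure ℝ) :=
    integral_nonneg fun x => by positivity
  have h5 : ∫ x in Iio t, |w x| ^ p ∂(gaussMeasure ℝ) = 0 := by
    nlinarith [mul_nonneg (sub_pos.2 hlam).le h4]
  rw [integral_eq_zero_iff_of_nonneg (fun x => by positivity)
    (by simpa using hwL.integrable_norm_rpow_ofReal hp)] at h5
  have h6 : w =ᵐ[volume.restrict (Iio t)] fun _ => 0 := by
    refine ae_restrict_gaussMeasure_iff.1 (h5.mono fun x hx => ?_)
    have := (Real.rpow_eq_zero (abs_nonneg (w x)) hp0).1 hx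
    exact abs_eq_zero.1 this
  have h7 := Measure.eqOn_open_of_ae_eq h6 isOpen_Iio hwc.continuousOn continuousOn_const
  rcases lt_or_ge x t with hx | hx
  · have : w x = 0 := h7 hx
    simp only [hw] at this
    exact min_eq_right_iff.1 this
  · rw [h.eq_zero x hx]

end Regularity

/-! ### Monotone iteration for nonnegative `α` -/

/-- The slope generated by a source `g`, with values in `[0, ∞]`. -/
noncomputable def eSlope (p : ℝ) (g : ℝ → ENNReal) (y : ℝ) : ENNReal :=
  ((ENNReal.ofReal (gaussDensity y))⁻¹ * ∫⁻ x in Iio y, g x ∂(gaussMeasure ℝ)) ^ (1 / (p - 1))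

/-- The solution of the equation with source `g` and zero boundary value at `t`. -/
noncomputable def eSolve (p t : ℝ) (g : ℝ → ENNReal) (x : ℝ) : ENNReal :=
  ∫⁻ y in Ioo x t, eSlope p g y

/-- The source `α v^{p-1} + 1`. -/
noncomputable def eSource (p α : ℝ) (v : ℝ → ENNReal) (x : ℝ) : ENNReal :=
  ENNReal.ofReal α * v x ^ (p - 1) + 1

/-- The iterates `v_{k+1} = eSolve (α v_k^{p-1} + 1)` started at zero. -/
noncomputable def torsionIter (p α t : ℝ) : ℕ → ℝ → ENNReal
  | 0 => fun _ => 0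
  | k + 1 => eSolve p t (eSource p α (torsionIter p α t k))

section Iteration

variable {p α t : ℝ}

theorem measurable_eSlope (p : ℝ) (g : ℝ → ENNReal) : Measurable (eSlope p g) := by
  have : Monotone fun y => ∫⁻ x in Iio y, g x ∂(gaussMeasure ℝ) :=
    fun a b hab => lintegral_mono_set (Iio_subset_Iio hab)
  exact ((continuous_gaussDensity.measurable.ennreal_ofReal.inv).mul this.measurable).pow_const _

theorem antitone_eSolve (p t : ℝ) (g : ℝ → ENNReal) : Antitone (eSolve p t g) :=
  fun _ _ hab => lintegral_mono_set (Ioo_subset_Ioo_left hab)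

theorem measurable_eSolve (p t : ℝ) (g : ℝ → ENNReal) : Measurable (eSolve p t g) :=
  (antitone_eSolve p t g).measurable

theorem eSolve_eq_zero (p : ℝ) (g : ℝ → ENNReal) {x : ℝ} (hx : t ≤ x) : eSolve p t g x = 0 := by
  simp [eSolve, Ioo_eq_empty (not_lt.2 hx)]

theorem eSlope_mono (hp : 1 < p) {g g' : ℝ → ENNReal} {y : ℝ} (h : ∀ x < y, g x ≤ g' x) :
    eSlope p g y ≤ eSlope p g' y := by
  unfold eSlope
  refine ENNReal.rpow_le_rpow ?_ (by have := sub_pos.2 hp; positivity)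
  gcongr 1
  exact setLIntegral_mono' measurableSet_Iio fun x hx => h x hx

theorem eSolve_mono (hp : 1 < p) {s : ℝ} (hst : s ≤ t) {g g' : ℝ → ENNReal}
    (h : ∀ x < s, g x ≤ g' x) (x : ℝ) : eSolve p s g x ≤ eSolve p t g' x := by
  unfold eSolve
  refine (setLIntegral_mono' measurableSet_Ioo fun y hy => ?_).trans
    (lintegral_mono_set (Ioo_subset_Ioo_right hst))
  exact eSlope_mono hp fun x hx => h x (hx.trans hy.2)

theorem eSource_mono (hp : 1 < p) {v w : ℝ → ENNReal} {x : ℝ} (h : v x ≤ w x) :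
    eSource p α v x ≤ eSource p α w x := by
  unfold eSource
  gcongr

theorem measurable_eSource {v : ℝ → ENNReal} (hv : Measurable v) : Measurable (eSource p α v) :=
  ((hv.pow_const _).const_mul _).add_const _

theorem measurable_torsionIter (p α t : ℝ) (k : ℕ) : Measurable (torsionIter p α t k) := by
  cases k with
  | zero => exact measurable_const
  | succ k => exact measurable_eSolve _ _ _

theorem torsionIter_le_succ (hp : 1 < p) (k : ℕ) (x : ℝ) :
    torsionIter p α t k x ≤ torsionIter p α t (k + 1) x := by
  induction k generalizing x with
  | zero => exact zero_le
  | succ k ih => exact eSolve_mono hp le_rfl (fun y _ => eSource_mono hp (ih y)) x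

theorem monotone_torsionIter (hp : 1 < p) (x : ℝ) : Monotone fun k => torsionIter p α t k x :=
  monotone_nat_of_le_succ fun k => torsionIter_le_succ hp k x

/-- The solution operator is monotone in both source and end point, so iterates started at zero
never cross a supersolution. Allowing `s < t` is what produces comparison between different
half-lines. -/
theorem torsionIter_le_of_supersolution (hp : 1 < p) {s : ℝ} (hst : s ≤ t) {w : ℝ → ENNReal}
    (hw : ∀ x, eSolve p t (eSource p α w) x ≤ w x) (k : ℕ) (x : ℝ) :
    torsionIter p α s k x ≤ w x := by
  induction k generalizing x with
  | zero => exact zero_le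
  | succ k ih => exact (eSolve_mono hp hst (fun y _ => eSource_mono hp (ih y)) x).trans (hw x)

theorem ennreal_rpow_eq_mul_self (hp : 1 < p) (a : ENNReal) : a ^ p = a ^ (p - 1) * a := by
  have h := ENNReal.rpow_add_of_nonneg (x := a) (p - 1) 1 (sub_pos.2 hp).le zero_le_one
  rwa [sub_add_cancel, ENNReal.rpow_one] at h

theorem eSlope_rpow_mul_density (hp : 1 < p) (g : ℝ → ENNReal) (y : ℝ) :
    ENNReal.ofReal (gaussDensity y) * eSlope p g y ^ p =
      eSlope p g y * ∫⁻ x in Iio y, g x ∂(gaussMeasure ℝ) := by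
  have h0 : ENNReal.ofReal (gaussDensity y) ≠ 0 := by simp [gaussDensity_pos y]
  have hp1 : 0 < p - 1 := sub_pos.2 hp
  have h1 : eSlope p g y ^ (p - 1) =
      (ENNReal.ofReal (gaussDensity y))⁻¹ * ∫⁻ x in Iio y, g x ∂(gaussMeasure ℝ) := by
    rw [eSlope, ← ENNReal.rpow_mul, one_div_mul_cancel hp1.ne', ENNReal.rpow_one]
  rw [ennreal_rpow_eq_mul_self hp, h1, ← mul_assoc, ← mul_assoc, ENNReal.mul_inv_cancel h0 ENNReal.ofReal_ne_top, one_mul,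
    mul_comm]

/-- The energy identity. -/
theorem lintegral_eSlope_rpow (hp : 1 < p) {g : ℝ → ENNReal} (hg : Measurable g) :
    ∫⁻ y in Iio t, eSlope p g y ^ p ∂(gaussMeasure ℝ) =
      ∫⁻ x in Iio t, g x * eSolve p t g x ∂(gaussMeasure ℝ) := by
  rw [setLIntegral_gaussMeasure measurableSet_Iio ((measurable_eSlope p g).pow_const p),
    setLIntegral_gaussMeasure measurableSet_Iio
      (show Measurable fun x => g x * eSolve p t g x from hg.mul (measurable_eSolve p t g))]
  simp_rw [eSlope_rpow_mul_density hp]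
  have hm : Measurable fun x => ENNReal.ofReal (gaussDensity x) * g x :=
    continuous_gaussDensity.measurable.ennreal_ofReal.mul hg
  have := lintegral_triangle_swap t hm.aemeasurable (measurable_eSlope p g).aemeasurable
  simp_rw [← mul_assoc]
  unfold eSolve
  rw [this]
  refine lintegral_congr fun y => ?_
  rw [setLIntegral_gaussMeasure measurableSet_Iio hg]

theorem eSolve_const_mul (hp : 1 < p) {c : ENNReal} (hc : c ≠ ⊤) (g : ℝ → ENNReal) (x : ℝ) :
    eSolve p t (fun y => c * g y) x = c ^ (1 / (p - 1)) * eSolve p t g x := by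
  have hp1 : 0 ≤ 1 / (p - 1) := by have := sub_pos.2 hp; positivity
  unfold eSolve
  rw [← lintegral_const_mul' _ _ (ENNReal.rpow_ne_top_of_nonneg hp1 hc)]
  refine lintegral_congr fun y => ?_
  rw [eSlope, eSlope, lintegral_const_mul' _ _ hc, mul_left_comm, ENNReal.mul_rpow_of_nonneg _ _ hp1]

/-- Monotone convergence twice, for the flux and for its primitive. Working in `[0, ∞]` postpones
every finiteness question to the limit. -/
theorem tendsto_eSolve (hp : 1 < p) {g : ℕ → ℝ → ENNReal} {g' : ℝ → ENNReal}
    (hgm : ∀ n, Measurable (g n)) (hmono : ∀ x, Monotone fun n => g n x)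
    (hlim : ∀ x, Tendsto (fun n => g n x) atTop (𝓝 (g' x))) (x : ℝ) :
    Tendsto (fun n => eSolve p t (g n) x) atTop (𝓝 (eSolve p t g' x)) := by
  refine lintegral_tendsto_of_tendsto_of_monotone
    (fun n => (measurable_eSlope p (g n)).aemeasurable)
    (Eventually.of_forall fun y m n hmn => eSlope_mono hp fun x _ => hmono x hmn)
    (Eventually.of_forall fun y => ?_)
  refine (ENNReal.Tendsto.const_mul (lintegral_tendsto_of_tendsto_of_monotone
    (fun n => (hgm n).aemeasurable) (Eventually.of_forall hmono) (Eventually.of_forall hlim))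
    (Or.inr ?_)).ennrpow_const _
  simp [gaussDensity_pos y]

/-- The limit of the iterates. -/
noncomputable def torsionLimit (p α t : ℝ) (x : ℝ) : ENNReal := ⨆ k, torsionIter p α t k x

theorem tendsto_torsionLimit (hp : 1 < p) (x : ℝ) :
    Tendsto (fun k => torsionIter p α t k x) atTop (𝓝 (torsionLimit p α t x)) :=
  tendsto_atTop_iSup (monotone_torsionIter hp x)

theorem measurable_torsionLimit (p α t : ℝ) : Measurable (torsionLimit p α t) :=
  Measurable.iSup fun k => measurable_torsionIter p α t k

theorem torsionLimit_fixed (hp : 1 < p) (x : ℝ) :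
    torsionLimit p α t x = eSolve p t (eSource p α (torsionLimit p α t)) x := by
  have hp1 : 0 < p - 1 := sub_pos.2 hp
  have h1 := (tendsto_torsionLimit (α := α) (t := t) hp x).comp (tendsto_add_atTop_nat 1)
  refine tendsto_nhds_unique h1 ?_
  refine tendsto_eSolve hp (fun n => measurable_eSource (measurable_torsionIter p α t n))
    (fun y m n hmn => eSource_mono hp (monotone_torsionIter hp y hmn)) (fun y => ?_) x
  exact (ENNReal.Tendsto.const_mul ((tendsto_torsionLimit hp y).ennrpow_const _)
    (Or.inr ENNReal.ofReal_ne_top)).add_const 1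

theorem antitone_torsionLimit (hp : 1 < p) : Antitone (torsionLimit p α t) := fun a b hab => by
  rw [torsionLimit_fixed hp a, torsionLimit_fixed hp b]
  exact antitone_eSolve _ _ _ hab

theorem ennreal_le_one_add_rpow (hp : 1 < p) (a : ENNReal) : a ≤ 1 + a ^ p := by
  rcases le_total a 1 with h | h
  · exact h.trans le_self_add
  · calc a = a ^ (1 : ℝ) := (ENNReal.rpow_one a).symm
      _ ≤ a ^ p := ENNReal.rpow_le_rpow_of_exponent_le h hp.le
      _ ≤ _ := le_add_self

theorem eSource_mul_self (hp : 1 < p) (v : ℝ → ENNReal) (x : ℝ) :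
    eSource p α v x * v x = ENNReal.ofReal α * v x ^ p + v x := by
  rw [eSource, add_mul, one_mul, mul_assoc, ← ennreal_rpow_eq_mul_self hp]

theorem memLp_ofReal_of_lintegral (hp : 1 < p) {μ : Measure ℝ} {f : ℝ → ℝ}
    (hf : AEStronglyMeasurable f μ) (hfin : ∫⁻ x, ‖f x‖ₑ ^ p ∂μ ≠ ⊤) :
    MemLp f (ENNReal.ofReal p) μ := by
  refine ⟨hf, ?_⟩
  rw [lintegral_enorm_rpow_eq_eLpNorm hp] at hfin
  by_contra hcon
  rw [not_lt, top_le_iff] at hcon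
  rw [hcon, ENNReal.top_rpow_of_pos (by linarith)] at hfin
  exact hfin rfl

theorem torsionFlux_nonneg (hα : 0 ≤ α) {u : ℝ → ℝ} (hu0 : ∀ x, 0 ≤ u x) (y : ℝ) :
    0 ≤ torsionFlux p α u y :=
  integral_nonneg fun x => by
    have := oddPow_nonneg (p := p) (hu0 x)
    show 0 ≤ α * oddPow p (u x) + 1
    positivity

theorem torsionSlope_nonneg (hα : 0 ≤ α) {u : ℝ → ℝ} (hu0 : ∀ x, 0 ≤ u x) (y : ℝ) :
    0 ≤ torsionSlope p α u y :=
  oddPow_nonneg (div_nonneg (torsionFlux_nonneg hα hu0 y) (gaussDensity_pos y).le)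

theorem eSource_ofReal (hp : 1 < p) (hα : 0 ≤ α) {u : ℝ → ℝ} (hu0 : ∀ x, 0 ≤ u x) (x : ℝ) :
    eSource p α (fun y => ENNReal.ofReal (u y)) x = ENNReal.ofReal (α * oddPow p (u x) + 1) := by
  rw [eSource, oddPow_of_nonneg hp (hu0 x), ENNReal.ofReal_add
    (mul_nonneg hα (Real.rpow_nonneg (hu0 x) _)) zero_le_one, ENNReal.ofReal_mul hα,
    ← ENNReal.ofReal_rpow_of_nonneg (hu0 x) (sub_pos.2 hp).le, ENNReal.ofReal_one]

theorem eSlope_eSource_ofReal (hp : 1 < p) (hα : 0 ≤ α) {u : ℝ → ℝ}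
    (hu : MemLp u (ENNReal.ofReal p) (gaussMeasure ℝ)) (hu0 : ∀ x, 0 ≤ u x) (y : ℝ) :
    eSlope p (eSource p α fun x => ENNReal.ofReal (u x)) y =
      ENNReal.ofReal (torsionSlope p α u y) := by
  have hp1 : 0 < p - 1 := sub_pos.2 hp
  have hd := gaussDensity_pos y
  have hf0 := torsionFlux_nonneg (p := p) hα hu0 y
  have hflux : ∫⁻ x in Iio y, eSource p α (fun y => ENNReal.ofReal (u y)) x ∂(gaussMeasure ℝ) =
      ENNReal.ofReal (torsionFlux p α u y) := by
    rw [torsionFlux, ofReal_integral_eq_lintegral_ofReal (integrable_source hp α hu).integrableOn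
      (Eventually.of_forall fun x => add_nonneg (mul_nonneg hα (oddPow_nonneg (hu0 x))) zero_le_one)]
    simp_rw [eSource_ofReal hp hα hu0]
  have he : 1 / (p - 1) = p / (p - 1) - 1 := by
    have := hp1.ne'
    field_simp
    ring
  rw [eSlope, hflux, torsionSlope, oddPow_of_nonneg (one_lt_conj hp) (div_nonneg hf0 hd.le),
    ← ENNReal.ofReal_inv_of_pos hd, ← ENNReal.ofReal_mul (inv_nonneg.2 hd.le),
    ENNReal.ofReal_rpow_of_nonneg (mul_nonneg (inv_nonneg.2 hd.le) hf0) (by positivity),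
    inv_mul_eq_div, he]

/-- Bounded iterates converge to a regular nonnegative solution. -/
theorem exists_regular_of_bounded_iter (hp : 1 < p) (hα : 0 ≤ α) {C : ENNReal} (hC : C ≠ ⊤)
    (hb : ∀ k, ∫⁻ x in Iio t, torsionIter p α t k x ^ p ∂(gaussMeasure ℝ) ≤ C) :
    ∃ u, IsRegularSolution p α t u ∧ (∀ x, 0 ≤ u x) ∧
      ∀ x, ENNReal.ofReal (u x) = torsionLimit p α t x := by
  have hp0 : 0 < p := by linarith
  have hp1 : 0 < p - 1 := sub_pos.2 hp
  set v := torsionLimit p α t with hv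
  have hvm : Measurable v := measurable_torsionLimit p α t
  have hv0 : ∀ x, t ≤ x → v x = 0 := fun x hx => by
    rw [hv, torsionLimit_fixed hp, eSolve_eq_zero _ _ hx]
  have hvp : ∫⁻ x in Iio t, v x ^ p ∂(gaussMeasure ℝ) ≤ C := by
    refine le_of_tendsto' (lintegral_tendsto_of_tendsto_of_monotone
      (fun k => ((measurable_torsionIter p α t k).pow_const p).aemeasurable)
      (Eventually.of_forall fun x m n hmn => ENNReal.rpow_le_rpow (monotone_torsionIter hp x hmn) hp0.le)
      (Eventually.of_forall fun x => (tendsto_torsionLimit hp x).ennrpow_const p)) hb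
  have hvpt : ∫⁻ x in Iio t, v x ^ p ∂(gaussMeasure ℝ) ≠ ⊤ := ne_top_of_le_ne_top hC hvp
  -- The `L^p` bound gives finiteness almost everywhere only. The limit is antitone, so finiteness
  -- at some point left of `x` passes to `x`.
  have hvfin : ∀ x, v x ≠ ⊤ := fun x => by
    rcases le_or_gt t x with hx | hx
    · rw [hv0 x hx]; exact ENNReal.zero_ne_top
    have hae := ae_restrict_gaussMeasure_iff.1 (ae_lt_top (hvm.pow_const p) hvpt)
    have hne : volume.restrict (Iio t) (Ioo (x - 1) x) ≠ 0 := by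
      rw [Measure.restrict_apply measurableSet_Ioo,
        inter_eq_left.2 (Ioo_subset_Iio_self.trans (Iio_subset_Iio hx.le)), Real.volume_Ioo]
      simp
    obtain ⟨y, hy, hy2⟩ : ∃ y ∈ Ioo (x - 1) x, v y ^ p < ⊤ := by
      by_contra! hcon
      refine hne (measure_mono_null (fun y hy => ?_) hae)
      exact fun h => absurd (hcon y hy) (not_le.2 h)
    have hyt : v y ≠ ⊤ := fun h => by
      rw [h, ENNReal.top_rpow_of_pos hp0] at hy2; exact lt_irrefl _ hy2
    exact ne_top_of_le_ne_top hyt (antitone_torsionLimit hp hy.2.le)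
  set u : ℝ → ℝ := fun x => (v x).toReal with hu
  have huv : ∀ x, ENNReal.ofReal (u x) = v x := fun x => ENNReal.ofReal_toReal (hvfin x)
  have hu0 : ∀ x, 0 ≤ u x := fun x => ENNReal.toReal_nonneg
  have hum : Measurable u := hvm.ennreal_toReal
  have hen : ∀ x, ‖u x‖ₑ = v x := fun x => by rw [Real.enorm_eq_ofReal (hu0 x), huv]
  have hall : ∫⁻ x, v x ^ p ∂(gaussMeasure ℝ) = ∫⁻ x in Iio t, v x ^ p ∂(gaussMeasure ℝ) := by
    rw [← lintegral_indicator measurableSet_Iio]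
    refine lintegral_congr fun x => ?_
    rcases lt_or_ge x t with hx | hx
    · rw [indicator_of_mem (mem_Iio.2 hx)]
    · rw [indicator_of_notMem (by simpa using hx), hv0 x hx, ENNReal.zero_rpow_of_pos hp0]
  have huL : MemLp u (ENNReal.ofReal p) (gaussMeasure ℝ) := by
    refine memLp_ofReal_of_lintegral hp hum.aestronglyMeasurable ?_
    simp_rw [hen]
    rw [hall]; exact hvpt
  have hv' : v = fun x => ENNReal.ofReal (u x) := (funext huv).symm
  have hslope0 := torsionSlope_nonneg (p := p) hα hu0
  have hslope : ∀ y, eSlope p (eSource p α v) y = ENNReal.ofReal (torsionSlope p α u y) :=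
    fun y => by rw [hv']; exact eSlope_eSource_ofReal hp hα huL hu0 y
  have hsm : Continuous (torsionSlope p α u) := continuous_torsionSlope hp huL
  refine ⟨u, ⟨fun x hx => by simp [hu, hv0 x hx], huL, fun x hx => ?_, ?_⟩, hu0, huv⟩
  · rw [intervalIntegral.integral_of_le hx, integral_Ioc_eq_integral_Ioo,
      integral_eq_lintegral_of_nonneg_ae (Eventually.of_forall hslope0) hsm.aestronglyMeasurable]
    simp_rw [← hslope]
    rw [hu]
    simp only
    rw [hv, torsionLimit_fixed hp x]
    rfl
  · refine memLp_ofReal_of_lintegral hp hsm.aestronglyMeasurable ?_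
    simp_rw [fun y => Real.enorm_eq_ofReal (hslope0 y), ← hslope]
    -- The energy identity at the fixed point expresses the slope's `L^p` norm through `α ∫ v^p + ∫
    -- v`, which is already known to be finite.
    rw [lintegral_eSlope_rpow hp (measurable_eSource hvm)]
    have hfx : ∀ x, eSolve p t (eSource p α v) x = v x := fun x => (torsionLimit_fixed hp x).symm
    simp_rw [hfx, eSource_mul_self hp]
    rw [lintegral_add_right _ hvm, lintegral_const_mul' _ _ ENNReal.ofReal_ne_top]
    refine ENNReal.add_ne_top.2 ⟨ENNReal.mul_ne_top ENNReal.ofReal_ne_top hvpt, ?_⟩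
    refine ne_top_of_le_ne_top ?_ (lintegral_mono fun x => ennreal_le_one_add_rpow hp (v x))
    rw [lintegral_add_left measurable_const, lintegral_one]
    exact ENNReal.add_ne_top.2 ⟨measure_ne_top _ _, hvpt⟩

/-- A regular nonnegative solution is a fixed point of the iteration. -/
theorem IsRegularSolution.eSolve_eq (hp : 1 < p) (hα : 0 ≤ α) {u : ℝ → ℝ}
    (h : IsRegularSolution p α t u) (hu0 : ∀ x, 0 ≤ u x) (x : ℝ) :
    eSolve p t (eSource p α fun y => ENNReal.ofReal (u y)) x = ENNReal.ofReal (u x) := by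
  have hslope0 := torsionSlope_nonneg (p := p) hα hu0
  have hsm : Continuous (torsionSlope p α u) := continuous_torsionSlope hp h.memLp
  rcases le_or_gt x t with hx | hx
  · rw [h.eq_integral x hx, intervalIntegral.integral_of_le hx, integral_Ioc_eq_integral_Ioo,
      ofReal_integral_eq_lintegral_ofReal (hsm.integrableOn_Icc.mono_set Ioo_subset_Icc_self)
        (Eventually.of_forall hslope0), eSolve]
    simp_rw [eSlope_eSource_ofReal hp hα h.memLp hu0]
  · rw [eSolve_eq_zero _ _ hx.le, h.eq_zero x hx.le, ENNReal.ofReal_zero]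

end Iteration

/-! ### Bounds for the iterates below the first eigenvalue -/

section IterationBounds

variable {p α t : ℝ}

/-- Expanding the square separates the density at `y` from a Gaussian in the distance `r`; the cross
term `e^{yr}` is bounded by `e^{tr}` when `y ≤ t` and `r ≥ 0`. -/
theorem gaussDensity_sub_mul (y r : ℝ) :
    gaussDensity (y - r) * gaussDensity (0 : ℝ) =
      gaussDensity y * gaussDensity r * Real.exp (y * r) := by
  simp only [gaussDensity_real]
  have h : Real.exp (-((y - r) ^ 2) / 2) =
      Real.exp (-(y ^ 2) / 2) * Real.exp (-(r ^ 2) / 2) * Real.exp (y * r) := by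
    rw [← Real.exp_add, ← Real.exp_add]
    congr 1
    ring
  rw [h]
  simp
  ring

theorem lintegral_exp_gaussMeasure_ne_top (b : ℝ) :
    ∫⁻ x, ENNReal.ofReal (Real.exp (b * x)) ∂(gaussMeasure ℝ) ≠ ⊤ := by
  have h : Integrable (fun x : ℝ => Real.exp (b * x)) (gaussMeasure ℝ) := by
    rw [gaussMeasure_real_eq]
    exact ProbabilityTheory.integrable_exp_mul_gaussianReal b
  exact h.lintegral_lt_top.ne

/-- Exponentially weighted Mills ratio bound. -/
theorem exists_lintegral_exp_le (a t : ℝ) : ∃ M : ENNReal, M ≠ ⊤ ∧ ∀ y ≤ t,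
    ∫⁻ x in Iio y, ENNReal.ofReal (Real.exp (-(a * x))) ∂(gaussMeasure ℝ) ≤
      M * ENNReal.ofReal (gaussDensity y * Real.exp (-(a * y))) := by
  have hφ0 := gaussDensity_pos (0 : ℝ)
  refine ⟨ENNReal.ofReal (1 / gaussDensity (0 : ℝ)) *
    ∫⁻ x, ENNReal.ofReal (Real.exp ((t + a) * x)) ∂(gaussMeasure ℝ),
    ENNReal.mul_ne_top ENNReal.ofReal_ne_top (lintegral_exp_gaussMeasure_ne_top _), fun y hy => ?_⟩
  have hme : ∀ b : ℝ, Measurable fun x : ℝ => ENNReal.ofReal (Real.exp (b * x)) := fun b => by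
    fun_prop
  have hme' : Measurable fun x : ℝ => ENNReal.ofReal (Real.exp (-(a * x))) := by fun_prop
  have hmφ : Measurable fun x : ℝ => ENNReal.ofReal (gaussDensity x) :=
    continuous_gaussDensity.measurable.ennreal_ofReal
  -- The reflection `x = y - r` turns the tail `x < y` into `r > 0`. The constant becomes an
  -- exponential moment of the Gaussian that no longer depends on `y`.
  rw [setLIntegral_gaussMeasure measurableSet_Iio hme', ← lintegral_indicator measurableSet_Iio,
    ← lintegral_sub_left_eq_self _ y]
  have hu := setLIntegral_gaussMeasure (E := ℝ) MeasurableSet.univ (hme (t + a))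
  rw [Measure.restrict_univ, Measure.restrict_univ] at hu
  rw [hu, mul_comm, ← mul_assoc, ← ENNReal.ofReal_mul (by have := gaussDensity_pos y; positivity),
    ← lintegral_const_mul' _ _ ENNReal.ofReal_ne_top]
  refine lintegral_mono fun r => ?_
  simp only
  rcases le_or_gt r 0 with hr | hr
  · rw [indicator_of_notMem (by simpa using hr)]; exact zero_le
  rw [indicator_of_mem (by simpa using hr), ← ENNReal.ofReal_mul (gaussDensity_pos _).le,
    ← ENNReal.ofReal_mul (gaussDensity_pos _).le,
    ← ENNReal.ofReal_mul (by have := gaussDensity_pos y; positivity)]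
  refine ENNReal.ofReal_le_ofReal ?_
  have h1 : gaussDensity (y - r) = gaussDensity y * gaussDensity r * Real.exp (y * r) /
      gaussDensity (0 : ℝ) := by rw [← gaussDensity_sub_mul, mul_div_cancel_right₀ _ hφ0.ne']
  have h2 : Real.exp (y * r) ≤ Real.exp (t * r) :=
    Real.exp_le_exp.2 (mul_le_mul_of_nonneg_right hy hr.le)
  have h3 : Real.exp (-(a * (y - r))) = Real.exp (-(a * y)) * Real.exp (a * r) := by
    rw [← Real.exp_add]; congr 1; ring
  have h4 : Real.exp ((t + a) * r) = Real.exp (t * r) * Real.exp (a * r) := by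
    rw [← Real.exp_add]; congr 1; ring
  have hy0 := gaussDensity_pos y
  have hr0 := gaussDensity_pos r
  rw [h1, h3, h4]
  calc gaussDensity y * gaussDensity r * Real.exp (y * r) / gaussDensity (0 : ℝ) *
        (Real.exp (-(a * y)) * Real.exp (a * r))
      = gaussDensity y * gaussDensity r * (Real.exp (-(a * y)) * Real.exp (a * r)) /
        gaussDensity (0 : ℝ) * Real.exp (y * r) := by ring
    _ ≤ gaussDensity y * gaussDensity r * (Real.exp (-(a * y)) * Real.exp (a * r)) /
        gaussDensity (0 : ℝ) * Real.exp (t * r) := by gcongr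
    _ = _ := by ring

theorem lintegral_Ioo_exp_le (x t : ℝ) :
    ∫⁻ y in Ioo x t, ENNReal.ofReal (Real.exp (-y)) ≤ ENNReal.ofReal (Real.exp (-x)) := by
  have hi : IntegrableOn (fun y : ℝ => Real.exp (-y)) (Ioi x) := by
    simpa using exp_neg_integrableOn_Ioi x one_pos
  refine (lintegral_mono_set Ioo_subset_Ioi_self).trans ?_
  rw [← ofReal_integral_eq_lintegral_ofReal hi (Eventually.of_forall fun y => (Real.exp_pos _).le),
    integral_exp_neg_Ioi]

theorem ofReal_exp_rpow (x b : ℝ) :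
    ENNReal.ofReal (Real.exp (-x)) ^ b = ENNReal.ofReal (Real.exp (-(b * x))) := by
  rw [ENNReal.ofReal_rpow_of_pos (Real.exp_pos _), ← Real.exp_mul]
  congr 2
  ring

/-- The class of functions `O(e^{-x})` on the half-line is preserved by the iteration: the source is
`O(e^{-(p-1)x})`, dividing the flux by the density keeps this rate by the Mills bound, and the root
and the primitive return `e^{-x}`. The constant depends on `k`; the purpose is qualitative
finiteness of each iterate, so that terms can later be subtracted. -/
theorem exists_torsionIter_le_exp (hp : 1 < p) (k : ℕ) : ∃ A : ENNReal, A ≠ ⊤ ∧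
    ∀ x, torsionIter p α t k x ≤ A * ENNReal.ofReal (Real.exp (-x)) := by
  have hp1 : 0 < p - 1 := sub_pos.2 hp
  induction k with
  | zero => exact ⟨0, ENNReal.zero_ne_top, fun x => zero_le⟩
  | succ k ih =>
    obtain ⟨A, hA, h⟩ := ih
    obtain ⟨M, hM, hMy⟩ := exists_lintegral_exp_le (p - 1) t
    set A' : ENNReal := ENNReal.ofReal α * A ^ (p - 1) + ENNReal.ofReal (Real.exp ((p - 1) * t))
    have hA' : A' ≠ ⊤ := ENNReal.add_ne_top.2 ⟨ENNReal.mul_ne_top ENNReal.ofReal_ne_top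
      (ENNReal.rpow_ne_top_of_nonneg hp1.le hA), ENNReal.ofReal_ne_top⟩
    have hsrc : ∀ x < t, eSource p α (torsionIter p α t k) x ≤
        A' * ENNReal.ofReal (Real.exp (-((p - 1) * x))) := fun x hx => by
      have h1 : torsionIter p α t k x ^ (p - 1) ≤
          A ^ (p - 1) * ENNReal.ofReal (Real.exp (-((p - 1) * x))) := by
        rw [← ofReal_exp_rpow, ← ENNReal.mul_rpow_of_nonneg _ _ hp1.le]
        exact ENNReal.rpow_le_rpow (h x) hp1.le
      have h2 : (1 : ENNReal) ≤ ENNReal.ofReal (Real.exp ((p - 1) * t)) *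
          ENNReal.ofReal (Real.exp (-((p - 1) * x))) := by
        rw [← ENNReal.ofReal_mul (Real.exp_pos _).le, ← Real.exp_add, ← ENNReal.ofReal_one]
        refine ENNReal.ofReal_le_ofReal (Real.one_le_exp ?_)
        nlinarith
      rw [eSource, add_mul, mul_assoc]
      gcongr
    have hslope : ∀ y < t, eSlope p (eSource p α (torsionIter p α t k)) y ≤
        (A' * M) ^ (1 / (p - 1)) * ENNReal.ofReal (Real.exp (-y)) := fun y hy => by
      have hd : ENNReal.ofReal (gaussDensity y) ≠ 0 := by simp [gaussDensity_pos y]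
      have h3 : ENNReal.ofReal (Real.exp (-y)) =
          ENNReal.ofReal (Real.exp (-((p - 1) * y))) ^ (1 / (p - 1)) := by
        rw [ofReal_exp_rpow]
        congr 3
        field_simp
      have hc : 0 ≤ 1 / (p - 1) := by positivity
      rw [h3, ← ENNReal.mul_rpow_of_nonneg _ _ hc, eSlope]
      refine ENNReal.rpow_le_rpow ?_ hc
      calc (ENNReal.ofReal (gaussDensity y))⁻¹ *
            ∫⁻ x in Iio y, eSource p α (torsionIter p α t k) x ∂(gaussMeasure ℝ)
          ≤ (ENNReal.ofReal (gaussDensity y))⁻¹ *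
            ∫⁻ x in Iio y, A' * ENNReal.ofReal (Real.exp (-((p - 1) * x))) ∂(gaussMeasure ℝ) := by
            gcongr 1
            exact setLIntegral_mono' measurableSet_Iio fun x hx => hsrc x (lt_trans hx hy)
        _ ≤ (ENNReal.ofReal (gaussDensity y))⁻¹ *
            (A' * (M * ENNReal.ofReal (gaussDensity y * Real.exp (-((p - 1) * y))))) := by
            rw [lintegral_const_mul' _ _ hA']
            gcongr
            exact hMy y hy.le
        _ = _ := by
            rw [ENNReal.ofReal_mul (gaussDensity_pos y).le]
            calc _ = ((ENNReal.ofReal (gaussDensity y))⁻¹ * ENNReal.ofReal (gaussDensity y)) *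
                  (A' * M * ENNReal.ofReal (Real.exp (-((p - 1) * y)))) := by ring
              _ = _ := by rw [ENNReal.inv_mul_cancel hd ENNReal.ofReal_ne_top, one_mul]
    have hB : (A' * M) ^ (1 / (p - 1)) ≠ ⊤ :=
      ENNReal.rpow_ne_top_of_nonneg (by positivity) (ENNReal.mul_ne_top hA' hM)
    refine ⟨_, hB, fun x => ?_⟩
    calc torsionIter p α t (k + 1) x
        ≤ ∫⁻ y in Ioo x t, (A' * M) ^ (1 / (p - 1)) * ENNReal.ofReal (Real.exp (-y)) :=
          setLIntegral_mono' measurableSet_Ioo fun y hy => hslope y hy.2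
      _ ≤ _ := by
          rw [lintegral_const_mul' _ _ hB]
          gcongr
          exact lintegral_Ioo_exp_le x t

theorem torsionIter_ne_top (hp : 1 < p) (k : ℕ) (x : ℝ) : torsionIter p α t k x ≠ ⊤ := by
  obtain ⟨A, hA, h⟩ := exists_torsionIter_le_exp (α := α) (t := t) hp k
  exact ne_top_of_le_ne_top (ENNReal.mul_ne_top hA ENNReal.ofReal_ne_top) (h x)

theorem lintegral_torsionIter_rpow_ne_top (hp : 1 < p) (k : ℕ) :
    ∫⁻ x in Iio t, torsionIter p α t k x ^ p ∂(gaussMeasure ℝ) ≠ ⊤ := by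
  have hp0 : 0 ≤ p := by linarith
  obtain ⟨A, hA, h⟩ := exists_torsionIter_le_exp (α := α) (t := t) hp k
  obtain ⟨M, hM, hMy⟩ := exists_lintegral_exp_le p t
  have h1 : ∀ x, torsionIter p α t k x ^ p ≤ A ^ p * ENNReal.ofReal (Real.exp (-(p * x))) :=
    fun x => by
      rw [← ofReal_exp_rpow, ← ENNReal.mul_rpow_of_nonneg _ _ hp0]
      exact ENNReal.rpow_le_rpow (h x) hp0
  have hAp : A ^ p ≠ ⊤ := ENNReal.rpow_ne_top_of_nonneg hp0 hA
  refine ne_top_of_le_ne_top ?_ (lintegral_mono h1)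
  rw [lintegral_const_mul' _ _ hAp]
  exact ENNReal.mul_ne_top hAp (ne_top_of_le_ne_top (ENNReal.mul_ne_top hM ENNReal.ofReal_ne_top)
    (hMy t le_rfl))

/-- In the energy identity the source carries the iterate `k` and the solution the iterate `k + 1`.
Monotonicity replaces the former by the latter, giving the energy inequality of a subsolution. -/
theorem lintegral_eSlope_torsionIter_le (hp : 1 < p) (k : ℕ) :
    ∫⁻ y in Iio t, eSlope p (eSource p α (torsionIter p α t k)) y ^ p ∂(gaussMeasure ℝ) ≤
      ENNReal.ofReal α * (∫⁻ x in Iio t, torsionIter p α t (k + 1) x ^ p ∂(gaussMeasure ℝ)) +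
        ∫⁻ x in Iio t, torsionIter p α t (k + 1) x ∂(gaussMeasure ℝ) := by
  rw [lintegral_eSlope_rpow hp (measurable_eSource (measurable_torsionIter p α t k)),
    ← lintegral_const_mul' _ _ ENNReal.ofReal_ne_top,
    ← lintegral_add_right _ (measurable_torsionIter p α t (k + 1))]
  refine lintegral_mono fun x => ?_
  simp only
  rw [← eSource_mul_self hp]
  exact mul_le_mul_left (eSource_mono hp (torsionIter_le_succ hp k x)) _

theorem lintegral_torsionIter_ne_top (hp : 1 < p) (k : ℕ) :
    ∫⁻ x in Iio t, torsionIter p α t k x ∂(gaussMeasure ℝ) ≠ ⊤ := by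
  refine ne_top_of_le_ne_top ?_ (lintegral_mono fun x => ennreal_le_one_add_rpow hp _)
  rw [lintegral_add_left measurable_const, lintegral_one]
  exact ENNReal.add_ne_top.2 ⟨measure_ne_top _ _, lintegral_torsionIter_rpow_ne_top hp k⟩

theorem lintegral_eSlope_torsionIter_ne_top (hp : 1 < p) (k : ℕ) :
    ∫⁻ y in Iio t, eSlope p (eSource p α (torsionIter p α t k)) y ^ p ∂(gaussMeasure ℝ) ≠ ⊤ :=
  ne_top_of_le_ne_top (ENNReal.add_ne_top.2 ⟨ENNReal.mul_ne_top ENNReal.ofReal_ne_top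
    (lintegral_torsionIter_rpow_ne_top hp _), lintegral_torsionIter_ne_top hp _⟩)
    (lintegral_eSlope_torsionIter_le hp k)

/-- Admissibility of the iterates, so that the Rayleigh bound can be applied to them. -/
theorem memGaussSobolevZero_torsionIter (hp : 1 < p) (k : ℕ) :
    MemGaussSobolevZero p (Iio t) (fun x => (torsionIter p α t (k + 1) x).toReal)
      (fun x => -(eSlope p (eSource p α (torsionIter p α t k)) x).toReal) := by
  have hp0 : 0 < p := by linarith
  set S := eSlope p (eSource p α (torsionIter p α t k)) with hS
  have hSm : Measurable S := measurable_eSlope _ _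
  have hle : ∀ a : ENNReal, ‖a.toReal‖ₑ ≤ a := fun a => by
    rw [Real.enorm_eq_ofReal ENNReal.toReal_nonneg]; exact ENNReal.ofReal_toReal_le
  refine memGaussSobolevZero_of_ae_eq hp ?_ ?_ ((ae_restrict_mem measurableSet_Iio).mono fun x hx => ?_)
  · refine memLp_ofReal_of_lintegral hp
      (measurable_torsionIter p α t (k + 1)).ennreal_toReal.aestronglyMeasurable ?_
    exact ne_top_of_le_ne_top (lintegral_torsionIter_rpow_ne_top hp (k + 1))
      (lintegral_mono fun x => ENNReal.rpow_le_rpow (hle _) hp0.le)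
  · refine (memLp_ofReal_of_lintegral hp hSm.ennreal_toReal.aestronglyMeasurable ?_).neg
    exact ne_top_of_le_ne_top (lintegral_eSlope_torsionIter_ne_top hp k)
      (lintegral_mono fun x => ENNReal.rpow_le_rpow (hle _) hp0.le)
  · rw [intervalIntegral.integral_neg, neg_neg]
    rw [intervalIntegral.integral_of_le (le_of_lt hx), integral_Ioc_eq_integral_Ioo, integral_toReal
      hSm.aemeasurable (ae_lt_top hSm (torsionIter_ne_top (α := α) (t := t) hp (k + 1) x))]
    rfl

/-- Absorbs linear terms into a small multiple of the `p`-th power. The constant is the threshold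
beyond which `ε a^{p-1} ≥ 1`. -/
theorem exists_le_mul_rpow_add (hp : 1 < p) {ε : ℝ} (hε : 0 < ε) :
    ∃ K : ℝ, 0 ≤ K ∧ ∀ a : ℝ, 0 ≤ a → a ≤ ε * a ^ p + K := by
  have hp1 : 0 < p - 1 := sub_pos.2 hp
  have hK : 0 < (1 / ε) ^ (1 / (p - 1)) := by positivity
  refine ⟨(1 / ε) ^ (1 / (p - 1)), hK.le, fun a ha => ?_⟩
  rcases le_total a ((1 / ε) ^ (1 / (p - 1))) with h | h
  · have : 0 ≤ ε * a ^ p := by positivity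
    linarith
  · have ha0 : 0 < a := hK.trans_le h
    have h1 : 1 / ε ≤ a ^ (p - 1) := by
      calc 1 / ε = ((1 / ε) ^ (1 / (p - 1))) ^ (p - 1) := by
            rw [← Real.rpow_mul (by positivity), one_div_mul_cancel hp1.ne', Real.rpow_one]
        _ ≤ _ := Real.rpow_le_rpow hK.le h hp1.le
    have h2 : a ^ p = a ^ (p - 1) * a := by
      rw [← Real.rpow_add_one ha0.ne', sub_add_cancel]
    have h3 : a = ε * (1 / ε * a) := by field_simp
    have h4 : ε * (1 / ε * a) ≤ ε * a ^ p := by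
      rw [h2]; gcongr
    linarith

/-- The iterates are bounded in `L^p` when `α` is below the first eigenvalue. -/
theorem exists_lintegral_torsionIter_le (hp : 1 < p) (hα : 0 ≤ α) {lam : ℝ} (hlam : α < lam)
    (hray : ∀ w : ℝ → ℝ, IsTestFunction (Iio t) w →
      lam * ∫ x in Iio t, |w x| ^ p ∂(gaussMeasure ℝ) ≤
        ∫ x in Iio t, ‖gradient w x‖ ^ p ∂(gaussMeasure ℝ)) :
    ∃ C : ENNReal, C ≠ ⊤ ∧
      ∀ k, ∫⁻ x in Iio t, torsionIter p α t k x ^ p ∂(gaussMeasure ℝ) ≤ C := by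
  have hp0 : 0 < p := by linarith
  have hε : 0 < (lam - α) / 2 := by linarith
  obtain ⟨K, hK0, hK⟩ := exists_le_mul_rpow_add hp hε
  -- Write `X` for the integral of the `p`-th power of an iterate. Rayleigh, the energy inequality
  -- and the absorption of the linear term give `lam X ≤ α X + (lam - α)/2 X + K`. Since `X` is
  -- finite, this bounds it independently of `k`.
  refine ⟨ENNReal.ofReal (K / ((lam - α) / 2)), ENNReal.ofReal_ne_top, fun k => ?_⟩
  cases k with
  | zero => simp [torsionIter, hp0]
  | succ k =>
    have hmem := memGaussSobolevZero_torsionIter (α := α) (t := t) hp k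
    have hR := hmem.rayleigh hp hray
    set v := torsionIter p α t (k + 1) with hv
    set S := eSlope p (eSource p α (torsionIter p α t k)) with hS
    have hvm : Measurable v := measurable_torsionIter _ _ _ _
    have hX := lintegral_torsionIter_rpow_ne_top (α := α) (t := t) hp (k + 1)
    have hY := lintegral_torsionIter_ne_top (α := α) (t := t) hp (k + 1)
    have hE := lintegral_eSlope_torsionIter_ne_top (α := α) (t := t) hp k
    have hEle := lintegral_eSlope_torsionIter_le (α := α) (t := t) hp k
    rw [← hv] at hX hY hEle
    rw [← hS] at hE hEle
    have hSm : Measurable fun x => S x ^ p := (measurable_eSlope _ _).pow_const p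
    have e1 : ∫ x in Iio t, |(v x).toReal| ^ p ∂(gaussMeasure ℝ) =
        (∫⁻ x in Iio t, v x ^ p ∂(gaussMeasure ℝ)).toReal := by
      rw [← integral_toReal (hvm.pow_const p).aemeasurable (ae_lt_top (hvm.pow_const p) hX)]
      simp_rw [abs_of_nonneg (ENNReal.toReal_nonneg), ENNReal.toReal_rpow]
    have e2 : ∫ x in Iio t, ‖-(S x).toReal‖ ^ p ∂(gaussMeasure ℝ) =
        (∫⁻ x in Iio t, S x ^ p ∂(gaussMeasure ℝ)).toReal := by
      rw [← integral_toReal hSm.aemeasurable (ae_lt_top hSm hE)]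
      simp_rw [norm_neg, Real.norm_of_nonneg (ENNReal.toReal_nonneg), ENNReal.toReal_rpow]
    have e3 : ∫ x in Iio t, (v x).toReal ∂(gaussMeasure ℝ) =
        (∫⁻ x in Iio t, v x ∂(gaussMeasure ℝ)).toReal :=
      integral_toReal hvm.aemeasurable (ae_lt_top hvm hY)
    have h1 : (∫⁻ x in Iio t, S x ^ p ∂(gaussMeasure ℝ)).toReal ≤
        α * (∫⁻ x in Iio t, v x ^ p ∂(gaussMeasure ℝ)).toReal +
          (∫⁻ x in Iio t, v x ∂(gaussMeasure ℝ)).toReal := by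
      have := ENNReal.toReal_mono (ENNReal.add_ne_top.2
        ⟨ENNReal.mul_ne_top ENNReal.ofReal_ne_top hX, hY⟩) hEle
      rwa [ENNReal.toReal_add (ENNReal.mul_ne_top ENNReal.ofReal_ne_top hX) hY, ENNReal.toReal_mul,
        ENNReal.toReal_ofReal hα] at this
    have hvL : MemLp (fun x => (v x).toReal) (ENNReal.ofReal p)
      ((gaussMeasure ℝ).restrict (Iio t)) := hmem.1.2.1
    have h2 : ∫ x in Iio t, (v x).toReal ∂(gaussMeasure ℝ) ≤
        (lam - α) / 2 * (∫ x in Iio t, |(v x).toReal| ^ p ∂(gaussMeasure ℝ)) + K := by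
      have hi := hvL.integrable_norm_rpow_ofReal hp
      simp_rw [Real.norm_eq_abs] at hi
      calc ∫ x in Iio t, (v x).toReal ∂(gaussMeasure ℝ)
          ≤ ∫ x in Iio t, ((lam - α) / 2 * |(v x).toReal| ^ p + K) ∂(gaussMeasure ℝ) := by
            refine integral_mono (hvL.integrable (by simpa using hp.le))
              ((hi.const_mul _).add (integrable_const _)) fun x => ?_
            simp only [abs_of_nonneg (ENNReal.toReal_nonneg (a := v x))]
            exact hK _ ENNReal.toReal_nonneg
        _ ≤ _ := by
            rw [integral_add (hi.const_mul _) (integrable_const _), integral_const_mul,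
              integral_const, smul_eq_mul]
            have : ((gaussMeasure ℝ).restrict (Iio t)).real univ ≤ 1 := by
              rw [measureReal_restrict_apply_univ]
              exact measureReal_le_one
            nlinarith
    rw [e1, e2] at hR
    rw [e1, e3] at h2
    rw [← ENNReal.ofReal_toReal hX]
    refine ENNReal.ofReal_le_ofReal ?_
    rw [le_div_iff₀ hε]
    linarith

theorem exists_isRegularSolution (hp : 1 < p) (hα : 0 ≤ α) {lam : ℝ} (hlam : α < lam)
    (hray : ∀ w : ℝ → ℝ, IsTestFunction (Iio t) w →
      lam * ∫ x in Iio t, |w x| ^ p ∂(gaussMeasure ℝ) ≤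
        ∫ x in Iio t, ‖gradient w x‖ ^ p ∂(gaussMeasure ℝ)) :
    ∃ u, IsRegularSolution p α t u ∧ ∀ x, 0 ≤ u x := by
  obtain ⟨C, hC, hb⟩ := exists_lintegral_torsionIter_le hp hα hlam hray
  obtain ⟨u, hu, hu0, -⟩ := exists_regular_of_bounded_iter hp hα hC hb
  exact ⟨u, hu, hu0⟩

/-- A supersolution in `L^p` dominates a nonnegative regular solution. -/
theorem exists_isRegularSolution_of_supersolution (hp : 1 < p) (hα : 0 ≤ α) {s : ℝ} (hst : s ≤ t)
    {w : ℝ → ℝ} (hwL : MemLp w (ENNReal.ofReal p) (gaussMeasure ℝ)) (hw0 : ∀ x, 0 ≤ w x)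
    (hw : ∀ x, eSolve p t (eSource p α fun y => ENNReal.ofReal (w y)) x ≤ ENNReal.ofReal (w x)) :
    ∃ u, IsRegularSolution p α s u ∧ (∀ x, 0 ≤ u x) ∧ ∀ x, u x ≤ w x := by
  have hp0 : 0 < p := by linarith
  have hit := fun k x => torsionIter_le_of_supersolution hp hst hw k x
  have hC : ∫⁻ x, ‖w x‖ₑ ^ p ∂(gaussMeasure ℝ) ≠ ⊤ := by
    rw [lintegral_enorm_rpow_eq_eLpNorm hp]
    exact ENNReal.rpow_ne_top_of_nonneg hp0.le hwL.2.ne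
  obtain ⟨u, hu, hu0, hlim⟩ := exists_regular_of_bounded_iter (t := s) hp hα hC fun k =>
    (lintegral_mono fun x => ENNReal.rpow_le_rpow
      ((hit k x).trans_eq (Real.enorm_eq_ofReal (hw0 x)).symm) hp0.le).trans
      (setLIntegral_le_lintegral _ _)
  refine ⟨u, hu, hu0, fun x => ?_⟩
  rw [← ENNReal.ofReal_le_ofReal_iff (hw0 x), hlim x]
  exact iSup_le fun k => hit k x

theorem IsRegularSolution.exists_le (hp : 1 < p) (hα : 0 ≤ α) {s : ℝ} (hst : s ≤ t) {w : ℝ → ℝ}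
    (h : IsRegularSolution p α t w) (h0 : ∀ x, 0 ≤ w x) :
    ∃ u, IsRegularSolution p α s u ∧ (∀ x, 0 ≤ u x) ∧ ∀ x, u x ≤ w x :=
  exists_isRegularSolution_of_supersolution hp hα hst h.memLp h0
    fun x => (h.eSolve_eq hp hα h0 x).le

/-- If `c ≤ η b`, the shift costs a factor `(1 + η)^{p-1}`, absorbed by the gap between `α` and
`α'`. Otherwise `b ≤ c / η`, and the whole left side is small. The number `η` is chosen first, then
`c`. -/
theorem exists_add_rpow_le {α' : ℝ} (hp : 1 < p) (hα : 0 ≤ α) (hα' : α < α') :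
    ∃ c : ℝ, 0 < c ∧ ∀ b : ℝ, 0 ≤ b → α * (b + c) ^ (p - 1) ≤ α' * b ^ (p - 1) + 1 / 2 := by
  have hp1 : 0 < p - 1 := sub_pos.2 hp
  have hcont : ∀ x : ℝ, ContinuousAt (fun y : ℝ => y ^ (p - 1)) x := fun x =>
    Real.continuousAt_rpow_const x _ (Or.inr hp1.le)
  have h1 : ∀ᶠ η in 𝓝[>] (0 : ℝ), α * (1 + η) ^ (p - 1) < α' := by
    have : Tendsto (fun η : ℝ => α * (1 + η) ^ (p - 1)) (𝓝 0) (𝓝 (α * (1 + 0) ^ (p - 1))) :=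
      (((hcont (1 + 0)).tendsto.comp ((continuous_const.add continuous_id).tendsto 0)).const_mul α)
    rw [add_zero, Real.one_rpow, mul_one] at this
    exact (this.eventually (gt_mem_nhds hα')).filter_mono nhdsWithin_le_nhds
  obtain ⟨η, hη, hη0⟩ := (h1.and self_mem_nhdsWithin).exists
  have hη0' : 0 < η := hη0
  have h2 : ∀ᶠ c in 𝓝[>] (0 : ℝ), α * (c * (1 / η + 1)) ^ (p - 1) < 1 / 2 := by
    have : Tendsto (fun c : ℝ => α * (c * (1 / η + 1)) ^ (p - 1)) (𝓝 0)
        (𝓝 (α * (0 * (1 / η + 1)) ^ (p - 1))) :=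
      ((hcont (0 * (1 / η + 1))).tendsto.comp
        ((continuous_id.mul continuous_const).tendsto 0)).const_mul α
    rw [zero_mul, Real.zero_rpow hp1.ne', mul_zero] at this
    exact (this.eventually (gt_mem_nhds (by norm_num))).filter_mono nhdsWithin_le_nhds
  obtain ⟨c, hc, hc0⟩ := (h2.and self_mem_nhdsWithin).exists
  have hc0' : 0 < c := hc0
  refine ⟨c, hc0', fun b hb => ?_⟩
  have hbp : 0 ≤ b ^ (p - 1) := Real.rpow_nonneg hb _
  rcases le_total c (η * b) with h | h
  · have : (b + c) ^ (p - 1) ≤ (1 + η) ^ (p - 1) * b ^ (p - 1) := by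
      rw [← Real.mul_rpow (by positivity) hb]
      exact Real.rpow_le_rpow (by positivity) (by linarith) hp1.le
    nlinarith [mul_le_mul_of_nonneg_left this hα]
  · have hbc : b ≤ c * (1 / η) := by rw [mul_one_div, le_div_iff₀ hη0']; linarith
    have : (b + c) ^ (p - 1) ≤ (c * (1 / η + 1)) ^ (p - 1) :=
      Real.rpow_le_rpow (by positivity) (by linarith) hp1.le
    nlinarith [mul_le_mul_of_nonneg_left this hα, mul_nonneg (hα.trans hα'.le) hbp]

/-- Solvability persists slightly beyond `t` when it holds for a larger parameter. -/
theorem IsRegularSolution.exists_gt {α' : ℝ} (hp : 1 < p) (hα : 0 ≤ α) (hα' : α < α') {u : ℝ → ℝ}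
    (h : IsRegularSolution p α' t u) (h0 : ∀ x, 0 ≤ u x) :
    ∃ r, t < r ∧ ∃ v, IsRegularSolution p α r v ∧ ∀ x, 0 ≤ v x := by
  have hp1 : 0 < p - 1 := sub_pos.2 hp
  have hα0 : 0 ≤ α' := hα.trans hα'.le
  obtain ⟨c, hc, hcb⟩ := exists_add_rpow_le hp hα hα'
  have hsl := continuous_torsionSlope (α := α') hp h.memLp
  have hsl0 := torsionSlope_nonneg (p := p) hα0 h0
  have hint : ∀ a b : ℝ, IntervalIntegrable (torsionSlope p α' u) volume a b := fun a b =>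
    hsl.intervalIntegrable a b
  have hlim : Tendsto (fun r => ∫ y in t..r, torsionSlope p α' u y) (𝓝[>] t) (𝓝 0) := by
    have hc := intervalIntegral.continuous_primitive hint t
    have := hc.tendsto t
    rw [intervalIntegral.integral_same] at this
    exact this.mono_left nhdsWithin_le_nhds
  -- The new end point is so close that integrating the old slope from `t` to `r` adds less than
  -- `c`. Solving up to `r` with the source of `u` therefore yields at most `u + c`.
  obtain ⟨r, hrc, hr⟩ := ((hlim.eventually (gt_mem_nhds hc)).and self_mem_nhdsWithin).exists
  have hr' : t < r := hr
  set e : ℝ := ∫ y in t..r, torsionSlope p α' u y with he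
  have he0 : 0 ≤ e := intervalIntegral.integral_nonneg hr'.le fun y _ => hsl0 y
  have hS : ∀ x, eSolve p r (eSource p α' fun y => ENNReal.ofReal (u y)) x ≤
      ENNReal.ofReal (u x + c) := fun x => by
    unfold eSolve
    simp_rw [eSlope_eSource_ofReal hp hα0 h.memLp h0]
    rw [← ofReal_integral_eq_lintegral_ofReal (hsl.integrableOn_Icc.mono_set Ioo_subset_Icc_self)
      (Eventually.of_forall hsl0)]
    refine ENNReal.ofReal_le_ofReal ?_
    rw [← integral_Ioc_eq_integral_Ioo]
    rcases le_total x t with hx | hx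
    · rw [← intervalIntegral.integral_of_le (hx.trans hr'.le),
        ← intervalIntegral.integral_add_adjacent_intervals (hint x t) (hint t r), ← h.eq_integral x hx]
      linarith
    · have : ∫ y in Ioc x r, torsionSlope p α' u y ≤ e := by
        rw [he, intervalIntegral.integral_of_le hr'.le]
        exact setIntegral_mono_set (hsl.integrableOn_Icc.mono_set Ioc_subset_Icc_self)
          (Eventually.of_forall hsl0) (Ioc_subset_Ioc_left hx).eventuallyLE
      linarith [h0 x]
  -- Scaling by `m` doubles the source, because `m^{p-1} = 2`. From `α (u + c)^{p-1} ≤ α' u^{p-1} +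
  -- 1/2` one gets `α (m (u + c))^{p-1} + 1 ≤ 2 (α' u^{p-1} + 1)`, so `m (u + c)` is a supersolution
  -- on the longer half-line; the `1/2` in `exists_add_rpow_le` is fitted to this.
  set m : ℝ := 2 ^ (1 / (p - 1)) with hm
  have hm0 : 0 < m := by positivity
  have hmp : m ^ (p - 1) = 2 := by
    rw [hm, ← Real.rpow_mul (by norm_num), one_div_mul_cancel hp1.ne', Real.rpow_one]
  have hw0 : ∀ x, 0 ≤ m * (u x + c) := fun x => by have := h0 x; positivity
  obtain ⟨v, hv, hv0, -⟩ := exists_isRegularSolution_of_supersolution (w := fun x => m * (u x + c))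
    hp hα le_rfl ((h.memLp.add (memLp_const c)).const_mul m) hw0 (t := r) fun x => by
      have hsrc : ∀ y, eSource p α (fun y => ENNReal.ofReal (m * (u y + c))) y ≤
          ENNReal.ofReal 2 * eSource p α' (fun y => ENNReal.ofReal (u y)) y := fun y => by
        rw [eSource_ofReal hp hα hw0, eSource_ofReal hp hα0 h0, ← ENNReal.ofReal_mul zero_le_two,
          oddPow_of_nonneg hp (hw0 y), oddPow_of_nonneg hp (h0 y),
          Real.mul_rpow hm0.le (by have := h0 y; positivity), hmp]
        refine ENNReal.ofReal_le_ofReal ?_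
        linarith [hcb (u y) (h0 y)]
      calc eSolve p r (eSource p α fun y => ENNReal.ofReal (m * (u y + c))) x
          ≤ eSolve p r (fun y => ENNReal.ofReal 2 *
              eSource p α' (fun y => ENNReal.ofReal (u y)) y) x :=
            eSolve_mono hp le_rfl (fun y _ => hsrc y) x
        _ = ENNReal.ofReal m * eSolve p r (eSource p α' fun y => ENNReal.ofReal (u y)) x := by
            rw [eSolve_const_mul hp ENNReal.ofReal_ne_top, ENNReal.ofReal_rpow_of_pos two_pos]
        _ ≤ ENNReal.ofReal (m * (u x + c)) := by
            rw [ENNReal.ofReal_mul hm0.le]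
            gcongr
            exact hS x
  exact ⟨r, hr', v, hv, hv0⟩

/-- Comparison of nonnegative solutions for `0 ≤ α`. -/
theorem IsRegularSolution.le_of_nonneg (hp : 1 < p) (hα : 0 ≤ α) {s : ℝ} (hst : s ≤ t)
    {u w : ℝ → ℝ} (hu : IsRegularSolution p α s u) (hu0 : ∀ x, 0 ≤ u x)
    (hw : IsRegularSolution p α t w) (hw0 : ∀ x, 0 ≤ w x) (x : ℝ) : u x ≤ w x := by
  -- The larger solution is a supersolution for the smaller half-line. Iteration below it gives a
  -- nonnegative solution there, which uniqueness identifies with `u`.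
  obtain ⟨u', hu', hu0', hle⟩ := hw.exists_le hp hα hst hw0
  rw [hu'.unique hp hu0' hu hu0]
  exact hle x

end IterationBounds

/-! ### The direct method for negative `α` -/

section DirectMethod

variable {Ω : Type*} [MeasurableSpace Ω] {μ : Measure Ω} {p : ℝ}

/-- For `|ε| < 1` the derivative is dominated by `p (|f| + |g|)^p`. It is used for the
Euler-Lagrange equation and, with `g = 1`, for shifting the competitor by a constant. -/
theorem hasDerivAt_integral_abs_add_rpow (hp : 1 < p) {f g : Ω → ℝ}
    (hf : MemLp f (ENNReal.ofReal p) μ) (hg : MemLp g (ENNReal.ofReal p) μ) :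
    HasDerivAt (fun ε : ℝ => ∫ x, |f x + ε * g x| ^ p ∂μ) (p * ∫ x, oddPow p (f x) * g x ∂μ) 0 := by
  have hp0 : 0 < p := by linarith
  have hp1 : 0 < p - 1 := sub_pos.2 hp
  have hfg : ∀ ε : ℝ, MemLp (fun x => f x + ε * g x) (ENNReal.ofReal p) μ := fun ε =>
    hf.add (hg.const_mul ε)
  have hi : ∀ ε : ℝ, Integrable (fun x => |f x + ε * g x| ^ p) μ := fun ε =>
    (hfg ε).integrable_norm_rpow_ofReal hp
  have hb : Integrable (fun x => p * (|f x| + |g x|) ^ p) μ := by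
    have := ((hf.abs.add hg.abs).integrable_norm_rpow_ofReal hp).const_mul p
    refine this.congr (Eventually.of_forall fun x => ?_)
    simp only [Pi.add_apply, Real.norm_eq_abs]
    rw [abs_of_nonneg (a := |f| x + |g| x) (by simp only [Pi.abs_apply]; positivity)]
    rfl
  have hd : ∀ x ε, HasDerivAt (fun ε : ℝ => |f x + ε * g x| ^ p)
      (p * oddPow p (f x + ε * g x) * g x) ε := fun x ε => by
    have h1 : HasDerivAt (fun ε : ℝ => f x + ε * g x) (g x) ε := by
      simpa using ((hasDerivAt_id ε).mul_const (g x)).const_add (f x)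
    exact (hasDerivAt_abs_rpow_oddPow hp (f x + ε * g x)).comp ε h1
  have hmain := (hasDerivAt_integral_of_dominated_loc_of_deriv_le (x₀ := (0 : ℝ))
    (s := Ioo (-1) 1) (F := fun ε x => |f x + ε * g x| ^ p)
    (F' := fun ε x => p * oddPow p (f x + ε * g x) * g x) (Ioo_mem_nhds (by norm_num) one_pos)
    (Eventually.of_forall fun ε => (hi ε).aestronglyMeasurable) (hi 0) ?_
    (Eventually.of_forall fun x ε hε => ?_) hb (Eventually.of_forall fun x ε _ => hd x ε)).2
  · have he : p * ∫ x, oddPow p (f x) * g x ∂μ =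
        ∫ x, p * oddPow p (f x + 0 * g x) * g x ∂μ := by
      rw [← integral_const_mul]
      simp only [zero_mul, add_zero, mul_assoc]
    rw [he]
    exact hmain
  · have := (((continuous_oddPow hp).comp_aestronglyMeasurable
      (hfg 0).aestronglyMeasurable).const_mul p).mul hg.aestronglyMeasurable
    exact this
  · have h1 : |f x + ε * g x| ≤ |f x| + |g x| := by
      refine (abs_add_le _ _).trans (add_le_add le_rfl ?_)
      rw [abs_mul]
      exact mul_le_of_le_one_left (abs_nonneg _) (abs_le.2 ⟨hε.1.le, hε.2.le⟩)
    have h0 : 0 ≤ |f x| + |g x| := by positivity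
    rw [Real.norm_eq_abs, abs_mul, abs_mul, abs_oddPow hp, abs_of_pos hp0, mul_assoc]
    refine mul_le_mul_of_nonneg_left ?_ hp0.le
    calc |f x + ε * g x| ^ (p - 1) * |g x|
        ≤ (|f x| + |g x|) ^ (p - 1) * (|f x| + |g x|) := by
          gcongr
          exact le_add_of_nonneg_left (abs_nonneg _)
      _ = (|f x| + |g x|) ^ p := by
          rcases h0.eq_or_lt with h | h
          · rw [← h, mul_zero, Real.zero_rpow hp0.ne']
          · rw [← Real.rpow_add_one h.ne', sub_add_cancel]

theorem exists_memLp_limit (hp : 1 < p) {f : ℕ → Ω → ℝ} (hf : ∀ n, MemLp (f n) (ENNReal.ofReal p) μ)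
    (hc : ∀ ε > 0, ∃ N, ∀ n ≥ N, ∀ m ≥ N, ∫ x, |f n x - f m x| ^ p ∂μ ≤ ε) :
    ∃ g, MemLp g (ENNReal.ofReal p) μ ∧
      Tendsto (fun n => eLpNorm (fun x => g x - f n x) (ENNReal.ofReal p) μ) atTop (𝓝 0) := by
  have hp0 : 0 < p := by linarith
  have : Fact (1 ≤ ENNReal.ofReal p) := ⟨by simpa using hp.le⟩
  have hcs : CauchySeq fun n => (hf n).toLp (f n) := by
    rw [Metric.cauchySeq_iff]
    intro ε hε
    obtain ⟨N, hN⟩ := hc ((ε / 2) ^ p) (by positivity)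
    refine ⟨N, fun n hn m hm => ?_⟩
    have h1 := hN n hn m hm
    have h2 := integral_norm_rpow_eq_eLpNorm hp ((hf n).sub (hf m)).1
    simp only [Pi.sub_apply, Real.norm_eq_abs] at h2
    rw [h2] at h1
    rw [dist_edist, Lp.edist_toLp_toLp]
    have h3 := (Real.rpow_le_rpow_iff ENNReal.toReal_nonneg (by positivity) hp0).1 h1
    linarith
  obtain ⟨g, hg⟩ := cauchySeq_tendsto_of_complete hcs
  refine ⟨g, Lp.memLp g, ?_⟩
  rw [tendsto_iff_edist_tendsto_0] at hg
  refine hg.congr fun n => ?_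
  rw [edist_comm, Lp.edist_def]
  refine eLpNorm_congr_ae ?_
  filter_upwards [(hf n).coeFn_toLp] with x hx
  simp [hx]

theorem midpoint_deficit_integrable (hp : 1 < p) {f g : Ω → ℝ} (hf : MemLp f (ENNReal.ofReal p) μ)
    (hg : MemLp g (ENNReal.ofReal p) μ) :
    Integrable (fun x => (|f x| ^ p + |g x| ^ p) / 2 - |(f x + g x) / 2| ^ p) μ := by
  have h1 : Integrable (fun x => |(f x + g x) / 2| ^ p) μ := by
    have := ((hf.add hg).const_mul (1 / 2)).integrable_norm_rpow_ofReal hp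
    refine this.congr (Eventually.of_forall fun x => ?_)
    simp only [Pi.add_apply, Real.norm_eq_abs]
    congr 2
    ring
  exact (((hf.integrable_norm_rpow_ofReal hp).add (hg.integrable_norm_rpow_ofReal hp)).div_const
    2).sub h1

/-- Sequences with vanishing convexity deficit converge in `L^p`. -/
theorem exists_memLp_limit_of_midpoint (hp : 1 < p) {f : ℕ → Ω → ℝ}
    (hf : ∀ n, MemLp (f n) (ENNReal.ofReal p) μ) {M : ℝ} (hM : ∀ n, ∫ x, |f n x| ^ p ∂μ ≤ M)
    {e : ℕ → ℝ} (he : Tendsto e atTop (𝓝 0))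
    (hD : ∀ n m, ∫ x, ((|f n x| ^ p + |f m x| ^ p) / 2 - |(f n x + f m x) / 2| ^ p) ∂μ ≤
      e n + e m) :
    ∃ g, MemLp g (ENNReal.ofReal p) μ ∧
      Tendsto (fun n => eLpNorm (fun x => g x - f n x) (ENNReal.ofReal p) μ) atTop (𝓝 0) := by
  refine exists_memLp_limit hp hf fun ε hε => ?_
  have hM0 : 0 ≤ M := (integral_nonneg fun x => Real.rpow_nonneg (abs_nonneg _) _).trans (hM 0)
  -- The tolerance is tuned so that the norm term contributes at most `ε / 2` given the bound `M`.
  -- The constant `C` it produces then determines how small the deficits must be for the other half.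
  obtain ⟨C, hC0, hC⟩ := uniform_convexity_abs_rpow hp (ε := ε / (4 * (M + 1))) (by positivity)
  obtain ⟨N, hN⟩ := (Metric.tendsto_atTop.1 he) (ε / (4 * (C + 1))) (by positivity)
  refine ⟨N, fun n hn m hm => ?_⟩
  have hen : ∀ k ≥ N, e k ≤ ε / (4 * (C + 1)) := fun k hk => by
    have := hN k hk
    rw [Real.dist_eq, sub_zero] at this
    exact (le_abs_self _).trans this.le
  have hi := fun k => (hf k).integrable_norm_rpow_ofReal hp
  simp_rw [Real.norm_eq_abs] at hi
  have hdi := midpoint_deficit_integrable hp (hf n) (hf m)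
  have hsum : Integrable (fun x => |f n x| ^ p + |f m x| ^ p) μ := (hi n).add (hi m)
  calc ∫ x, |f n x - f m x| ^ p ∂μ
      ≤ ∫ x, (ε / (4 * (M + 1)) * (|f n x| ^ p + |f m x| ^ p) +
        C * ((|f n x| ^ p + |f m x| ^ p) / 2 - |(f n x + f m x) / 2| ^ p)) ∂μ :=
        integral_mono (((hf n).sub (hf m)).integrable_norm_rpow_ofReal hp)
          ((hsum.const_mul _).add (hdi.const_mul _)) fun x => hC _ _
    _ = ε / (4 * (M + 1)) * (∫ x, |f n x| ^ p ∂μ + ∫ x, |f m x| ^ p ∂μ) +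
        C * ∫ x, ((|f n x| ^ p + |f m x| ^ p) / 2 - |(f n x + f m x) / 2| ^ p) ∂μ := by
        rw [integral_add (hsum.const_mul _) (hdi.const_mul _), integral_const_mul,
          integral_const_mul, integral_add (hi n) (hi m)]
    _ ≤ ε / (4 * (M + 1)) * (M + M) + C * (ε / (4 * (C + 1)) + ε / (4 * (C + 1))) := by
        have := hD n m
        have h1 := hen n hn
        have h2 := hen m hm
        gcongr
        · exact hM n
        · exact hM m
        · linarith
    _ ≤ ε := by
        have h1 : ε / (4 * (M + 1)) * (M + M) ≤ ε / 2 := by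
          rw [div_mul_eq_mul_div, div_le_div_iff₀ (by positivity) (by norm_num)]
          nlinarith
        have h2 : C * (ε / (4 * (C + 1)) + ε / (4 * (C + 1))) ≤ ε / 2 := by
          rw [← two_mul, ← mul_assoc, mul_div_assoc', div_le_div_iff₀ (by positivity) (by norm_num)]
          nlinarith
        linarith

end DirectMethod

/-! ### Maximizers and comparison for nonpositive `α`, and solvability near an end point -/

section NegativeParameter

variable {p α t : ℝ}

theorem MemGaussSobolevZero.add_mul (hp : 1 < p) {u G ψ Ψ : ℝ → ℝ}
    (hu : MemGaussSobolevZero p (Iio t) u G) (hψ : MemGaussSobolevZero p (Iio t) ψ Ψ) (ε : ℝ) :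
    MemGaussSobolevZero p (Iio t) (fun x => u x + ε * ψ x) (fun x => G x + ε * Ψ x) := by
  refine memGaussSobolevZero_of_ae_eq hp (hu.1.2.1.add (hψ.1.2.1.const_mul ε))
    (hu.1.2.2.add (hψ.1.2.2.const_mul ε)) ?_
  filter_upwards [hu.ae_eq_neg_integral hp, hψ.ae_eq_neg_integral hp,
    ae_restrict_mem measurableSet_Iio] with x h1 h2 hx
  have hx' : x ≤ t := le_of_lt hx
  rw [intervalIntegral.integral_add (hu.1.2.2.intervalIntegrable_of_gauss hp hx' le_rfl)
    ((hψ.1.2.2.intervalIntegrable_of_gauss hp hx' le_rfl).const_mul ε),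
    intervalIntegral.integral_const_mul, h1, h2]
  ring

theorem IsTestFunction.midpoint {Ω : Set ℝ} {w z : ℝ → ℝ} (hw : IsTestFunction Ω w)
    (hz : IsTestFunction Ω z) : IsTestFunction Ω fun x => (w x + z x) / 2 := by
  refine ⟨(hw.1.add hz.1).div_const 2, ?_, ?_⟩
  · have := (hw.2.1.add hz.2.1).mul_right (f' := fun _ => (2 : ℝ)⁻¹)
    exact this
  · refine (closure_mono (fun x hx => ?_)).trans
      ((closure_union (s := Function.support w) (t := Function.support z)).subset.trans
        (union_subset hw.2.2 hz.2.2))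
    by_contra hcon
    simp only [mem_union, Function.mem_support, not_or, not_not] at hcon
    simp [hcon.1, hcon.2] at hx

/-- A maximizer of the functional is a weak solution. -/
theorem isGenTorsionFunction_of_forall_le (hp : 1 < p) {u G : ℝ → ℝ}
    (hu : MemGaussSobolevZero p (Iio t) u G)
    (hmax : ∀ ψ Ψ : ℝ → ℝ, MemGaussSobolevZero p (Iio t) ψ Ψ →
      torsionFunctional p α (Iio t) ψ Ψ ≤ torsionFunctional p α (Iio t) u G) :
    IsGenTorsionFunction p α (Iio t) u := by
  refine ⟨G, hu, fun ψ Ψ hψ => ?_⟩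
  have hp1 : 1 ≤ ENNReal.ofReal p := by simpa using hp.le
  have d1 := hasDerivAt_integral_abs_add_rpow hp hu.1.2.2 hψ.1.2.2
  have d2 := hasDerivAt_integral_abs_add_rpow hp hu.1.2.1 hψ.1.2.1
  have d3 : HasDerivAt (fun ε : ℝ => ∫ x in Iio t, (u x + ε * ψ x) ∂(gaussMeasure ℝ))
      (∫ x in Iio t, ψ x ∂(gaussMeasure ℝ)) 0 := by
    have : (fun ε : ℝ => ∫ x in Iio t, (u x + ε * ψ x) ∂(gaussMeasure ℝ)) = fun ε =>
        (∫ x in Iio t, u x ∂(gaussMeasure ℝ)) + ε * ∫ x in Iio t, ψ x ∂(gaussMeasure ℝ) := by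
      funext ε
      rw [integral_add (hu.1.2.1.integrable hp1) ((hψ.1.2.1.integrable hp1).const_mul ε),
        integral_const_mul]
    rw [this]
    simpa using ((hasDerivAt_id (0 : ℝ)).mul_const
      (∫ x in Iio t, ψ x ∂(gaussMeasure ℝ))).const_add (∫ x in Iio t, u x ∂(gaussMeasure ℝ))
  have hd := (d1.neg.add (d2.const_mul α)).add (d3.const_mul p)
  have hloc : IsLocalMax (fun ε : ℝ => torsionFunctional p α (Iio t) (fun x => u x + ε * ψ x)
      (fun x => G x + ε * Ψ x)) 0 := Eventually.of_forall fun ε => by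
    simpa using hmax _ _ (hu.add_mul hp hψ ε)
  have h0 := hloc.hasDerivAt_eq_zero hd
  have e1 : ∫ x in Iio t, ‖G x‖ ^ (p - 2) * inner ℝ (G x) (Ψ x) ∂(gaussMeasure ℝ) =
      ∫ x in Iio t, oddPow p (G x) * Ψ x ∂(gaussMeasure ℝ) := by
    refine integral_congr_ae (Eventually.of_forall fun x => ?_)
    simp only [inner, RCLike.re_to_real, star_trivial, Real.norm_eq_abs, oddPow]
    ring
  rw [e1]
  change _ = α * (∫ x in Iio t, oddPow p (u x) * ψ x ∂(gaussMeasure ℝ)) + _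
  have hp0 : p ≠ 0 := by linarith
  refine mul_left_cancel₀ hp0 ?_
  linarith

/-- Existence of a maximizer for negative `α`. -/
theorem exists_maximizer (hp : 1 < p) (hα : α < 0) : ∃ u G : ℝ → ℝ,
    MemGaussSobolevZero p (Iio t) u G ∧ ∀ ψ Ψ : ℝ → ℝ, MemGaussSobolevZero p (Iio t) ψ Ψ →
      torsionFunctional p α (Iio t) ψ Ψ ≤ torsionFunctional p α (Iio t) u G := by
  set μ := (gaussMeasure ℝ).restrict (Iio t) with hμ
  have hp1 : 1 ≤ ENNReal.ofReal p := by simpa using hp.le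
  have hp0 : 0 < p := by linarith
  have hL1 := fun {w : ℝ → ℝ} (hw : IsTestFunction (Iio t) w) => (hw.memGaussSobolev p).2.1
  have hL2 := fun {w : ℝ → ℝ} (hw : IsTestFunction (Iio t) w) => (hw.memGaussSobolev p).2.2
  have hF : ∀ w : ℝ → ℝ, torsionFunctional p α (Iio t) w (gradient w) =
      -(∫ x, |gradient w x| ^ p ∂μ) + α * (∫ x, |w x| ^ p ∂μ) + p * ∫ x, w x ∂μ := fun w => rfl
  -- Half of the coercive term `-α ∫ |w|^p` absorbs the linear term; the other half remains to bound
  -- the minimizing data in `L^p`.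
  obtain ⟨K, hK0, hK⟩ := exists_le_mul_rpow_add hp (ε := -α / 2 / p) (by
    have : 0 < -α / 2 := by linarith
    positivity)
  have hcoer : ∀ w, IsTestFunction (Iio t) w →
      p * ∫ x, w x ∂μ ≤ -α / 2 * (∫ x, |w x| ^ p ∂μ) + p * K := fun w hw => by
    have hi : Integrable (fun x => |w x| ^ p) μ := (hL1 hw).integrable_norm_rpow_ofReal hp
    have h1 : ∫ x, w x ∂μ ≤ -α / 2 / p * (∫ x, |w x| ^ p ∂μ) + K := by
      calc ∫ x, w x ∂μ ≤ ∫ x, (-α / 2 / p * |w x| ^ p + K) ∂μ :=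
            integral_mono ((hL1 hw).integrable hp1) ((hi.const_mul _).add (integrable_const _))
              fun x => (le_abs_self _).trans (hK _ (abs_nonneg _))
        _ ≤ _ := by
            rw [integral_add (hi.const_mul _) (integrable_const _), integral_const_mul,
              integral_const, smul_eq_mul]
            have : μ.real univ ≤ 1 := by
              rw [hμ, measureReal_restrict_apply_univ]
              exact measureReal_le_one
            nlinarith
    calc p * ∫ x, w x ∂μ ≤ p * (-α / 2 / p * (∫ x, |w x| ^ p ∂μ) + K) := by gcongr
      _ = _ := by field_simp
  have hn1 : ∀ f : ℝ → ℝ, 0 ≤ ∫ x, |f x| ^ p ∂μ := fun f =>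
    integral_nonneg fun x => Real.rpow_nonneg (abs_nonneg _) _
  set A : Set ℝ := {r | ∃ w, IsTestFunction (Iio t) w ∧
    r = torsionFunctional p α (Iio t) w (gradient w)} with hA
  have hAb : BddAbove A := ⟨p * K, by
    rintro _ ⟨w, hw, rfl⟩
    rw [hF]
    nlinarith [hcoer w hw, hn1 w, hn1 (gradient w)]⟩
  have hAne : A.Nonempty := ⟨_, _, isTestFunction_zero, rfl⟩
  set S := sSup A with hS
  have hle : ∀ w, IsTestFunction (Iio t) w → torsionFunctional p α (Iio t) w (gradient w) ≤ S :=
    fun w hw => le_csSup hAb ⟨w, hw, rfl⟩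
  have hex : ∀ n : ℕ, ∃ w, IsTestFunction (Iio t) w ∧
      S - 1 / ((n : ℝ) + 1) < torsionFunctional p α (Iio t) w (gradient w) := fun n => by
    obtain ⟨_, ⟨w, hw, rfl⟩, h⟩ := exists_lt_of_lt_csSup hAne
      (show S - 1 / ((n : ℝ) + 1) < S by have : 0 < 1 / ((n : ℝ) + 1) := by positivity
                                         linarith)
    exact ⟨w, hw, h⟩
  choose w hw hwS using hex
  have hone : ∀ n : ℕ, 1 / ((n : ℝ) + 1) ≤ 1 := fun n => by
    rw [div_le_one (by positivity)]
    have : (0 : ℝ) ≤ n := Nat.cast_nonneg n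
    linarith
  have hbound : ∀ n, (∫ x, |gradient (w n) x| ^ p ∂μ) + -α / 2 * (∫ x, |w n x| ^ p ∂μ) ≤
      1 - S + p * K := fun n => by
    have h1 := hwS n
    rw [hF] at h1
    linarith [hcoer (w n) (hw n), hone n]
  set e : ℕ → ℝ := fun n => 1 / ((n : ℝ) + 1) with he
  have he0 : Tendsto e atTop (𝓝 0) := tendsto_one_div_add_atTop_nhds_zero_nat
  have hdef : ∀ a b : ℝ, 0 ≤ (|a| ^ p + |b| ^ p) / 2 - |(a + b) / 2| ^ p := fun a b => by
    have := (strictConvexOn_abs_rpow hp).convexOn.2 (mem_univ a) (mem_univ b)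
      (by norm_num : (0 : ℝ) ≤ 1 / 2) (by norm_num : (0 : ℝ) ≤ 1 / 2) (by norm_num)
    simp only [smul_eq_mul] at this
    rw [show (1 / 2 * a + 1 / 2 * b : ℝ) = (a + b) / 2 by ring] at this
    linarith
  have hsplit : ∀ {f g : ℝ → ℝ}, MemLp f (ENNReal.ofReal p) μ → MemLp g (ENNReal.ofReal p) μ →
      ∫ x, ((|f x| ^ p + |g x| ^ p) / 2 - |(f x + g x) / 2| ^ p) ∂μ =
        ((∫ x, |f x| ^ p ∂μ) + ∫ x, |g x| ^ p ∂μ) / 2 - ∫ x, |(f x + g x) / 2| ^ p ∂μ := by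
    intro f g hf hg
    have hi : Integrable (fun x => (|f x| ^ p + |g x| ^ p) / 2) μ :=
      ((hf.integrable_norm_rpow_ofReal hp).add (hg.integrable_norm_rpow_ofReal hp)).div_const 2
    have h2 : Integrable (fun x => |(f x + g x) / 2| ^ p) μ := by
      have := hi.sub (midpoint_deficit_integrable hp hf hg)
      refine this.congr (Eventually.of_forall fun x => ?_)
      simp
    rw [integral_sub hi h2]
    congr 1
    rw [integral_div]
    congr 1
    exact integral_add (hf.integrable_norm_rpow_ofReal hp) (hg.integrable_norm_rpow_ofReal hp)
  -- Midpoints are admissible, so their functional is at most `S`, while both end points nearly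
  -- attain `S`. The linear terms cancel, leaving the convexity deficits of gradients and values;
  -- both enter with nonnegative coefficients because `α < 0`, so each is controlled separately.
  have hmid : ∀ n m,
      (∫ x, ((|gradient (w n) x| ^ p + |gradient (w m) x| ^ p) / 2 -
        |(gradient (w n) x + gradient (w m) x) / 2| ^ p) ∂μ) +
      -α * (∫ x, ((|w n x| ^ p + |w m x| ^ p) / 2 - |(w n x + w m x) / 2| ^ p) ∂μ) ≤
        (e n + e m) / 2 := fun n m => by
    have h1 := hle _ ((hw n).midpoint (hw m))
    have hg : gradient (fun x => (w n x + w m x) / 2) =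
        fun x => (gradient (w n) x + gradient (w m) x) / 2 := by
      funext x
      simp only [gradient_real]
      rw [deriv_div_const, deriv_fun_add (hw n).differentiable.differentiableAt
        (hw m).differentiable.differentiableAt]
    have hint : ∫ x, (w n x + w m x) / 2 ∂μ = ((∫ x, w n x ∂μ) + ∫ x, w m x ∂μ) / 2 := by
      rw [integral_div, integral_add ((hL1 (hw n)).integrable hp1) ((hL1 (hw m)).integrable hp1)]
    rw [hF, hg, hint] at h1
    rw [hsplit (hL1 (hw n)) (hL1 (hw m)), hsplit (hL2 (hw n)) (hL2 (hw m))]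
    have h2 := hwS n
    have h3 := hwS m
    rw [hF] at h2 h3
    simp only [he]
    nlinarith
  have hd1 : ∀ n m, 0 ≤ ∫ x, ((|gradient (w n) x| ^ p + |gradient (w m) x| ^ p) / 2 -
        |(gradient (w n) x + gradient (w m) x) / 2| ^ p) ∂μ := fun n m =>
    integral_nonneg fun x => hdef _ _
  have hd2 : ∀ n m, 0 ≤ ∫ x, ((|w n x| ^ p + |w m x| ^ p) / 2 - |(w n x + w m x) / 2| ^ p) ∂μ :=
    fun n m => integral_nonneg fun x => hdef _ _
  have he1 : ∀ n, 0 ≤ e n := fun n => by simp only [he]; positivity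
  obtain ⟨G, hG, hGlim⟩ := exists_memLp_limit_of_midpoint hp (fun n => hL2 (hw n))
    (M := 1 - S + p * K) (fun n => by nlinarith [hbound n, hn1 (w n)]) he0 fun n m => by
      nlinarith [hmid n m, hd2 n m, he1 n, he1 m]
  obtain ⟨u, hu, hulim⟩ := exists_memLp_limit_of_midpoint hp (fun n => hL1 (hw n))
    (M := (1 - S + p * K) / (-α / 2)) (fun n => by
      rw [le_div_iff₀ (by linarith)]
      nlinarith [hbound n, hn1 (gradient (w n))])
    (e := fun n => e n / -α) (by simpa using he0.div_const (-α)) fun n m => by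
      rw [← add_div, le_div_iff₀ (by linarith)]
      nlinarith [hmid n m, hd1 n m, he1 n, he1 m]
  have hmem : MemGaussSobolevZero p (Iio t) u G := memGaussSobolevZero_of_ae_eq hp hu hG
    (ae_eq_neg_integral_of_tendsto hp hu.1 hG hw hulim hGlim)
  have hFu : S ≤ torsionFunctional p α (Iio t) u G := by
    have a1 := tendsto_integral_norm_rpow_of_eLpNorm hp hG (fun n => hL2 (hw n)) hGlim
    have a2 := tendsto_integral_norm_rpow_of_eLpNorm hp hu (fun n => hL1 (hw n)) hulim
    have a3 := tendsto_integral_of_eLpNorm hp hu (fun n => hL1 (hw n)) hulim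
    have a4 := (a1.neg.add (a2.const_mul α)).add (a3.const_mul p)
    have a5 : Tendsto (fun n => S - e n) atTop (𝓝 (S - 0)) := he0.const_sub S
    rw [sub_zero] at a5
    exact le_of_tendsto_of_tendsto' a5 a4 fun n => (hwS n).le
  refine ⟨u, G, hmem, fun ψ Ψ hψ => ?_⟩
  obtain ⟨z, hz, -, -, -, hlim⟩ := hψ.exists_seq_tendsto hp
  exact (le_of_tendsto' (hlim α) fun n => hle _ (hz n)).trans hFu

/-- The trivial Rayleigh constant `0` already exceeds `α`, so the sign follows with no eigenvalue
assumption and for every end point. -/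
theorem exists_isRegularSolution_of_neg (hp : 1 < p) (hα : α < 0) (t : ℝ) :
    ∃ u, IsRegularSolution p α t u ∧ ∀ x, 0 ≤ u x := by
  obtain ⟨u, G, hu, hmax⟩ := exists_maximizer (t := t) hp hα
  obtain ⟨v, hv, -⟩ := (isGenTorsionFunction_of_forall_le hp hu hmax).exists_regular hp
  refine ⟨v, hv, hv.nonneg_of_rayleigh hp hα fun w _ => ?_⟩
  rw [zero_mul]
  exact integral_nonneg fun x => Real.rpow_nonneg (norm_nonneg _) _

/-- Comparison of nonnegative solutions for `α ≤ 0`. -/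
theorem IsRegularSolution.le_of_nonpos (hp : 1 < p) (hα : α ≤ 0) {s : ℝ} (hst : s ≤ t)
    {u w : ℝ → ℝ} (hu : IsRegularSolution p α s u) (hw : IsRegularSolution p α t w)
    (hw0 : ∀ x, 0 ≤ w x) (x : ℝ) : u x ≤ w x := by
  by_contra! hcon
  have hxs : x < s := by
    by_contra! h
    rw [hu.eq_zero x h] at hcon
    exact absurd (hw0 x) (not_le.2 hcon)
  set f : ℝ → ℝ := fun y => u y - w y with hf
  have hfc : Continuous f := (hu.continuous hp).sub (hw.continuous hp)
  have hfd : ∀ y < s, HasDerivAt f (-torsionSlope p α u y - -torsionSlope p α w y) y := fun y hy =>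
    (hu.hasDerivAt hp hy).sub (hw.hasDerivAt hp (hy.trans_le hst))
  have hfx : 0 < f x := by simp only [hf]; linarith
  have hfs : f s ≤ 0 := by simp only [hf, hu.eq_zero s le_rfl]; linarith [hw0 s]
  -- the first zero of `f` to the right of `x`
  obtain ⟨z, hz, hzmin⟩ : ∃ z ∈ Icc x s ∩ {y | f y ≤ 0}, ∀ y ∈ Icc x s ∩ {y | f y ≤ 0}, z ≤ y :=
    (isCompact_Icc.inter_right (isClosed_le hfc continuous_const)).exists_isLeast
      ⟨s, ⟨hxs.le, le_rfl⟩, hfs⟩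
  have hxz : x < z := lt_of_le_of_ne hz.1.1 fun h => by
    have := hz.2; rw [← h] at this; exact absurd hfx (not_lt.2 this)
  -- The difference falls from a positive value to its first zero, so at some `y` it is positive
  -- with negative derivative. In terms of fluxes, that of `u` exceeds that of `w` at `y`.
  obtain ⟨y, hy, hyd⟩ := exists_hasDerivAt_eq_slope f _ hxz hfc.continuousOn
    fun y hy => hfd y (hy.2.trans_le hz.1.2)
  have hys : y < s := hy.2.trans_le hz.1.2
  have hfy : 0 < f y := by
    by_contra! h
    exact absurd (hzmin y ⟨⟨hy.1.le, hys.le⟩, h⟩) (not_le.2 hy.2)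
  have hslope : torsionSlope p α w y < torsionSlope p α u y := by
    have : (f z - f x) / (z - x) < 0 :=
      div_neg_of_neg_of_pos (by have := hz.2; simp only [mem_ofPred_eq] at this; linarith) (by linarith)
    linarith
  have hflux_of : ∀ y, torsionSlope p α w y < torsionSlope p α u y ↔
      torsionFlux p α w y < torsionFlux p α u y := fun y => by
    rw [← (strictMono_oddPow hp).lt_iff_lt, oddPow_torsionSlope hp, oddPow_torsionSlope hp,
      div_lt_div_iff_of_pos_right (gaussDensity_pos y)]
  have hD := (hflux_of y).1 hslope
  have hui := integrable_source hp α hu.memLp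
  have hwi := integrable_source hp α hw.memLp
  have hsrc : ∀ z, 0 < f z → α * oddPow p (u z) + 1 ≤ α * oddPow p (w z) + 1 := fun z hz => by
    have : oddPow p (w z) ≤ oddPow p (u z) :=
      (strictMono_oddPow hp).monotone (by simp only [hf] at hz; linarith)
    nlinarith
  -- the flux difference increases to the left as long as `f` is positive
  have hleft : ∀ a ≤ y, (∀ b ∈ Ioo a y, 0 < f b) → torsionFlux p α w a < torsionFlux p α u a := by
    intro a ha hpos
    have hsplit : ∀ {v : ℝ → ℝ}, Integrable (fun x => α * oddPow p (v x) + 1) (gaussMeasure ℝ) →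
        torsionFlux p α v y = torsionFlux p α v a +
          ∫ x in Ico a y, (α * oddPow p (v x) + 1) ∂(gaussMeasure ℝ) := fun hv => by
      rw [torsionFlux, ← Iio_union_Ico_eq_Iio ha, setIntegral_union
        (disjoint_left.2 fun b (hb : b ∈ Iio a) hb' => not_lt.2 hb'.1 hb) measurableSet_Ico hv.integrableOn
        hv.integrableOn, torsionFlux]
    have hmono : ∫ x in Ico a y, (α * oddPow p (u x) + 1) ∂(gaussMeasure ℝ) ≤
        ∫ x in Ico a y, (α * oddPow p (w x) + 1) ∂(gaussMeasure ℝ) := by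
      rw [integral_Ico_eq_integral_Ioo, integral_Ico_eq_integral_Ioo]
      exact setIntegral_mono_on hui.integrableOn hwi.integrableOn measurableSet_Ioo
        fun b hb => hsrc b (hpos b hb)
    have h1 := hsplit hui
    have h2 := hsplit hwi
    linarith
  -- For `α ≤ 0` a larger solution has a smaller source, so the flux gap does not shrink towards the
  -- left while `f > 0`. It keeps `f` decreasing in `x`, and hence `f` cannot have come up from a
  -- zero on the left of `y`.
  have hall : ∀ b ≤ y, 0 < f b := by
    by_contra! hcon
    obtain ⟨b, hb, hfb⟩ := hcon
    obtain ⟨a, ha, hamax⟩ : ∃ a ∈ Icc b y ∩ {z | f z ≤ 0}, ∀ z ∈ Icc b y ∩ {z | f z ≤ 0}, z ≤ a :=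
      (isCompact_Icc.inter_right (isClosed_le hfc continuous_const)).exists_isGreatest
        ⟨b, ⟨le_rfl, hb⟩, hfb⟩
    have hay : a < y := lt_of_le_of_ne ha.1.2 fun h => by
      have := ha.2; rw [h] at this; exact absurd hfy (not_lt.2 this)
    have hpos : ∀ c ∈ Ioo a y, 0 < f c := fun c hc => by
      by_contra! h
      exact absurd (hamax c ⟨⟨ha.1.1.trans hc.1.le, hc.2.le⟩, h⟩) (not_le.2 hc.1)
    obtain ⟨c, hc, hcd⟩ := exists_hasDerivAt_eq_slope f _ hay hfc.continuousOn
      fun c hc => hfd c (hc.2.trans hys)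
    have h1 := (hflux_of c).2 (hleft c hc.2.le fun b hb => hpos b ⟨hc.1.trans hb.1, hb.2⟩)
    have h2 : 0 < (f y - f a) / (y - a) :=
      div_pos (by have := ha.2; simp only [mem_ofPred_eq] at this; linarith) (by linarith)
    linarith
  -- With `f > 0` on all of `(-∞, y]`, comparing sources from `-∞` gives the opposite inequality
  -- between the fluxes at `y`.
  have : torsionFlux p α u y ≤ torsionFlux p α w y :=
    setIntegral_mono_on hui.integrableOn hwi.integrableOn measurableSet_Iio
      fun b hb => hsrc b (hall b (le_of_lt hb))
  linarith

theorem IsRegularSolution.le (hp : 1 < p) {s : ℝ} (hst : s ≤ t) {u w : ℝ → ℝ}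
    (hu : IsRegularSolution p α s u) (hu0 : ∀ x, 0 ≤ u x)
    (hw : IsRegularSolution p α t w) (hw0 : ∀ x, 0 ≤ w x) (x : ℝ) : u x ≤ w x := by
  rcases le_total 0 α with h | h
  · exact hu.le_of_nonneg hp h hst hu0 hw hw0 x
  · exact hu.le_of_nonpos hp h hst hw hw0 x

/-- Solvability in a neighbourhood of `t`. -/
theorem exists_isRegularSolution_nhds (hp : 1 < p) {lam : ℝ} (hlam : α < lam)
    (hray : ∀ w : ℝ → ℝ, IsTestFunction (Iio t) w →
      lam * ∫ x in Iio t, |w x| ^ p ∂(gaussMeasure ℝ) ≤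
        ∫ x in Iio t, ‖gradient w x‖ ^ p ∂(gaussMeasure ℝ)) :
    ∃ T, t < T ∧ ∀ s ≤ T, ∃ u, IsRegularSolution p α s u ∧ ∀ x, 0 ≤ u x := by
  rcases lt_or_ge α 0 with hα | hα
  · exact ⟨t + 1, by linarith, fun s _ => exists_isRegularSolution_of_neg hp hα s⟩
  -- The spare room between `α` and the Rayleigh constant is spent on moving the end point to the
  -- right; end points further left come from comparison.
  · obtain ⟨α', h1, h2⟩ := exists_between hlam
    obtain ⟨u, hu, hu0⟩ := exists_isRegularSolution hp (hα.trans h1.le) h2 hray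
    obtain ⟨T, hT, v, hv, hv0⟩ := hu.exists_gt hp hα h1 hu0
    refine ⟨T, hT, fun s hs => ?_⟩
    obtain ⟨z, hz, hz0, -⟩ := hv.exists_le hp hα hs hv0
    exact ⟨z, hz, hz0⟩

end NegativeParameter

/-! ### Continuous dependence on the end point -/

section Limits

variable {p α t : ℝ}

/-- The moving end point is put into an indicator, so that dominated convergence can be used on a
fixed interval. -/
theorem IsRegularSolution.eq_setIntegral_indicator {σ T : ℝ} (hσT : σ ≤ T) {u : ℝ → ℝ}
    (h : IsRegularSolution p α σ u) (x : ℝ) :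
    u x = ∫ y in Ioo x T, (Iio σ).indicator (torsionSlope p α u) y := by
  rw [setIntegral_indicator measurableSet_Iio, Ioo_inter_Iio, min_eq_right hσT]
  rcases le_total x σ with hx | hx
  · rw [h.eq_integral x hx, intervalIntegral.integral_of_le hx, integral_Ioc_eq_integral_Ioo]
  · rw [Ioo_eq_empty (not_lt.2 hx), h.eq_zero x hx]; simp

/-- Pointwise dominated limits of nonnegative regular solutions are regular solutions. -/
theorem IsRegularSolution.of_tendsto (hp : 1 < p) {ι : Type*} {l : Filter ι} [l.NeBot]
    [l.IsCountablyGenerated] {σ : ι → ℝ} (hσ : Tendsto σ l (𝓝 t)) {U : ι → ℝ → ℝ}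
    (hU : ∀ i, IsRegularSolution p α (σ i) (U i)) (h0 : ∀ i x, 0 ≤ U i x) {W : ℝ → ℝ}
    (hW : MemLp W (ENNReal.ofReal p) (gaussMeasure ℝ)) (hdom : ∀ i x, U i x ≤ W x) {V : ℝ → ℝ}
    (hlim : ∀ x, Tendsto (fun i => U i x) l (𝓝 (V x))) : IsRegularSolution p α t V := by
  have hp0 : 0 < p := by linarith
  have hq : 0 ≤ p / (p - 1) - 1 := by linarith [one_lt_conj hp]
  have hV0 : ∀ x, 0 ≤ V x := fun x => ge_of_tendsto' (hlim x) fun i => h0 i x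
  have hVW : ∀ x, V x ≤ W x := fun x => le_of_tendsto' (hlim x) fun i => hdom i x
  have hVm : AEStronglyMeasurable V (gaussMeasure ℝ) := aestronglyMeasurable_of_tendsto_ae l
    (fun i => (hU i).memLp.1) (Eventually.of_forall hlim)
  have hVL : MemLp V (ENNReal.ofReal p) (gaussMeasure ℝ) := hW.mono hVm
    (Eventually.of_forall fun x => by
      rw [Real.norm_of_nonneg (hV0 x), Real.norm_of_nonneg ((hV0 x).trans (hVW x))]
      exact hVW x)
  have hJm := (strictMono_oddPow hp).monotone
  have hbi : Integrable (fun x => |α| * oddPow p (W x) + 1) (gaussMeasure ℝ) :=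
    integrable_source hp |α| hW
  have hbd : ∀ i x, ‖α * oddPow p (U i x) + 1‖ ≤ |α| * oddPow p (W x) + 1 := fun i x => by
    refine (norm_add_le _ _).trans ?_
    rw [norm_mul, Real.norm_eq_abs, Real.norm_of_nonneg (oddPow_nonneg (h0 i x)), norm_one]
    gcongr
    exact hJm (hdom i x)
  have hflux : ∀ y, Tendsto (fun i => torsionFlux p α (U i) y) l (𝓝 (torsionFlux p α V y)) :=
    fun y => tendsto_integral_filter_of_dominated_convergence _
      (Eventually.of_forall fun i =>
        (integrable_source hp α (hU i).memLp).integrableOn.aestronglyMeasurable)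
      (Eventually.of_forall fun i => Eventually.of_forall (hbd i)) hbi.integrableOn
      (Eventually.of_forall fun x =>
        ((((continuous_oddPow hp).tendsto _).comp (hlim x)).const_mul α).add_const 1)
  have hslope : ∀ y, Tendsto (fun i => torsionSlope p α (U i) y) l (𝓝 (torsionSlope p α V y)) :=
    fun y => ((continuous_oddPow (one_lt_conj hp)).tendsto _).comp ((hflux y).div_const _)
  -- The dominating function bounds all fluxes by `L`. Since the density is bounded below on `[x,
  -- T]`, the slopes are uniformly bounded there.
  set L := ∫ x, (|α| * oddPow p (W x) + 1) ∂(gaussMeasure ℝ) with hL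
  have hL0 : ∀ x, 0 ≤ |α| * oddPow p (W x) + 1 := fun x => by
    have := oddPow_nonneg (p := p) ((hV0 x).trans (hVW x)); positivity
  have hfluxL : ∀ i y, |torsionFlux p α (U i) y| ≤ L := fun i y => by
    rw [torsionFlux, ← Real.norm_eq_abs]
    refine (norm_integral_le_of_norm_le hbi.integrableOn (Eventually.of_forall (hbd i))).trans ?_
    exact setIntegral_le_integral hbi (Eventually.of_forall hL0)
  set T := t + 1 with hT
  have hσT : ∀ᶠ i in l, σ i ≤ T :=
    (hσ.eventually (gt_mem_nhds (show t < T by linarith))).mono fun i hi => le_of_lt hi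
  have hcont : ∀ i, Continuous (torsionSlope p α (U i)) := fun i =>
    continuous_torsionSlope hp (hU i).memLp
  have hind : ∀ y, y ≠ t → Tendsto (fun i => (Iio (σ i)).indicator (torsionSlope p α (U i)) y) l
      (𝓝 ((Iio t).indicator (torsionSlope p α V) y)) := fun y hy => by
    rcases lt_or_gt_of_ne hy with h | h
    · rw [indicator_of_mem (mem_Iio.2 h)]
      refine (hslope y).congr' ?_
      filter_upwards [hσ.eventually (lt_mem_nhds h)] with i hi
      rw [indicator_of_mem (mem_Iio.2 hi)]
    · rw [indicator_of_notMem (by simpa using h.le)]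
      refine tendsto_const_nhds.congr' ?_
      filter_upwards [hσ.eventually (gt_mem_nhds h)] with i hi
      rw [indicator_of_notMem (by simpa using hi.le)]
  have hVeq : ∀ x, V x = ∫ y in Ioo x T, (Iio t).indicator (torsionSlope p α V) y := fun x => by
    refine tendsto_nhds_unique ((hlim x).congr' (hσT.mono fun i hi =>
      (hU i).eq_setIntegral_indicator hi x)) ?_
    set m := gaussDensity (max |x| |T|) with hm
    have hm0 : 0 < m := gaussDensity_pos _
    refine tendsto_integral_filter_of_dominated_convergence
      (fun _ => (L / m) ^ (p / (p - 1) - 1))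
      (Eventually.of_forall fun i => ((hcont i).aestronglyMeasurable.indicator measurableSet_Iio))
      (Eventually.of_forall fun i => ?_) (integrable_const _)
      ((Measure.ae_ne _ t).mono hind)
    filter_upwards [ae_restrict_mem measurableSet_Ioo] with y hy
    refine (norm_indicator_le_norm_self _ _).trans ?_
    rw [torsionSlope, Real.norm_eq_abs, abs_oddPow (one_lt_conj hp), abs_div,
      abs_of_pos (gaussDensity_pos y)]
    refine Real.rpow_le_rpow (div_nonneg (abs_nonneg _) (gaussDensity_pos y).le) ?_ hq
    exact div_le_div₀ ((abs_nonneg _).trans (hfluxL i y)) (hfluxL i y) hm0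
      (gaussDensity_le_of_mem_Icc ⟨hy.1.le, hy.2.le⟩)
  have hsVc := continuous_torsionSlope (α := α) hp hVL
  refine ⟨fun x hx => ?_, hVL, fun x hx => ?_, ?_⟩
  · rw [hVeq x, setIntegral_indicator measurableSet_Iio, Ioo_inter_Iio,
      Ioo_eq_empty (by simp [hx])]
    simp
  · rw [hVeq x, setIntegral_indicator measurableSet_Iio, Ioo_inter_Iio,
      min_eq_right (by linarith : t ≤ T), intervalIntegral.integral_of_le hx,
      integral_Ioc_eq_integral_Ioo]
  · refine memLp_ofReal_of_lintegral hp hsVc.aestronglyMeasurable ?_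
    set C := |α| * (∫ x, |W x| ^ p ∂(gaussMeasure ℝ)) + ∫ x, W x ∂(gaussMeasure ℝ) with hC
    have hWp : Integrable (fun x => |W x| ^ p) (gaussMeasure ℝ) := hW.integrable_norm_rpow_ofReal hp
    have hWi : Integrable W (gaussMeasure ℝ) := hW.integrable (by simpa using hp.le)
    -- The energy identity bounds the slopes in `L^p` uniformly, and Fatou's lemma transfers the
    -- bound to the limit. The varying indicators converge except possibly at `y = t`.
    have hen : ∀ i, ∫⁻ y, (Iio (σ i)).indicator (fun y => ‖torsionSlope p α (U i) y‖ₑ ^ p) y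
        ∂(gaussMeasure ℝ) ≤ ENNReal.ofReal C := fun i => by
      rw [lintegral_indicator measurableSet_Iio]
      have hint : Integrable (fun y => |torsionSlope p α (U i) y| ^ p)
          ((gaussMeasure ℝ).restrict (Iio (σ i))) := (hU i).memLp_slope.integrable_norm_rpow_ofReal hp
      have e : ∫⁻ y in Iio (σ i), ‖torsionSlope p α (U i) y‖ₑ ^ p ∂(gaussMeasure ℝ) =
          ENNReal.ofReal (∫ y in Iio (σ i), |torsionSlope p α (U i) y| ^ p ∂(gaussMeasure ℝ)) := by
        rw [ofReal_integral_eq_lintegral_ofReal hint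
          (Eventually.of_forall fun y => Real.rpow_nonneg (abs_nonneg _) _)]
        refine lintegral_congr fun y => ?_
        rw [← ENNReal.ofReal_rpow_of_nonneg (abs_nonneg _) hp0.le, ← Real.norm_eq_abs, ofReal_norm]
      rw [e, (hU i).energy hp]
      refine ENNReal.ofReal_le_ofReal ?_
      have hUp : Integrable (fun x => |U i x| ^ p) (gaussMeasure ℝ) :=
        (hU i).memLp.integrable_norm_rpow_ofReal hp
      have hUn : 0 ≤ ∫ x in Iio (σ i), |U i x| ^ p ∂(gaussMeasure ℝ) :=
        integral_nonneg fun x => Real.rpow_nonneg (abs_nonneg _) _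
      have h1 : ∫ x in Iio (σ i), |U i x| ^ p ∂(gaussMeasure ℝ) ≤ ∫ x, |W x| ^ p ∂(gaussMeasure ℝ) :=
        (setIntegral_le_integral hUp (Eventually.of_forall fun x =>
          Real.rpow_nonneg (abs_nonneg _) _)).trans (integral_mono hUp hWp fun x => by
            refine Real.rpow_le_rpow (abs_nonneg _) ?_ hp0.le
            rw [abs_of_nonneg (h0 i x), abs_of_nonneg ((h0 i x).trans (hdom i x))]
            exact hdom i x)
      have h2 : ∫ x in Iio (σ i), U i x ∂(gaussMeasure ℝ) ≤ ∫ x, W x ∂(gaussMeasure ℝ) :=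
        (setIntegral_le_integral ((hU i).integrable hp) (Eventually.of_forall (h0 i))).trans
          (integral_mono ((hU i).integrable hp) hWi (hdom i))
      have h3 : α * (∫ x in Iio (σ i), |U i x| ^ p ∂(gaussMeasure ℝ)) ≤
          |α| * ∫ x, |W x| ^ p ∂(gaussMeasure ℝ) :=
        (mul_le_mul_of_nonneg_right (le_abs_self α) hUn).trans
          (mul_le_mul_of_nonneg_left h1 (abs_nonneg α))
      rw [hC]
      linarith
    have hlimi : ∀ᵐ y ∂(gaussMeasure ℝ), (Iio t).indicator (fun y => ‖torsionSlope p α V y‖ₑ ^ p) y =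
        liminf (fun i => (Iio (σ i)).indicator (fun y => ‖torsionSlope p α (U i) y‖ₑ ^ p) y) l := by
      filter_upwards [Measure.ae_ne _ t] with y hy
      have key : ∀ (s : Set ℝ) (f : ℝ → ℝ), s.indicator (fun y => ‖f y‖ₑ ^ p) y =
          ‖s.indicator f y‖ₑ ^ p := fun s f => by
        by_cases h : y ∈ s <;> simp [h, hp0]
      simp_rw [key]
      exact (((hind y hy).enorm).ennrpow_const p).liminf_eq.symm
    refine ne_top_of_le_ne_top (ENNReal.ofReal_ne_top (r := C)) ?_
    rw [← lintegral_indicator measurableSet_Iio, lintegral_congr_ae hlimi]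
    refine (lintegral_liminf_le fun i => ?_).trans ?_
    · exact ((hcont i).measurable.enorm.pow_const p).indicator measurableSet_Iio
    · exact (liminf_le_liminf (Eventually.of_forall hen)).trans (liminf_const _).le

variable {T : ℝ} {U : ℝ → ℝ → ℝ}

/-- The nonnegative solution depends continuously on the end point. -/
theorem continuousAt_solution (hp : 1 < p) (hU : ∀ s ≤ T, IsRegularSolution p α s (U s))
    (h0 : ∀ s ≤ T, ∀ x, 0 ≤ U s x) (ht : t < T) (x : ℝ) : ContinuousAt (fun s => U s x) t := by
  -- Freezing the family beyond `T` makes it a monotone function of the end point on all of the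
  -- line, dominated by `U T`.
  set U' : ℝ → ℝ → ℝ := fun s => U (min s T) with hU'
  have hreg : ∀ s, IsRegularSolution p α (min s T) (U' s) := fun s => hU _ (min_le_right _ _)
  have hnn : ∀ s x, 0 ≤ U' s x := fun s => h0 _ (min_le_right _ _)
  have hmono : ∀ x, Monotone fun s => U' s x := fun x a b hab =>
    (hreg a).le hp (min_le_min_right T hab) (hnn a) (hreg b) (hnn b) x
  have hdom : ∀ s x, U' s x ≤ U T x := fun s x =>
    (hreg s).le hp (min_le_right _ _) (hnn s) (hU T le_rfl) (h0 T le_rfl) x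
  have hmin : Tendsto (fun s => min s T) (𝓝 t) (𝓝 t) := by
    have := (continuous_id.min (continuous_const (y := T))).tendsto t
    simpa [min_eq_left ht.le] using this
  -- One-sided limits exist by monotonicity. Each of them is again a nonnegative solution for the
  -- end point `t`, and uniqueness makes both equal to `U t`.
  have key : ∀ (l : Filter ℝ) [l.NeBot] [l.IsCountablyGenerated] (V : ℝ → ℝ), l ≤ 𝓝 t →
      (∀ x, Tendsto (fun s => U' s x) l (𝓝 (V x))) → V = U t := fun l _ _ V hl hV => by
    have hr := IsRegularSolution.of_tendsto hp (hmin.mono_left hl) hreg hnn (hU T le_rfl).memLp hdom hV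
    exact (hU t ht.le).unique hp (h0 t ht.le) hr fun x => ge_of_tendsto' (hV x) fun s => hnn s x
  have hleft := key (𝓝[<] t) _ nhdsWithin_le_nhds fun x => (hmono x).tendsto_nhdsLT t
  have hright := key (𝓝[>] t) _ nhdsWithin_le_nhds fun x => (hmono x).tendsto_nhdsGT t
  have hc : ContinuousAt (fun s => U' s x) t := by
    rw [continuousAt_iff_continuous_left'_right']
    have e : U' t x = U t x := by simp only [hU', min_eq_left ht.le]
    constructor
    · have := (hmono x).tendsto_nhdsLT t
      rw [congrFun hleft x, ← e] at this
      exact this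
    · have := (hmono x).tendsto_nhdsGT t
      rw [congrFun hright x, ← e] at this
      exact this
  refine hc.congr ?_
  filter_upwards [gt_mem_nhds ht] with s hs
  simp only [hU', min_eq_left (le_of_lt hs)]

/-- As `f 0 = 0` and solutions vanish beyond their end point, the integral may be taken over the
whole line, with `f (U T)` as dominating function. The cases `f = id` and `f = oddPow p` give
continuity of the rigidity and of the boundary flux. -/
theorem continuousAt_integral_solution (hp : 1 < p)
    (hU : ∀ s ≤ T, IsRegularSolution p α s (U s)) (h0 : ∀ s ≤ T, ∀ x, 0 ≤ U s x) (ht : t < T)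
    {f : ℝ → ℝ} (hf : Continuous f) (hf0 : f 0 = 0) (hmono : Monotone f)
    (hi : Integrable (fun x => f (U T x)) (gaussMeasure ℝ)) :
    ContinuousAt (fun s => ∫ x in Iio s, f (U s x) ∂(gaussMeasure ℝ)) t := by
  have e : ∀ s ≤ T, ∫ x in Iio s, f (U s x) ∂(gaussMeasure ℝ) = ∫ x, f (U s x) ∂(gaussMeasure ℝ) :=
    fun s hs => setIntegral_eq_integral_of_forall_compl_eq_zero fun x hx => by
      rw [(hU s hs).eq_zero x (by simpa using hx), hf0]
  have hlt : ∀ᶠ s in 𝓝 t, s ≤ T := (gt_mem_nhds ht).mono fun s hs => le_of_lt hs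
  have hc : ContinuousAt (fun s => ∫ x, f (U s x) ∂(gaussMeasure ℝ)) t := by
    refine tendsto_integral_filter_of_dominated_convergence (fun x => f (U T x))
      (hlt.mono fun s hs => (hf.comp ((hU s hs).continuous hp)).aestronglyMeasurable)
      (hlt.mono fun s hs => Eventually.of_forall fun x => ?_) hi
      (Eventually.of_forall fun x => (hf.tendsto _).comp (continuousAt_solution hp hU h0 ht x))
    have h1 : 0 ≤ f (U s x) := hf0 ▸ hmono (h0 s hs x)
    rw [Real.norm_of_nonneg h1]
    exact hmono ((hU s hs).le hp hs (h0 s hs) (hU T le_rfl) (h0 T le_rfl) x)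
  exact hc.congr (hlt.mono fun s hs => (e s hs).symm)

theorem continuousAt_torsionSlope_endpoint (hp : 1 < p)
    (hU : ∀ s ≤ T, IsRegularSolution p α s (U s)) (h0 : ∀ s ≤ T, ∀ x, 0 ≤ U s x) (ht : t < T) :
    ContinuousAt (fun s => torsionSlope p α (U s) s) t := by
  have hlt : ∀ᶠ s in 𝓝 t, s ≤ T := (gt_mem_nhds ht).mono fun s hs => le_of_lt hs
  have h1 := continuousAt_integral_solution hp hU h0 ht (continuous_oddPow hp) oddPow_zero
    (strictMono_oddPow hp).monotone (integrable_oddPow hp (hU T le_rfl).memLp)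
  have h2 : Continuous fun s => ∫ _ in Iio s, (1 : ℝ) ∂(gaussMeasure ℝ) :=
    continuous_setIntegral_Iio (integrable_const _)
  have h3 : ContinuousAt (fun s => torsionFlux p α (U s) s) t := by
    refine ((h1.const_smul α).add h2.continuousAt).congr (hlt.mono fun s hs => ?_)
    have hi := integrable_oddPow hp (hU s hs).memLp
    simp only [torsionFlux, Pi.add_apply, Pi.smul_apply, smul_eq_mul]
    rw [integral_add (hi.integrableOn.const_mul α) (integrable_const _), integral_const_mul]
  exact ((continuous_oddPow (one_lt_conj hp)).continuousAt.comp
    (h3.div continuous_gaussDensity.continuousAt (gaussDensity_pos t).ne'))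

end Limits

/-! ### Differentiability with respect to the end point -/

section Minorants

/-- A function with differentiable minorants touching at every point grows at least like the
integral of their derivatives. -/
theorem integral_le_sub_of_minorants {Q q : ℝ → ℝ} {a b : ℝ} (hab : a ≤ b) {s : Set ℝ}
    (hs : IsOpen s) (hsub : Icc a b ⊆ s) (hQ : ContinuousOn Q s) (hq : ContinuousOn q s)
    (hK : ∀ x ∈ s, ∃ K : ℝ → ℝ, HasDerivAt K (q x) x ∧ K x = Q x ∧ ∀ᶠ z in 𝓝 x, K z ≤ Q z) :
    ∫ y in a..b, q y ≤ Q b - Q a := by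
  have hqi : ∀ x ∈ Icc a b, IntervalIntegrable q volume a x := fun x hx =>
    (hq.mono ((uIcc_of_le hx.1).subset.trans ((Icc_subset_Icc_right hx.2).trans
      hsub))).intervalIntegrable
  have hd : ∀ x ∈ Icc a b, HasDerivAt (fun z => -Q a - ∫ y in a..z, q y) (-q x) x := fun x hx =>
    (intervalIntegral.integral_hasDerivAt_right (hqi x hx)
      (hq.stronglyMeasurableAtFilter hs x (hsub hx)) (hq.continuousAt (hs.mem_nhds (hsub hx)))).const_sub
      _
  -- A touching minorant `K` of `Q` bounds the right difference quotients of `-Q` above by those of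
  -- `-K`, which tend to `-q`. The one-sided mean value inequality then compares `-Q` with the
  -- primitive of `-q`.
  have := image_le_of_liminf_slope_right_le_deriv_boundary (f := fun x => -Q x)
    (B := fun z => -Q a - ∫ y in a..z, q y) (B' := fun x => -q x) (hQ.mono hsub).neg (by simp)
    (fun x hx => (hd x hx).continuousAt.continuousWithinAt)
    (fun x hx => (hd x (Ico_subset_Icc_self hx)).hasDerivWithinAt) (fun x hx r hr => ?_)
    (right_mem_Icc.2 hab)
  · linarith
  · obtain ⟨K, hKd, hKx, hKle⟩ := hK x (hsub (Ico_subset_Icc_self hx))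
    have h1 : Tendsto (slope (fun z => -K z) x) (𝓝[>] x) (𝓝 (-q x)) :=
      (hasDerivAt_iff_tendsto_slope.1 hKd.neg).mono_left
        (nhdsWithin_mono x fun z hz => ne_of_gt hz)
    refine Eventually.frequently ?_
    filter_upwards [h1.eventually (gt_mem_nhds hr), hKle.filter_mono nhdsWithin_le_nhds,
      self_mem_nhdsWithin] with z hz hzK hzx
    refine lt_of_le_of_lt ?_ hz
    simp only [slope_def_field]
    have : 0 < z - x := sub_pos.2 hzx
    gcongr ?_ / _
    linarith

/-- Minorants that touch are valid on both sides of the contact point, so the integral inequality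
also holds for the reflected function `Q (-z)`. This is the reverse inequality: `Q` is a primitive
of the continuous function `q`. -/
theorem hasDerivAt_of_minorants {Q q : ℝ → ℝ} {s : Set ℝ} (hs : IsOpen s) (hQ : ContinuousOn Q s)
    (hq : ContinuousOn q s)
    (hK : ∀ x ∈ s, ∃ K : ℝ → ℝ, HasDerivAt K (q x) x ∧ K x = Q x ∧ ∀ᶠ z in 𝓝 x, K z ≤ Q z)
    {x : ℝ} (hx : x ∈ s) : HasDerivAt Q (q x) x := by
  obtain ⟨ε, hε, hball⟩ := Metric.isOpen_iff.1 hs x hx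
  rw [Real.ball_eq_Ioo] at hball
  have hsub : ∀ {a b}, a ∈ Ioo (x - ε) (x + ε) → b ∈ Ioo (x - ε) (x + ε) → Icc a b ⊆ s :=
    fun ha hb z hz => hball ⟨ha.1.trans_le hz.1, hz.2.trans_lt hb.2⟩
  have key : ∀ {a b}, a ∈ Ioo (x - ε) (x + ε) → b ∈ Ioo (x - ε) (x + ε) → a ≤ b →
      ∫ y in a..b, q y = Q b - Q a := by
    intro a b ha hb hab
    refine le_antisymm (integral_le_sub_of_minorants hab hs (hsub ha hb) hQ hq hK) ?_
    have hneg : ContinuousOn (fun z : ℝ => -z) (Neg.neg ⁻¹' s) := continuous_neg.continuousOn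
    have := integral_le_sub_of_minorants (Q := fun z => Q (-z)) (q := fun z => -q (-z))
      (neg_le_neg hab) (s := Neg.neg ⁻¹' s) (hs.preimage continuous_neg)
      (fun z hz => hsub ha hb ⟨by linarith [hz.2], by linarith [hz.1]⟩)
      (hQ.comp hneg fun z hz => hz) (hq.comp hneg fun z hz => hz).neg fun z hz => by
        obtain ⟨K, hKd, hKx, hKle⟩ := hK (-z) hz
        refine ⟨fun z => K (-z), ?_, hKx, (continuous_neg.tendsto z).eventually hKle⟩
        have := hKd.comp z (hasDerivAt_neg z)
        rw [mul_neg_one] at this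
        exact this
    simp only [neg_neg, intervalIntegral.integral_neg, intervalIntegral.integral_comp_neg] at this
    linarith
  have hxm : x ∈ Ioo (x - ε) (x + ε) := ⟨by linarith, by linarith⟩
  have hd : HasDerivAt (fun z => Q x + ∫ y in x..z, q y) (q x) x :=
    (intervalIntegral.integral_hasDerivAt_right (by simp) (hq.stronglyMeasurableAtFilter hs x hx)
      (hq.continuousAt (hs.mem_nhds hx))).const_add _
  refine hd.congr_of_eventuallyEq ?_
  filter_upwards [Ioo_mem_nhds hxm.1 hxm.2] with z hz
  rcases le_total x z with h | h
  · rw [key hxm hz h]; ring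
  · rw [intervalIntegral.integral_symm, key hz hxm h]; ring

end Minorants

/-! ### Linear extensions as competitors and the derivative of the rigidity on half-lines -/

section Competitor

variable {p α r : ℝ} {U : ℝ → ℝ}

/-- The gradient of the competitor: the slope of the solution, frozen beyond the end point. -/
noncomputable def frozenSlope (p α r : ℝ) (U : ℝ → ℝ) (x : ℝ) : ℝ := torsionSlope p α U (min x r)

/-- The linear extension of the solution beyond the end point. -/
noncomputable def linearExtension (p α r : ℝ) (U : ℝ → ℝ) (x : ℝ) : ℝ :=
  ∫ y in x..r, frozenSlope p α r U y

theorem continuous_frozenSlope (hp : 1 < p) (h : IsRegularSolution p α r U) :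
    Continuous (frozenSlope p α r U) :=
  (continuous_torsionSlope hp h.memLp).comp (continuous_id.min continuous_const)

theorem frozenSlope_of_le {x : ℝ} (hx : x ≤ r) :
    frozenSlope p α r U x = torsionSlope p α U x := by rw [frozenSlope, min_eq_left hx]

theorem frozenSlope_of_ge {x : ℝ} (hx : r ≤ x) :
    frozenSlope p α r U x = torsionSlope p α U r := by rw [frozenSlope, min_eq_right hx]

theorem linearExtension_of_le (h : IsRegularSolution p α r U) {x : ℝ} (hx : x ≤ r) :
    linearExtension p α r U x = U x := by
  rw [linearExtension, h.eq_integral x hx]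
  refine intervalIntegral.integral_congr fun y hy => ?_
  rw [uIcc_of_le hx] at hy
  exact frozenSlope_of_le hy.2

theorem linearExtension_eq (h : IsRegularSolution p α r U) (x : ℝ) :
    linearExtension p α r U x = U x - torsionSlope p α U r * max (x - r) 0 := by
  rcases le_total x r with hx | hx
  · rw [linearExtension_of_le h hx, max_eq_right (by linarith), mul_zero, sub_zero]
  · rw [linearExtension, intervalIntegral.integral_symm, h.eq_zero x hx, max_eq_left (by linarith)]
    have : ∫ y in r..x, frozenSlope p α r U y = ∫ _ in r..x, torsionSlope p α U r := by
      refine intervalIntegral.integral_congr fun y hy => ?_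
      rw [uIcc_of_le hx] at hy
      exact frozenSlope_of_ge hy.1
    rw [this, intervalIntegral.integral_const, smul_eq_mul]
    ring

theorem hasDerivAt_linearExtension (hp : 1 < p) (h : IsRegularSolution p α r U) (x : ℝ) :
    HasDerivAt (linearExtension p α r U) (-frozenSlope p α r U x) x :=
  intervalIntegral.integral_hasDerivAt_left ((continuous_frozenSlope hp h).intervalIntegrable _ _)
    ((continuous_frozenSlope hp h).stronglyMeasurableAtFilter _ _)
    (continuous_frozenSlope hp h).continuousAt

theorem memLp_id_gaussMeasure (p : ℝ) :
    MemLp (fun x : ℝ => x) (ENNReal.ofReal p) (gaussMeasure ℝ) := by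
  rw [gaussMeasure_real_eq]
  exact ProbabilityTheory.memLp_id_gaussianReal p.toNNReal

theorem memLp_linearExtension (h : IsRegularSolution p α r U) :
    MemLp (linearExtension p α r U) (ENNReal.ofReal p) (gaussMeasure ℝ) := by
  have h1 : MemLp (fun x : ℝ => max (x - r) 0) (ENNReal.ofReal p) (gaussMeasure ℝ) := by
    have h2 : MemLp (fun x : ℝ => x - r) (ENNReal.ofReal p) (gaussMeasure ℝ) :=
      (memLp_id_gaussMeasure p).sub (memLp_const r)
    refine h2.mono (by fun_prop) (Eventually.of_forall fun x => ?_)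
    rw [Real.norm_of_nonneg (le_max_right _ _), Real.norm_eq_abs]
    exact max_le (le_abs_self _) (abs_nonneg _)
  rw [funext (linearExtension_eq h)]
  exact h.memLp.sub (h1.const_mul _)

theorem memLp_frozenSlope (hp : 1 < p) (h : IsRegularSolution p α r U) :
    MemLp (frozenSlope p α r U) (ENNReal.ofReal p) (gaussMeasure ℝ) := by
  have h1 : MemLp ((Iio r).indicator (torsionSlope p α U)) (ENNReal.ofReal p) (gaussMeasure ℝ) :=
    (memLp_indicator_iff_restrict measurableSet_Iio).2 h.memLp_slope
  have h2 : MemLp ((Ici r).indicator fun _ => torsionSlope p α U r) (ENNReal.ofReal p)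
      (gaussMeasure ℝ) := (memLp_const _).indicator measurableSet_Ici
  refine (h1.add h2).congr_norm (continuous_frozenSlope hp h).aestronglyMeasurable
    (Eventually.of_forall fun x => ?_)
  rcases lt_or_ge x r with hx | hx
  · simp [frozenSlope_of_le hx.le, hx, not_le.2 hx]
  · simp [frozenSlope_of_ge hx, hx, not_lt.2 hx]

/-- The competitor on `(-∞, s)`. -/
theorem memGaussSobolevZero_linearExtension (hp : 1 < p) (h : IsRegularSolution p α r U) (s : ℝ) :
    MemGaussSobolevZero p (Iio s)
      (fun x => linearExtension p α r U x - linearExtension p α r U s)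
      (fun x => -frozenSlope p α r U x) := by
  refine memGaussSobolevZero_of_ae_eq hp
    (((memLp_linearExtension h).sub (memLp_const _)).restrict _)
    ((memLp_frozenSlope hp h).restrict _).neg (Eventually.of_forall fun x => ?_)
  have hi := fun a b => (continuous_frozenSlope hp h).intervalIntegrable (μ := volume) a b
  rw [intervalIntegral.integral_neg, neg_neg, linearExtension, linearExtension,
    ← intervalIntegral.integral_add_adjacent_intervals (hi x s) (hi s r), add_sub_cancel_right]

theorem gaussMeasure_real_Ico_le {a b : ℝ} (hab : a ≤ b) :
    (gaussMeasure ℝ).real (Ico a b) ≤ b - a := by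
  have h1 : ∀ x : ℝ, gaussDensity x ≤ 1 := fun x => by
    rw [gaussDensity_real]
    have h2 : 1 / (2 * Real.pi) ^ ((1 : ℝ) / 2) ≤ 1 := by
      rw [div_le_one (by positivity)]
      exact Real.one_le_rpow (by nlinarith [Real.pi_gt_three]) (by norm_num)
    have h3 : Real.exp (-(x ^ 2) / 2) ≤ 1 := Real.exp_le_one_iff.2 (by nlinarith [sq_nonneg x])
    exact mul_le_one₀ h2 (Real.exp_pos _).le h3
  have h4 : gaussMeasure ℝ (Ico a b) ≤ ENNReal.ofReal (b - a) := by
    rw [gaussMeasure, withDensity_apply _ measurableSet_Ico]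
    calc ∫⁻ x in Ico a b, ENNReal.ofReal (gaussDensity x) ≤ ∫⁻ _ in Ico a b, 1 :=
          lintegral_mono fun x => ENNReal.ofReal_le_one.2 (h1 x)
      _ = _ := by simp
  exact ENNReal.toReal_le_of_le_ofReal (by linarith) h4

theorem abs_setIntegral_Iio_sub_le {f : ℝ → ℝ} (hf : Integrable f (gaussMeasure ℝ)) {a b B : ℝ}
    (hB : ∀ x ∈ uIcc a b, |f x| ≤ B) :
    |(∫ x in Iio b, f x ∂(gaussMeasure ℝ)) - ∫ x in Iio a, f x ∂(gaussMeasure ℝ)| ≤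
      B * |b - a| := by
  wlog hab : a ≤ b generalizing a b
  · rw [abs_sub_comm, abs_sub_comm b a]
    exact this (by rwa [uIcc_comm]) (le_of_not_ge hab)
  rw [← Iio_union_Ico_eq_Iio hab, setIntegral_union
    (disjoint_left.2 fun x (hx : x ∈ Iio a) hx' => not_lt.2 hx'.1 hx) measurableSet_Ico
    hf.integrableOn hf.integrableOn, add_sub_cancel_left, abs_of_nonneg (sub_nonneg.2 hab)]
  have hB0 : 0 ≤ B := (abs_nonneg _).trans (hB a left_mem_uIcc)
  calc |∫ x in Ico a b, f x ∂(gaussMeasure ℝ)| ≤ B * (gaussMeasure ℝ).real (Ico a b) := by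
        rw [← Real.norm_eq_abs]
        exact norm_setIntegral_le_of_norm_le_const (measure_lt_top _ _) fun x hx =>
          hB x (Icc_subset_uIcc (Ico_subset_Icc_self hx))
    _ ≤ B * (b - a) := by
        gcongr
        exact gaussMeasure_real_Ico_le hab

/-- Replacing the domain of integration by a fixed one costs only second order, when the
integrand is small near the end point. -/
theorem hasDerivAt_setIntegral_of_small {f : ℝ → ℝ → ℝ} {D : ℝ} {B : ℝ → ℝ}
    (hf : ∀ s, Integrable (f s) (gaussMeasure ℝ)) (hB : Tendsto B (𝓝 r) (𝓝 0))
    (hfB : ∀ᶠ s in 𝓝 r, ∀ x ∈ uIcc r s, |f s x| ≤ B s)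
    (hd : HasDerivAt (fun s => ∫ x in Iio r, f s x ∂(gaussMeasure ℝ)) D r) :
    HasDerivAt (fun s => ∫ x in Iio s, f s x ∂(gaussMeasure ℝ)) D r := by
  have h0 : HasDerivAt (fun s => (∫ x in Iio s, f s x ∂(gaussMeasure ℝ)) -
      ∫ x in Iio r, f s x ∂(gaussMeasure ℝ)) 0 r := by
    rw [hasDerivAt_iff_isLittleO]
    simp only [sub_self, sub_zero, smul_zero]
    rw [Asymptotics.isLittleO_iff]
    intro c hc
    filter_upwards [hfB, hB.eventually (gt_mem_nhds hc)] with s hs hsc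
    rw [Real.norm_eq_abs, Real.norm_eq_abs]
    exact (abs_setIntegral_Iio_sub_le (hf s) hs).trans
      (mul_le_mul_of_nonneg_right hsc.le (abs_nonneg _))
  have := h0.add hd
  rw [zero_add] at this
  refine this.congr_of_eventuallyEq (Eventually.of_forall fun s => ?_)
  simp

/-- The functional evaluated along the competitors is differentiable at the end point. -/
theorem hasDerivAt_competitor (hp : 1 < p) (h : IsRegularSolution p α r U) :
    HasDerivAt (fun s => torsionFunctional p α (Iio s)
      (fun x => linearExtension p α r U x - linearExtension p α r U s)
      (fun x => -frozenSlope p α r U x))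
      ((p - 1) * |torsionSlope p α U r| ^ p * gaussDensity r) r := by
  have hp0 : 0 < p := by linarith
  set E := linearExtension p α r U with hE
  set d := torsionSlope p α U r with hd
  have hEr : E r = 0 := by rw [hE, linearExtension, intervalIntegral.integral_same]
  have hEd : HasDerivAt (fun s => -E s) d r := by
    have := (hasDerivAt_linearExtension hp h r).neg
    rwa [neg_neg, frozenSlope_of_le le_rfl] at this
  have hEc : Continuous E := continuous_iff_continuousAt.2 fun x =>
    (hasDerivAt_linearExtension hp h x).continuousAt
  have hEL := memLp_linearExtension h
  rw [← hE] at hEL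
  have hUr : MemLp U (ENNReal.ofReal p) ((gaussMeasure ℝ).restrict (Iio r)) := h.memLp.restrict _
  -- bound of the shifted extension between `r` and `s`
  have hsmall : ∀ q : ℝ, 0 < q → ∃ B : ℝ → ℝ, Tendsto B (𝓝 r) (𝓝 0) ∧
      ∀ᶠ s in 𝓝 r, ∀ x ∈ uIcc r s, |E x - E s| ^ q ≤ B s := by
    intro q hq
    obtain ⟨C, hC⟩ := (isCompact_Icc (a := r - 1) (b := r + 1)).exists_bound_of_continuousOn
      (continuous_frozenSlope hp h).continuousOn
    have hC0 : 0 ≤ C := (norm_nonneg _).trans (hC r ⟨by linarith, by linarith⟩)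
    refine ⟨fun s => (C * |s - r|) ^ q, ?_, ?_⟩
    · have hc : Continuous fun s => (C * |s - r|) ^ q :=
        Continuous.rpow_const (by fun_prop) fun s => Or.inr hq.le
      have := hc.tendsto r
      simpa [hq.ne'] using this
    · filter_upwards [Icc_mem_nhds (show r - 1 < r by linarith) (show r < r + 1 by linarith)]
        with s hs x hx
      refine Real.rpow_le_rpow (abs_nonneg _) ?_ hq.le
      have hsub : uIcc r s ⊆ Icc (r - 1) (r + 1) :=
        uIcc_subset_Icc ⟨by linarith, by linarith⟩ hs
      have h1 := (convex_uIcc r s).norm_image_sub_le_of_norm_hasDerivWithin_le (f := E)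
        (f' := fun y => -frozenSlope p α r U y) (C := C)
        (fun y hy => (hasDerivAt_linearExtension hp h y).hasDerivWithinAt)
        (fun y hy => by rw [norm_neg]; exact hC y (hsub hy)) right_mem_uIcc hx
      rw [Real.norm_eq_abs, Real.norm_eq_abs] at h1
      refine h1.trans (mul_le_mul_of_nonneg_left ?_ hC0)
      rw [abs_sub_comm]
      exact abs_sub_right_of_mem_uIcc hx
  have hshift : ∀ s, MemLp (fun x => E x - E s) (ENNReal.ofReal p) (gaussMeasure ℝ) := fun s =>
    hEL.sub (memLp_const _)
  have hEU : ∀ x < r, E x = U x := fun x hx => linearExtension_of_le h hx.le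
  -- the gradient term
  have d1 : HasDerivAt (fun s => ∫ x in Iio s, ‖-frozenSlope p α r U x‖ ^ p ∂(gaussMeasure ℝ))
      (gaussDensity r * |d| ^ p) r := by
    have hi := (memLp_frozenSlope hp h).neg.integrable_norm_rpow_ofReal hp
    have hc : Continuous fun x => ‖-frozenSlope p α r U x‖ ^ p :=
      Continuous.rpow_const (continuous_frozenSlope hp h).neg.norm fun x => Or.inr hp0.le
    have := hasDerivAt_setIntegral_Iio hi hc.continuousAt (y := r)
    simpa [frozenSlope_of_le le_rfl] using this
  -- the power term
  have d2 : HasDerivAt (fun s => ∫ x in Iio s, |E x - E s| ^ p ∂(gaussMeasure ℝ))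
      (p * (∫ x in Iio r, oddPow p (U x) ∂(gaussMeasure ℝ)) * d) r := by
    obtain ⟨B, hB, hBs⟩ := hsmall p hp0
    -- Between `r` and `s` the shifted extension is of order `s - r`, so the change of domain is of
    -- second order. Only the vertical shift by `-E s`, whose derivative at `r` is `d`, contributes.
    refine hasDerivAt_setIntegral_of_small (fun s => (hshift s).integrable_norm_rpow_ofReal hp) hB
      (hBs.mono fun s hs x hx => by
        rw [abs_of_nonneg (Real.rpow_nonneg (abs_nonneg _) _)]; exact hs x hx) ?_
    have h1 := hasDerivAt_integral_abs_add_rpow hp hUr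
      (memLp_const (1 : ℝ) : MemLp (fun _ => (1 : ℝ)) (ENNReal.ofReal p)
        ((gaussMeasure ℝ).restrict (Iio r)))
    have h2 := HasDerivAt.comp (h₂ := fun ε : ℝ => ∫ x in Iio r, |U x + ε * 1| ^ p ∂(gaussMeasure ℝ))
      r (by simpa [hEr] using h1) hEd
    simp only [mul_one] at h2
    refine h2.congr_of_eventuallyEq (Eventually.of_forall fun s => ?_)
    refine setIntegral_congr_fun measurableSet_Iio fun x hx => ?_
    simp only [hEU x hx]
    ring_nf
  have d3 : HasDerivAt (fun s => ∫ x in Iio s, (E x - E s) ∂(gaussMeasure ℝ))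
      (d * (gaussMeasure ℝ).real (Iio r)) r := by
    obtain ⟨B, hB, hBs⟩ := hsmall 1 one_pos
    refine hasDerivAt_setIntegral_of_small
      (fun s => (hshift s).integrable (by simpa using hp.le)) hB
      (hBs.mono fun s hs x hx => by simpa using hs x hx) ?_
    have h1 := (hEd.mul_const ((gaussMeasure ℝ).real (Iio r))).const_add
      (∫ x in Iio r, E x ∂(gaussMeasure ℝ))
    refine h1.congr_of_eventuallyEq (Eventually.of_forall fun s => ?_)
    simp only
    rw [integral_sub (hEL.integrable (by simpa using hp.le)).integrableOn (integrable_const _),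
      setIntegral_const, smul_eq_mul]
    ring
  have hK := (d1.neg.add (d2.const_mul α)).add (d3.const_mul p)
  refine hK.congr_deriv ?_
  have hφ := gaussDensity_pos r
  -- The integrated equation at the end point: the contribution of the shift becomes `p φ |d|^p`,
  -- against `-φ |d|^p` from the gradient term, which leaves the factor `p - 1`.
  have hflux : α * (∫ x in Iio r, oddPow p (U x) ∂(gaussMeasure ℝ)) + (gaussMeasure ℝ).real (Iio r) =
      gaussDensity r * oddPow p d := by
    rw [hd, oddPow_torsionSlope hp, mul_div_cancel₀ _ hφ.ne', torsionFlux, integral_add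
      ((integrable_oddPow hp hUr).const_mul α) (integrable_const _), integral_const_mul,
      setIntegral_const, smul_eq_mul, mul_one]
  have h5 := oddPow_mul_self hp d
  calc -(gaussDensity r * |d| ^ p) +
        α * (p * (∫ x in Iio r, oddPow p (U x) ∂(gaussMeasure ℝ)) * d) +
        p * (d * (gaussMeasure ℝ).real (Iio r))
      = -(gaussDensity r * |d| ^ p) +
        p * d * (α * (∫ x in Iio r, oddPow p (U x) ∂(gaussMeasure ℝ)) +
          (gaussMeasure ℝ).real (Iio r)) := by ring
    _ = _ := by rw [hflux, ← h5]; ring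

variable {t T : ℝ} {V : ℝ → ℝ → ℝ}

/-- Derivative of the rigidity of `(-∞, s)` with respect to the end point. -/
theorem hasDerivAt_integral_solution (hp : 1 < p) (hV : ∀ s ≤ T, IsRegularSolution p α s (V s))
    (h0 : ∀ s ≤ T, ∀ x, 0 ≤ V s x) (ht : t < T) :
    HasDerivAt (fun s => (p - 1) * ∫ x in Iio s, V s x ∂(gaussMeasure ℝ))
      ((p - 1) * |torsionSlope p α (V t) t| ^ p * gaussDensity t) t := by
  have hcQ : ContinuousOn (fun s => (p - 1) * ∫ x in Iio s, V s x ∂(gaussMeasure ℝ)) (Iio T) :=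
    fun s hs => ((continuousAt_integral_solution hp hV h0 hs continuous_id rfl monotone_id
      ((hV T le_rfl).integrable hp)).const_smul (p - 1)).continuousWithinAt
  have hcq : ContinuousOn (fun s => (p - 1) * |torsionSlope p α (V s) s| ^ p * gaussDensity s)
      (Iio T) := fun s hs => by
    have h1 := continuousAt_torsionSlope_endpoint hp hV h0 hs
    exact (((h1.abs.rpow_const (Or.inr (by linarith))).const_smul (p - 1)).mul
      continuous_gaussDensity.continuousAt).continuousWithinAt
  refine hasDerivAt_of_minorants isOpen_Iio hcQ hcq (fun r hr => ?_) ht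
  have hr' : r < T := hr
  -- The competitor is built from the solution at `r` but is admissible on `(-∞, s)` for every `s`;
  -- its functional lies below the rigidity and equals it at `s = r`.
  refine ⟨_, hasDerivAt_competitor hp (hV r hr'.le), ?_, ?_⟩
  · rw [← (hV r hr'.le).torsionFunctional_eq hp]
    have hs : linearExtension p α r (V r) r = 0 := intervalIntegral.integral_same
    have e1 : ∀ x ∈ Iio r, linearExtension p α r (V r) x = V r x := fun x hx =>
      linearExtension_of_le (hV r hr'.le) (le_of_lt hx)
    have e2 : ∀ x ∈ Iio r, frozenSlope p α r (V r) x = torsionSlope p α (V r) x := fun x hx =>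
      frozenSlope_of_le (le_of_lt hx)
    simp only [torsionFunctional, hs, sub_zero]
    have e3 : ∀ x ∈ Iio r, ‖-frozenSlope p α r (V r) x‖ ^ p = ‖-torsionSlope p α (V r) x‖ ^ p :=
      fun x hx => by rw [e2 x hx]
    have e4 : ∀ x ∈ Iio r, |linearExtension p α r (V r) x| ^ p = |V r x| ^ p :=
      fun x hx => by rw [e1 x hx]
    rw [setIntegral_congr_fun measurableSet_Iio e1, setIntegral_congr_fun measurableSet_Iio e3,
      setIntegral_congr_fun measurableSet_Iio e4]
  · filter_upwards [gt_mem_nhds hr'] with s hs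
    have h1 := le_genTorsionalRigidity (α := α)
      (memGaussSobolevZero_linearExtension hp (hV r hr'.le) s)
    rw [(hV s (le_of_lt hs)).genTorsionalRigidity_eq hp (h0 s (le_of_lt hs))] at h1
    exact EReal.coe_le_coe_iff.1 h1

end Competitor

/-! ### Reduction of half-spaces to half-lines -/

theorem isProbabilityMeasure_gaussMeasure
    (V : Type*) [NormedAddCommGroup V] [InnerProductSpace ℝ V] [FiniteDimensional ℝ V]
    [MeasurableSpace V] [BorelSpace V] :
    IsProbabilityMeasure (@gaussMeasure V _ _ measureSpaceOfInnerProductSpace) := by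
  constructor
  have hb : (0 : ℝ) < 1 / 2 := by norm_num
  have hI := GaussianFourier.integral_rexp_neg_mul_sq_norm (V := V) hb
  have hpos : 0 < (Real.pi / (1 / 2)) ^ ((Module.finrank ℝ V : ℝ) / 2) := by positivity
  -- Integrability is read off from the known nonzero value, since the integral of a nonintegrable
  -- function is zero by convention.
  have hi : Integrable fun v : V => Real.exp (-(1 / 2) * ‖v‖ ^ 2) := by
    by_contra hcon
    rw [integral_undef hcon] at hI
    exact hpos.ne hI
  rw [gaussMeasure, withDensity_apply _ MeasurableSet.univ, Measure.restrict_univ]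
  have he : (fun v : V => gaussDensity v) =
      fun v => 1 / (2 * Real.pi) ^ ((Module.finrank ℝ V : ℝ) / 2) * Real.exp (-(1 / 2) * ‖v‖ ^ 2) := by
    funext v
    rw [gaussDensity]
    congr 2
    ring
  have hgi : Integrable fun v : V => gaussDensity v := by
    rw [he]; exact hi.const_mul _
  rw [← ofReal_integral_eq_lintegral_ofReal hgi (Eventually.of_forall fun v => (gaussDensity_pos v).le),
    he, integral_const_mul, hI, show Real.pi / (1 / 2) = 2 * Real.pi by ring,
    one_div_mul_cancel (by positivity), ENNReal.ofReal_one]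

section HalfSpace

variable {n : ℕ}

instance (N : ℕ) : IsProbabilityMeasure (gaussMeasure (EuclideanSpace ℝ (Fin N))) :=
  isProbabilityMeasure_gaussMeasure _

/-- The point of `ℝ^{n+1}` with given first coordinate and remaining coordinates. -/
noncomputable def euclideanCons (z : ℝ × EuclideanSpace ℝ (Fin n)) :
    EuclideanSpace ℝ (Fin (n + 1)) :=
  WithLp.toLp 2 (Fin.cons z.1 z.2)

@[simp] theorem euclideanCons_zero (z : ℝ × EuclideanSpace ℝ (Fin n)) :
    euclideanCons z 0 = z.1 := rfl

theorem continuous_euclideanCons : Continuous (euclideanCons (n := n)) := by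
  unfold euclideanCons; fun_prop

theorem measurePreserving_euclideanCons_volume :
    MeasurePreserving (euclideanCons (n := n)) ((volume : Measure ℝ).prod volume) volume := by
  have h1 : MeasurePreserving (Prod.map (id : ℝ → ℝ) (WithLp.ofLp (p := 2) (V := Fin n → ℝ)))
      ((volume : Measure ℝ).prod volume) (volume.prod volume) :=
    (MeasurePreserving.id volume).prod (PiLp.volume_preserving_ofLp (Fin n))
  have h2 := (volume_preserving_piFinSuccAbove (fun _ : Fin (n + 1) => ℝ) 0).symm
  have h3 := (PiLp.volume_preserving_toLp (Fin (n + 1))).comp (h2.comp h1)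
  have he : euclideanCons (n := n) = WithLp.toLp 2 ∘
      ⇑(MeasurableEquiv.piFinSuccAbove (fun _ : Fin (n + 1) => ℝ) 0).symm ∘
        Prod.map (id : ℝ → ℝ) (WithLp.ofLp (p := 2) (V := Fin n → ℝ)) := by
    funext z
    ext i
    refine Fin.cases ?_ (fun j => ?_) i <;> rfl
  rw [he]
  exact h3

theorem gaussDensity_euclideanCons (z : ℝ × EuclideanSpace ℝ (Fin n)) :
    gaussDensity (euclideanCons z) = gaussDensity z.1 * gaussDensity z.2 := by
  have h1 : ‖euclideanCons z‖ ^ 2 = z.1 ^ 2 + ‖z.2‖ ^ 2 := by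
    rw [EuclideanSpace.norm_sq_eq, EuclideanSpace.norm_sq_eq, Fin.sum_univ_succ]
    simp [euclideanCons]
  have h2 : (2 * Real.pi) ^ (((n + 1 : ℕ) : ℝ) / 2) =
      (2 * Real.pi) ^ ((1 : ℝ) / 2) * (2 * Real.pi) ^ ((n : ℝ) / 2) := by
    rw [← Real.rpow_add (by positivity)]
    congr 1
    push_cast
    ring
  have h3 : Real.exp (-(z.1 ^ 2 + ‖z.2‖ ^ 2) / 2) =
      Real.exp (-(z.1 ^ 2) / 2) * Real.exp (-(‖z.2‖ ^ 2) / 2) := by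
    rw [← Real.exp_add]; congr 1; ring
  rw [gaussDensity_real, gaussDensity, gaussDensity, h1, finrank_euclideanSpace_fin,
    finrank_euclideanSpace_fin, h2, h3]
  field_simp

theorem measurePreserving_euclideanCons :
    MeasurePreserving (euclideanCons (n := n))
      ((gaussMeasure ℝ).prod (gaussMeasure (EuclideanSpace ℝ (Fin n))))
      (gaussMeasure (EuclideanSpace ℝ (Fin (n + 1)))) := by
  refine ⟨continuous_euclideanCons.measurable, Measure.ext fun s hs => ?_⟩
  have hm : ∀ k, Measurable fun x : EuclideanSpace ℝ (Fin k) => ENNReal.ofReal (gaussDensity x) :=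
    fun k => continuous_gaussDensity.measurable.ennreal_ofReal
  rw [Measure.map_apply continuous_euclideanCons.measurable hs, gaussMeasure, gaussMeasure,
    prod_withDensity continuous_gaussDensity.measurable.ennreal_ofReal (hm n),
    withDensity_apply _ (continuous_euclideanCons.measurable hs), gaussMeasure,
    withDensity_apply _ hs, ← measurePreserving_euclideanCons_volume.setLIntegral_comp_preimage hs
      (hm (n + 1))]
  refine lintegral_congr fun z => ?_
  rw [gaussDensity_euclideanCons, ENNReal.ofReal_mul (gaussDensity_pos _).le]

theorem preimage_euclideanCons_halfSpace (t : ℝ) :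
    euclideanCons (n := n) ⁻¹' halfSpace (n + 1) t = Iio t ×ˢ univ := by
  ext z
  simp [halfSpace]

theorem isOpen_halfSpace (t : ℝ) : IsOpen (halfSpace (n + 1) t) :=
  isOpen_lt (by fun_prop) continuous_const

theorem measurePreserving_euclideanCons_halfSpace (t : ℝ) :
    MeasurePreserving (euclideanCons (n := n))
      (((gaussMeasure ℝ).restrict (Iio t)).prod (gaussMeasure (EuclideanSpace ℝ (Fin n))))
      ((gaussMeasure (EuclideanSpace ℝ (Fin (n + 1)))).restrict (halfSpace (n + 1) t)) := by
  have := measurePreserving_euclideanCons.restrict_preimage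
    (isOpen_halfSpace (n := n) t).measurableSet
  rwa [preimage_euclideanCons_halfSpace, ← Measure.prod_restrict, Measure.restrict_univ] at this

/-- Fubini on a half-space. -/
theorem setIntegral_halfSpace {t : ℝ} {f : EuclideanSpace ℝ (Fin (n + 1)) → ℝ}
    (hf : IntegrableOn f (halfSpace (n + 1) t) (gaussMeasure _)) :
    Integrable (fun z => f (euclideanCons z))
      (((gaussMeasure ℝ).restrict (Iio t)).prod (gaussMeasure (EuclideanSpace ℝ (Fin n)))) ∧
    ∫ x in halfSpace (n + 1) t, f x ∂(gaussMeasure _) =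
      ∫ y, ∫ x in Iio t, f (euclideanCons (x, y)) ∂(gaussMeasure ℝ)
        ∂(gaussMeasure (EuclideanSpace ℝ (Fin n))) := by
  have hmp := measurePreserving_euclideanCons_halfSpace (n := n) t
  have h1 : Integrable (fun z => f (euclideanCons z))
      (((gaussMeasure ℝ).restrict (Iio t)).prod (gaussMeasure (EuclideanSpace ℝ (Fin n)))) :=
    hmp.integrable_comp_of_integrable hf
  refine ⟨h1, ?_⟩
  rw [← integral_prod_symm _ h1, ← hmp.map_eq, integral_map hmp.aemeasurable]
  rw [hmp.map_eq]
  exact hf.aestronglyMeasurable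

/-- Functions of the first coordinate. -/
theorem setIntegral_halfSpace_comp_zero (t : ℝ) {f : ℝ → ℝ}
    (hf : IntegrableOn f (Iio t) (gaussMeasure ℝ)) :
    ∫ x in halfSpace (n + 1) t, f (x 0) ∂(gaussMeasure (EuclideanSpace ℝ (Fin (n + 1)))) =
      ∫ x in Iio t, f x ∂(gaussMeasure ℝ) := by
  have hmp := measurePreserving_euclideanCons_halfSpace (n := n) t
  have hfst : MeasurePreserving (fun x : EuclideanSpace ℝ (Fin (n + 1)) => x 0)
      ((gaussMeasure (EuclideanSpace ℝ (Fin (n + 1)))).restrict (halfSpace (n + 1) t))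
      ((gaussMeasure ℝ).restrict (Iio t)) := by
    refine ⟨by fun_prop, ?_⟩
    rw [← hmp.map_eq, Measure.map_map (by fun_prop) hmp.measurable]
    exact (measurePreserving_fst (ν := gaussMeasure (EuclideanSpace ℝ (Fin n)))).map_eq
  rw [← hfst.map_eq, integral_map hfst.aemeasurable]
  rw [hfst.map_eq]
  exact hf.aestronglyMeasurable

theorem euclideanCons_eq_add_smul (x : ℝ) (y : EuclideanSpace ℝ (Fin n)) :
    euclideanCons (x, y) = euclideanCons (0, y) + x • EuclideanSpace.single 0 (1 : ℝ) := by
  ext i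
  refine Fin.cases ?_ (fun j => ?_) i
  · simp
  · rw [PiLp.add_apply, PiLp.smul_apply]
    simp only [euclideanCons, Fin.cons_succ, PiLp.single_apply, Fin.succ_ne_zero, if_false, smul_zero,
      add_zero]

theorem contDiff_euclideanCons_left (y : EuclideanSpace ℝ (Fin n)) :
    ContDiff ℝ (⊤ : ℕ∞) fun x : ℝ => euclideanCons (x, y) := by
  rw [funext fun x => euclideanCons_eq_add_smul x y]
  fun_prop

theorem hasDerivAt_euclideanCons_left (y : EuclideanSpace ℝ (Fin n)) (x : ℝ) :
    HasDerivAt (fun x : ℝ => euclideanCons (x, y)) (EuclideanSpace.single 0 (1 : ℝ)) x := by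
  rw [funext fun x => euclideanCons_eq_add_smul x y]
  simpa using ((hasDerivAt_id x).smul_const
    (EuclideanSpace.single (0 : Fin (n + 1)) (1 : ℝ))).const_add (euclideanCons (0, y))

/-- Slices of test functions on a half-space are test functions on a half-line. -/
theorem IsTestFunction.slice {t : ℝ} {w : EuclideanSpace ℝ (Fin (n + 1)) → ℝ}
    (hw : IsTestFunction (halfSpace (n + 1) t) w) (y : EuclideanSpace ℝ (Fin n)) :
    IsTestFunction (Iio t) fun x => w (euclideanCons (x, y)) := by
  have hc : Continuous fun x : ℝ => euclideanCons (x, y) :=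
    continuous_euclideanCons.comp (Continuous.prodMk_left y)
  have hsub : tsupport (fun x => w (euclideanCons (x, y))) ⊆
      (fun x : ℝ => euclideanCons (x, y)) ⁻¹' tsupport w :=
    tsupport_comp_subset_preimage w hc
  refine ⟨hw.1.comp (contDiff_euclideanCons_left y), ?_, fun x hx => ?_⟩
  · have hK : IsCompact ((fun x : EuclideanSpace ℝ (Fin (n + 1)) => x 0) '' tsupport w) :=
      (show IsCompact (tsupport w) from hw.2.1).image (by fun_prop)
    exact hK.of_isClosed_subset (isClosed_tsupport _) fun x hx => ⟨_, hsub hx, rfl⟩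
  · exact hw.2.2 (hsub hx)

theorem abs_gradient_slice_le {t : ℝ} {w : EuclideanSpace ℝ (Fin (n + 1)) → ℝ}
    (hw : IsTestFunction (halfSpace (n + 1) t) w) (x : ℝ) (y : EuclideanSpace ℝ (Fin n)) :
    ‖gradient (fun x => w (euclideanCons (x, y))) x‖ ≤ ‖gradient w (euclideanCons (x, y))‖ := by
  have h1 : HasDerivAt (fun x => w (euclideanCons (x, y)))
      (fderiv ℝ w (euclideanCons (x, y)) (EuclideanSpace.single 0 1)) x :=
    (hw.differentiable _).hasFDerivAt.comp_hasDerivAt x (hasDerivAt_euclideanCons_left y x)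
  rw [gradient_real, h1.deriv, ← inner_gradient]
  refine (norm_inner_le_norm _ _).trans ?_
  simp

variable {p α t : ℝ}

/-- Each slice in the first variable is a one-dimensional competitor, and forgetting the transverse
part of the gradient only raises the functional. Averaging over the remaining variables keeps the
bound `M` because their measure has mass one. -/
theorem torsionFunctional_halfSpace_le (hp : 1 < p) {M : ℝ}
    (hM : ∀ w : ℝ → ℝ, IsTestFunction (Iio t) w →
      torsionFunctional p α (Iio t) w (gradient w) ≤ M)
    {w : EuclideanSpace ℝ (Fin (n + 1)) → ℝ} (hw : IsTestFunction (halfSpace (n + 1) t) w) :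
    torsionFunctional p α (halfSpace (n + 1) t) w (gradient w) ≤ M := by
  have hmem := hw.memGaussSobolev p
  have i1 := setIntegral_halfSpace (hmem.2.2.integrable_norm_rpow_ofReal hp)
  have i2 := setIntegral_halfSpace (hmem.2.1.integrable_norm_rpow_ofReal hp)
  have i3 := setIntegral_halfSpace (hmem.2.1.integrable (by simpa using hp.le))
  have hn : ∫ x in halfSpace (n + 1) t, |w x| ^ p ∂(gaussMeasure _) =
    ∫ x in halfSpace (n + 1) t, ‖w x‖ ^ p ∂(gaussMeasure _) := rfl
  have j1 : Integrable (fun y => -∫ x in Iio t, ‖gradient w (euclideanCons (x, y))‖ ^ p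
    ∂(gaussMeasure ℝ)) (gaussMeasure (EuclideanSpace ℝ (Fin n))) := i1.1.integral_prod_right.neg
  have j2 : Integrable (fun y => α * ∫ x in Iio t, ‖w (euclideanCons (x, y))‖ ^ p
    ∂(gaussMeasure ℝ)) (gaussMeasure (EuclideanSpace ℝ (Fin n))) :=
    i2.1.integral_prod_right.const_mul α
  have j12 := j1.add j2
  simp only [Pi.add_def] at j12
  have j3 : Integrable (fun y => p * ∫ x in Iio t, w (euclideanCons (x, y)) ∂(gaussMeasure ℝ))
    (gaussMeasure (EuclideanSpace ℝ (Fin n))) := i3.1.integral_prod_right.const_mul p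
  rw [torsionFunctional, i1.2, hn, i2.2, i3.2, ← integral_const_mul, ← integral_const_mul,
    ← integral_neg, ← integral_add j1 j2, ← integral_add j12 j3]
  have hconst : M = ∫ _ : EuclideanSpace ℝ (Fin n), M ∂(gaussMeasure _) := by simp
  rw [hconst]
  refine integral_mono_ae (j12.add j3) (integrable_const _) ?_
  filter_upwards [i1.1.prod_left_ae] with y hy
  refine le_trans ?_ (hM _ (hw.slice y))
  unfold torsionFunctional
  have : ∫ x in Iio t, ‖gradient (fun x => w (euclideanCons (x, y))) x‖ ^ p ∂(gaussMeasure ℝ) ≤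
      ∫ x in Iio t, ‖gradient w (euclideanCons (x, y))‖ ^ p ∂(gaussMeasure ℝ) :=
    integral_mono (((hw.slice y).memGaussSobolev p).2.2.integrable_norm_rpow_ofReal hp) hy
      fun x => Real.rpow_le_rpow (norm_nonneg _) (abs_gradient_slice_le hw x y) (by linarith)
  simp only [Real.norm_eq_abs (w _)]
  linarith

/-- Extension of a one-dimensional test function by cutoffs in the remaining directions. -/
noncomputable def cylinderExtension (n : ℕ) (w : ℝ → ℝ) (k : ℕ) (x : EuclideanSpace ℝ (Fin (n + 1))) : ℝ :=
  w (x 0) * cutoff (EuclideanSpace ℝ (Fin (n + 1))) k x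

theorem isTestFunction_cylinder {w : ℝ → ℝ} (hw : IsTestFunction (Iio t) w) (k : ℕ) :
    IsTestFunction (halfSpace (n + 1) t) (cylinderExtension n w k) := by
  have hw0 : ContDiff ℝ (⊤ : ℕ∞) fun x : EuclideanSpace ℝ (Fin (n + 1)) => w (x 0) :=
    hw.1.comp (by fun_prop)
  refine ⟨hw0.mul (contDiff_cutoff k), (hasCompactSupport_cutoff k).mul_left, ?_⟩
  refine (tsupport_mul_subset_left).trans ?_
  exact (tsupport_comp_subset_preimage w
    (show Continuous fun x : EuclideanSpace ℝ (Fin (n + 1)) => x 0 by fun_prop)).trans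
    (preimage_mono hw.2.2)

theorem hasFDerivAt_comp_zero {w : ℝ → ℝ} (hw : IsTestFunction (Iio t) w)
    (x : EuclideanSpace ℝ (Fin (n + 1))) :
    HasFDerivAt (fun x : EuclideanSpace ℝ (Fin (n + 1)) => w (x 0))
      (deriv w (x 0) • (EuclideanSpace.proj 0 : EuclideanSpace ℝ (Fin (n + 1)) →L[ℝ] ℝ)) x :=
  (hw.differentiable (x 0)).hasDerivAt.comp_hasFDerivAt x
    (EuclideanSpace.proj (0 : Fin (n + 1)) : EuclideanSpace ℝ (Fin (n + 1)) →L[ℝ] ℝ).hasFDerivAt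

theorem norm_gradient_comp_zero {w : ℝ → ℝ} (hw : IsTestFunction (Iio t) w)
    (x : EuclideanSpace ℝ (Fin (n + 1))) :
    ‖gradient (fun x : EuclideanSpace ℝ (Fin (n + 1)) => w (x 0)) x‖ = |deriv w (x 0)| := by
  have : gradient (fun x : EuclideanSpace ℝ (Fin (n + 1)) => w (x 0)) x =
      deriv w (x 0) • EuclideanSpace.single 0 (1 : ℝ) := by
    refine ext_inner_right ℝ fun e => ?_
    rw [inner_gradient, (hasFDerivAt_comp_zero hw x).fderiv, inner_smul_left]
    simp [EuclideanSpace.inner_single_left]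
  rw [this, norm_smul]
  simp

/-- Equality of germs settles the pointwise convergence of values and gradients at once. -/
theorem cylinder_eventuallyEq (w : ℝ → ℝ) (x : EuclideanSpace ℝ (Fin (n + 1))) :
    ∀ᶠ k : ℕ in atTop, cylinderExtension n w k =ᶠ[𝓝 x] fun x => w (x 0) := by
  obtain ⟨m, hm⟩ := exists_nat_ge ‖x‖
  filter_upwards [eventually_ge_atTop m] with k hk
  have hk' : (m : ℝ) ≤ k := by exact_mod_cast hk
  have : ∀ᶠ y in 𝓝 x, ‖y‖ < (k : ℝ) + 1 :=
    continuous_norm.continuousAt.eventually_lt continuousAt_const (by linarith)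
  filter_upwards [this] with y hy
  rw [cylinderExtension, cutoff_eq_one hy.le, mul_one]

/-- A bound independent of `k` gives domination by a constant, which is integrable for a probability
measure. -/
theorem exists_norm_gradient_cylinder_le {w : ℝ → ℝ} (hw : IsTestFunction (Iio t) w) :
    ∃ C : ℝ, ∀ (k : ℕ) (x : EuclideanSpace ℝ (Fin (n + 1))), ‖gradient (cylinderExtension n w k) x‖ ≤ C := by
  obtain ⟨C0, hC0⟩ := hw.2.1.exists_bound_of_continuous hw.continuous
  obtain ⟨C1, hC1⟩ := hw.2.1.deriv.exists_bound_of_continuous (hw.1.continuous_deriv (by simp))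
  obtain ⟨C, hC, hcut⟩ := exists_norm_fderiv_cutoff_le (E := EuclideanSpace ℝ (Fin (n + 1)))
  have hC0' : 0 ≤ C0 := (norm_nonneg _).trans (hC0 0)
  refine ⟨C0 * C + C1, fun k x => ?_⟩
  have hd := (hasFDerivAt_comp_zero hw x).mul
    ((contDiff_cutoff (E := EuclideanSpace ℝ (Fin (n + 1))) k).differentiable
      (by simp) x).hasFDerivAt
  have hfd : fderiv ℝ (cylinderExtension n w k) x = _ := hd.fderiv
  have hnp : ‖deriv w (x 0) • (EuclideanSpace.proj 0 : EuclideanSpace ℝ (Fin (n + 1)) →L[ℝ] ℝ)‖ ≤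
      C1 := by
    rw [← (hasFDerivAt_comp_zero hw x).fderiv]
    have := norm_gradient_comp_zero hw x
    rw [gradient, LinearIsometryEquiv.norm_map] at this
    rw [this]
    exact hC1 _
  have hcut' : ‖fderiv ℝ (cutoff (EuclideanSpace ℝ (Fin (n + 1))) k) x‖ ≤ C := by
    refine (hcut k x).trans (mul_le_of_le_one_right hC ?_)
    rw [div_le_one (by positivity)]
    have : (0 : ℝ) ≤ k := Nat.cast_nonneg k
    linarith
  rw [gradient, LinearIsometryEquiv.norm_map, hfd]
  refine (norm_add_le _ _).trans (add_le_add ?_ ?_)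
  · rw [norm_smul]
    exact mul_le_mul (hC0 _) hcut' (norm_nonneg _) hC0'
  · rw [norm_smul]
    calc _ ≤ 1 * C1 := mul_le_mul (abs_cutoff_le_one k x) hnp (norm_nonneg _) zero_le_one
      _ = C1 := one_mul _

/-- The integrals of the cylinders converge to the one-dimensional ones. -/
theorem tendsto_cylinder (hp : 1 < p) {w : ℝ → ℝ} (hw : IsTestFunction (Iio t) w) :
    Tendsto (fun k => ∫ x in halfSpace (n + 1) t, ‖gradient (cylinderExtension n w k) x‖ ^ p
      ∂(gaussMeasure _)) atTop (𝓝 (∫ x in Iio t, ‖gradient w x‖ ^ p ∂(gaussMeasure ℝ))) ∧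
    Tendsto (fun k => ∫ x in halfSpace (n + 1) t, |cylinderExtension n w k x| ^ p ∂(gaussMeasure _)) atTop
      (𝓝 (∫ x in Iio t, |w x| ^ p ∂(gaussMeasure ℝ))) ∧
    Tendsto (fun k => ∫ x in halfSpace (n + 1) t, cylinderExtension n w k x ∂(gaussMeasure _)) atTop
      (𝓝 (∫ x in Iio t, w x ∂(gaussMeasure ℝ))) := by
  have hp0 : 0 ≤ p := by linarith
  have hmem := hw.memGaussSobolev p
  have htest := fun k => isTestFunction_cylinder (n := n) hw k
  have hval : ∀ x, ∀ᶠ k in atTop, cylinderExtension n w k x = w (x 0) := fun x =>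
    (cylinder_eventuallyEq w x).mono fun k hk => hk.eq_of_nhds
  have hgrad : ∀ x, ∀ᶠ k in atTop, ‖gradient (cylinderExtension n w k) x‖ = ‖gradient w (x 0)‖ := fun x =>
    (cylinder_eventuallyEq w x).mono fun k hk => by
      rw [gradient, hk.fderiv_eq, ← gradient, norm_gradient_comp_zero hw, gradient_real,
        Real.norm_eq_abs]
  obtain ⟨C1, hC1⟩ := exists_norm_gradient_cylinder_le (n := n) hw
  obtain ⟨C0, hC0⟩ := hw.2.1.exists_bound_of_continuous hw.continuous
  have hb0 : ∀ k x, |cylinderExtension n w k x| ≤ C0 := fun k x => by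
    rw [cylinderExtension, abs_mul]
    calc _ ≤ C0 * 1 := mul_le_mul (hC0 _) (abs_cutoff_le_one k x) (abs_nonneg _)
          ((norm_nonneg _).trans (hC0 0))
      _ = C0 := mul_one _
  refine ⟨?_, ?_, ?_⟩
  · rw [← setIntegral_halfSpace_comp_zero (n := n) t (hmem.2.2.integrable_norm_rpow_ofReal hp)]
    refine tendsto_integral_of_dominated_convergence (fun _ => C1 ^ p)
      (fun k => ?_) (integrable_const _) (fun k => Eventually.of_forall fun x => ?_)
      (Eventually.of_forall fun x => ?_)
    · exact (Continuous.rpow_const (htest k).continuous_gradient.norm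
        fun x => Or.inr hp0).aestronglyMeasurable
    · rw [Real.norm_of_nonneg (Real.rpow_nonneg (norm_nonneg _) _)]
      exact Real.rpow_le_rpow (norm_nonneg _) (hC1 k x) hp0
    · exact tendsto_const_nhds.congr' ((hgrad x).mono fun k hk => by simp only [hk])
  · rw [← setIntegral_halfSpace_comp_zero (n := n) (f := fun x => |w x| ^ p) t
      (hmem.2.1.integrable_norm_rpow_ofReal hp)]
    refine tendsto_integral_of_dominated_convergence (fun _ => C0 ^ p)
      (fun k => ?_) (integrable_const _) (fun k => Eventually.of_forall fun x => ?_)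
      (Eventually.of_forall fun x => ?_)
    · exact (Continuous.rpow_const (htest k).continuous.abs
        fun x => Or.inr hp0).aestronglyMeasurable
    · rw [Real.norm_of_nonneg (Real.rpow_nonneg (abs_nonneg _) _)]
      exact Real.rpow_le_rpow (abs_nonneg _) (hb0 k x) hp0
    · exact tendsto_const_nhds.congr' ((hval x).mono fun k hk => by simp only [hk])
  · rw [← setIntegral_halfSpace_comp_zero (n := n) t (hmem.2.1.integrable (by simpa using hp.le))]
    refine tendsto_integral_of_dominated_convergence (fun _ => C0)
      (fun k => (htest k).continuous.aestronglyMeasurable) (integrable_const _)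
      (fun k => Eventually.of_forall (hb0 k)) (Eventually.of_forall fun x => ?_)
    exact tendsto_const_nhds.congr' ((hval x).mono fun k hk => by simp only [hk])

/-- The first eigenvalue of the half-space bounds one-dimensional Rayleigh quotients. -/
theorem firstEigenvalue_halfSpace_mul_le (hp : 1 < p) {w : ℝ → ℝ} (hw : IsTestFunction (Iio t) w) :
    firstEigenvalue p (halfSpace (n + 1) t) * ∫ x in Iio t, |w x| ^ p ∂(gaussMeasure ℝ) ≤
      ∫ x in Iio t, ‖gradient w x‖ ^ p ∂(gaussMeasure ℝ) := by
  have hp0 : 0 < p := by linarith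
  obtain ⟨h1, h2, -⟩ := tendsto_cylinder (n := n) hp hw
  refine le_of_tendsto_of_tendsto' (h2.const_mul _) h1 fun k => ?_
  set v := cylinderExtension n w k with hv
  have hvt : IsTestFunction (halfSpace (n + 1) t) v := isTestFunction_cylinder hw k
  have hg0 : 0 ≤ ∫ x in halfSpace (n + 1) t, ‖gradient v x‖ ^ p ∂(gaussMeasure _) :=
    integral_nonneg fun x => Real.rpow_nonneg (norm_nonneg _) _
  have hv0 : 0 ≤ ∫ x in halfSpace (n + 1) t, |v x| ^ p ∂(gaussMeasure _) :=
    integral_nonneg fun x => Real.rpow_nonneg (abs_nonneg _) _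
  -- The Rayleigh quotient is defined through nonzero functions only, so a vanishing denominator is
  -- treated apart.
  rcases hv0.eq_or_lt with h | h
  · rw [← h, mul_zero]; exact hg0
  · rw [← le_div_iff₀ h]
    refine csInf_le ⟨0, ?_⟩ ⟨v, gradient v, hvt.memGaussSobolevZero p, fun hz => ?_, rfl⟩
    · rintro _ ⟨u, G, -, -, rfl⟩
      exact div_nonneg (integral_nonneg fun x => Real.rpow_nonneg (norm_nonneg _) _)
        (integral_nonneg fun x => Real.rpow_nonneg (abs_nonneg _) _)
    · refine h.ne' (integral_eq_zero_of_ae ?_)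
      filter_upwards [hz] with x hx
      simp [hx, hp0.ne']

/-- The rigidity of the half-space is that of the half-line. -/
theorem IsRegularSolution.genTorsionSharp_eq (hp : 1 < p) {u : ℝ → ℝ}
    (h : IsRegularSolution p α t u) (h0 : ∀ x, 0 ≤ u x) :
    genTorsionSharp (n + 1) p α t =
      (((p - 1) * ∫ x in Iio t, u x ∂(gaussMeasure ℝ) : ℝ) : EReal) := by
  refine le_antisymm (genTorsionalRigidity_le hp fun w hw => torsionFunctional_halfSpace_le hp
    (fun w hw => h.torsionFunctional_le hp h0 le_rfl hw) hw) ?_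
  have hlow : ∀ w : ℝ → ℝ, IsTestFunction (Iio t) w →
      (torsionFunctional p α (Iio t) w (gradient w) : EReal) ≤ genTorsionSharp (n + 1) p α t :=
    fun w hw => by
      obtain ⟨h1, h2, h3⟩ := tendsto_cylinder (n := n) hp hw
      have h4 := (continuous_coe_real_ereal.tendsto _).comp
        ((h1.neg.add (h2.const_mul α)).add (h3.const_mul p))
      exact le_of_tendsto' h4 fun k =>
        le_genTorsionalRigidity ((isTestFunction_cylinder hw k).memGaussSobolevZero p)
  -- The maximizer on the half-line is reached in two limits: by test functions on the line, and
  -- each of these by cylinders in the half-space.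
  obtain ⟨w, hw, -, -, -, hlim⟩ := (h.memGaussSobolevZero hp).exists_seq_tendsto hp
  have h5 := (continuous_coe_real_ereal.tendsto _).comp (hlim α)
  rw [h.torsionFunctional_eq hp] at h5
  exact le_of_tendsto' h5 fun k => hlow _ (hw k)

end HalfSpace

/-! ### The main theorem -/

section Main

variable {n : ℕ} {p α t : ℝ}

/-- Solutions exist for all end points up to some `T > t`. This replaces any continuity of the first
eigenvalue in the end point: nearby half-spaces need not be shown to satisfy the eigenvalue
condition. -/
theorem exists_solution_family (hp : 1 < p) (ht : α < firstEigenvalue p (halfSpace (n + 1) t)) :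
    ∃ (T : ℝ) (V : ℝ → ℝ → ℝ), t < T ∧ (∀ s ≤ T, IsRegularSolution p α s (V s)) ∧
      ∀ s ≤ T, ∀ x, 0 ≤ V s x := by
  obtain ⟨T, hT, hex⟩ := exists_isRegularSolution_nhds hp ht
    fun w hw => firstEigenvalue_halfSpace_mul_le hp hw
  choose! V hV using hex
  exact ⟨T, V, hT, fun s hs => (hV s hs).1, fun s hs => (hV s hs).2⟩

theorem exists_solution (hp : 1 < p) (ht : α < firstEigenvalue p (halfSpace (n + 1) t)) :
    ∃ u, IsRegularSolution p α t u ∧ ∀ x, 0 ≤ u x := by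
  obtain ⟨T, V, hT, hV, hV0⟩ := exists_solution_family hp ht
  exact ⟨V t, hV t hT.le, hV0 t hT.le⟩

/-- Comparison on `(-∞, s)` gives the weak inequality, and strictness comes from the positive mass
of the larger solution on `(s, t)`. -/
theorem strictMonoOn_genTorsionSharp (hp : 1 < p) :
    StrictMonoOn (fun t : ℝ => genTorsionSharp (n + 1) p α t)
      {t : ℝ | α < firstEigenvalue p (halfSpace (n + 1) t)} := by
  intro s hs t ht hst
  obtain ⟨u, hu, hu0⟩ := exists_solution hp hs
  obtain ⟨v, hv, hv0⟩ := exists_solution hp ht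
  simp only
  rw [hu.genTorsionSharp_eq hp hu0, hv.genTorsionSharp_eq hp hv0, EReal.coe_lt_coe_iff]
  refine mul_lt_mul_of_pos_left ?_ (sub_pos.2 hp)
  refine lt_of_le_of_lt ?_ (hv.lt_integral hp hv0 hst)
  exact integral_mono (hu.integrable hp).integrableOn (hv.integrable hp).integrableOn
    (hu.le hp hst.le hu0 hv hv0)

theorem hasDerivAt_genTorsionSharp (hp : 1 < p) {T : ℝ} {V : ℝ → ℝ → ℝ}
    (hV : ∀ s ≤ T, IsRegularSolution p α s (V s)) (hV0 : ∀ s ≤ T, ∀ x, 0 ≤ V s x) (ht : t < T) :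
    HasDerivAt (fun s : ℝ => (genTorsionSharp (n + 1) p α s).toReal)
      ((p - 1) * |-torsionSlope p α (V t) t| ^ p * gaussDensity t) t := by
  rw [abs_neg]
  refine (hasDerivAt_integral_solution hp hV hV0 ht).congr_of_eventuallyEq ?_
  filter_upwards [gt_mem_nhds ht] with s hs
  rw [(hV s (le_of_lt hs)).genTorsionSharp_eq hp (hV0 s (le_of_lt hs)), EReal.toReal_coe]

end Main

theorem mainTheorem8 (N : ℕ) [NeZero N] (p : ℝ) (hp : 1 < p) (α : ℝ) :
    (∀ t : ℝ, α < firstEigenvalue p (halfSpace N t) →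
      genTorsionSharp N p α t ≠ ⊥ ∧ genTorsionSharp N p α t ≠ ⊤) ∧
    StrictMonoOn (fun t : ℝ => genTorsionSharp N p α t)
      {t : ℝ | α < firstEigenvalue p (halfSpace N t)} ∧
    (∀ t : ℝ, α < firstEigenvalue p (halfSpace N t) →
      ∃ v : ℝ → ℝ,
        IsGenTorsionFunction p α (Iio t) v ∧
        (∀ u : ℝ → ℝ, IsGenTorsionFunction p α (Iio t) u → u =ᵐ[volume.restrict (Iio t)] v) ∧
        ContinuousOn v (Iic t) ∧ (∀ x ∈ Iic t, 0 ≤ v x) ∧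
        ∃ d : ℝ, HasDerivWithinAt v d (Iic t) t ∧
          (∀ᶠ s in 𝓝 t, genTorsionSharp N p α s ≠ ⊤) ∧
          HasDerivAt (fun s : ℝ => (genTorsionSharp N p α s).toReal)
            ((p - 1) * |d| ^ p * gaussDensity t) t) := by
  obtain ⟨n, rfl⟩ := Nat.exists_eq_succ_of_ne_zero (NeZero.ne N)
  refine ⟨fun t ht => ?_, strictMonoOn_genTorsionSharp hp, fun t ht => ?_⟩
  · obtain ⟨u, hu, hu0⟩ := exists_solution (n := n) hp ht
    rw [hu.genTorsionSharp_eq (n := n) hp hu0]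
    exact ⟨EReal.coe_ne_bot _, EReal.coe_ne_top _⟩
  · obtain ⟨T, V, hT, hV, hV0⟩ := exists_solution_family (n := n) hp ht
    have hVt := hV t hT.le
    refine ⟨V t, hVt.isGenTorsionFunction hp, fun u hu => ?_, (hVt.continuous hp).continuousOn,
      fun x _ => hV0 t hT.le x, -torsionSlope p α (V t) t, hVt.hasDerivWithinAt hp, ?_,
      hasDerivAt_genTorsionSharp hp hV hV0 hT⟩
    -- No sign is assumed on `u`. Its regular representative is nonnegative by the Rayleigh bound,
    -- and only then does Picone's uniqueness apply.
    · obtain ⟨w, hw, huw⟩ := hu.exists_regular hp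
      have hw0 := hw.nonneg_of_rayleigh hp ht
        fun z hz => firstEigenvalue_halfSpace_mul_le (n := n) hp hz
      rwa [hVt.unique hp (hV0 t hT.le) hw hw0] at huw
    · filter_upwards [gt_mem_nhds hT] with s hs
      rw [(hV s (le_of_lt hs)).genTorsionSharp_eq (n := n) hp (hV0 s (le_of_lt hs))]
      exact EReal.coe_ne_top _
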